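/- Let $H=(V,E_H)$ be a finite undirected graph, let $k\ge 1$ be an integer, and let $G=(V,E)$ be a graph on the same node set with edge costs $c_e\ge 0$, $e\in E$ (parallel edges are allowed in both graphs). For $S\subseteq V$ and an edge set $J$ let $d_J(S)$ be the number of edges in $J$ with exactly one end in $S$, and let $d_H(S)=d_{E_H}(S)$. In the Small Cuts Cover problem one seeks a minimum-cost edge set $J\subseteq E$ that covers all cuts of size less than $k$ of $H$, that is, such that $d_J(S)\ge 1$ for every $\emptyset\ne S\subsetneq V$ with $d_H(S)<k$; an instance is feasible if such a set $J$ exists. There is a deterministic polynomial-time algorithm for this problem (it performs a number of elementary steps -- additions, subtractions, comparisons and memory accesses -- that is bounded by a polynomial in $|V|+|E_H|+|E|$) with the following property. On every feasible instance it returns a feasible solution $J$, and whenever $H$ is $\lambda$-edge-connected, i.e. $d_H(S)\ge\lambda$ for all $\emptyset\ne S\subsetneq V$, where $\lambda\ge 0$ is an integer, the cost of $J$ is at most $$6-\frac{1}{\beta+1},\qquad \beta=\left\lfloor\frac{k-1}{\lceil(\lambda+1)/2\rceil}\right\rfloor,$$ times the minimum cost of a feasible solution. In other words, Small Cuts Cover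 with a $\lambda$-edge-connected graph $H$ admits approximation ratio $6-\frac{1}{\beta+1}$. -/

import Mathlib

/-! ## Graphs and small cuts -/

/-- A finite undirected multigraph on the node set `Fin n`, given by the list of its edges:
edge number `e` joins `fst e` and `snd e`. Parallel edges are allowed; loops are harmless,
since a loop lies in no cut. -/
structure Multigraph (n : ℕ) where
  /-- the number of edges -/
  m : ℕ
  /-- one end of an edge -/
  fst : Fin m → Fin n
  /-- the other end of an edge -/
  snd : Fin m → Fin n

namespace Multigraph

variable {n : ℕ}

/-- `δ_J(S)`: the edges of `J` with exactly one end in `S`. -/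
def delta (G : Multigraph n) (J : Finset (Fin G.m)) (S : Finset (Fin n)) : Finset (Fin G.m) :=
  J.filter fun e => (G.fst e ∈ S ∧ G.snd e ∉ S) ∨ (G.fst e ∉ S ∧ G.snd e ∈ S)

/-- `d_G(S)`: the number of edges of `G` with exactly one end in `S`. -/
def cutSize (G : Multigraph n) (S : Finset (Fin n)) : ℕ :=
  (G.delta Finset.univ S).card

/-- `G` is `l`-edge-connected: every cut has at least `l` edges. -/
def IsEdgeConnected (G : Multigraph n) (l : ℕ) : Prop :=
  ∀ S : Finset (Fin n), S.Nonempty → S ≠ Finset.univ → l ≤ G.cutSize S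

/-- The family of node sets `∅ ≠ S ⊂ V` with `d_H(S) < k`. -/
def smallCuts (H : Multigraph n) (k : ℕ) : Set (Finset (Fin n)) :=
  {S | S.Nonempty ∧ S ≠ Finset.univ ∧ H.cutSize S < k}

/-- The edge set `J` covers every member of the set family `F`: `d_J(S) ≥ 1` for `S ∈ F`. -/
def Covers (G : Multigraph n) (J : Finset (Fin G.m)) (F : Set (Finset (Fin n))) : Prop :=
  ∀ S ∈ F, 1 ≤ (G.delta J S).card

end Multigraph

/-- An instance of Small Cuts Cover: a graph `H` whose cuts of size `< k` are to be covered, and a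
graph `G` on the same nodes, with non-negative edge costs, whose edges may be used for that. -/
structure SmallCutsInstance where
  /-- the number of nodes -/
  n : ℕ
  /-- the graph whose small cuts are to be covered -/
  H : Multigraph n
  /-- the graph of the available edges -/
  G : Multigraph n
  /-- the edge costs -/
  c : Fin G.m → ℝ
  /-- the threshold -/
  k : ℕ
  c_nonneg : ∀ e, 0 ≤ c e
  k_pos : 1 ≤ k

namespace SmallCutsInstance

/-- `J` is a feasible solution: it covers all cuts of size `< k` of `H`. -/
def IsSolution (I : SmallCutsInstance) (J : Finset (Fin I.G.m)) : Prop :=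
  I.G.Covers J (I.H.smallCuts I.k)

/-- The cost of an edge set. -/
noncomputable def cost (I : SmallCutsInstance) (J : Finset (Fin I.G.m)) : ℝ := ∑ e ∈ J, I.c e

/-- The size of an instance: the number of nodes and edges. The magnitudes of the costs and of `k`
do not enter. -/
def size (I : SmallCutsInstance) : ℕ := I.n + I.H.m + I.G.m

end SmallCutsInstance

/-! ## The model of computation

A random access machine with structured programs. Its memory consists of arrays of natural numbers
and arrays of real numbers; a program names arrays by fixed numbers, so it uses only finitely many,
while indices are computed (indirect addressing). The only operations are addition, (truncated)
subtraction and comparison. The real numbers hold the edge costs; a program has no real constants,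
and real numbers influence natural numbers only through comparisons. Every operation takes one step.
A step lengthens the numbers in memory by at most one bit (over a common denominator, if the
real inputs are rational), so a polynomial number of steps here is polynomial time on a
Turing machine. -/

namespace RAM

/-- The memory: `nat a i` and `real a i` are the entries `i` of the arrays number `a`. -/
structure State where
  nat : ℕ → ℕ → ℕ
  real : ℕ → ℕ → ℝ

/-- Expressions with natural values. -/
inductive NatExp where
  | const (v : ℕ)
  | load (a : ℕ) (i : NatExp)
  | add (x y : NatExp)
  | sub (x y : NatExp)

/-- Expressions with real values. -/
inductive RealExp where
  | load (a : ℕ) (i : NatExp)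
  | add (x y : RealExp)
  | sub (x y : RealExp)

/-- Tests. -/
inductive Test where
  | natLe (x y : NatExp)
  | realLe (x y : RealExp)
  | not (b : Test)
  | and (b d : Test)

/-- Programs. -/
inductive Prog where
  | skip
  /-- write the value of `x` into entry `i` of the array number `a` of natural numbers -/
  | setNat (a : ℕ) (i x : NatExp)
  /-- write the value of `x` into entry `i` of the array number `a` of real numbers -/
  | setReal (a : ℕ) (i : NatExp) (x : RealExp)
  | seq (p q : Prog)
  | ite (b : Test) (p q : Prog)
  /-- repeat `p` while `b` holds -/
  | loop (b : Test) (p : Prog)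

namespace NatExp

def eval (s : State) : NatExp → ℕ
  | const v => v
  | load a i => s.nat a (i.eval s)
  | add x y => x.eval s + y.eval s
  | sub x y => x.eval s - y.eval s

/-- The number of steps of an evaluation. -/
def steps : NatExp → ℕ
  | const _ => 1
  | load _ i => i.steps + 1
  | add x y => x.steps + y.steps + 1
  | sub x y => x.steps + y.steps + 1

end NatExp

namespace RealExp

noncomputable def eval (s : State) : RealExp → ℝ
  | load a i => s.real a (i.eval s)
  | add x y => x.eval s + y.eval s
  | sub x y => x.eval s - y.eval s

/-- The number of steps of an evaluation. -/
def steps : RealExp → ℕ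
  | load _ i => i.steps + 1
  | add x y => x.steps + y.steps + 1
  | sub x y => x.steps + y.steps + 1

end RealExp

namespace Test

def Holds (s : State) : Test → Prop
  | natLe x y => x.eval s ≤ y.eval s
  | realLe x y => x.eval s ≤ y.eval s
  | not b => ¬ b.Holds s
  | and b d => b.Holds s ∧ d.Holds s

/-- The number of steps of an evaluation. -/
def steps : Test → ℕ
  | natLe x y => x.steps + y.steps + 1
  | realLe x y => x.steps + y.steps + 1
  | not b => b.steps + 1
  | and b d => b.steps + d.steps + 1

end Test

namespace State

def setNat (s : State) (a i v : ℕ) : State :=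
  { s with nat := Function.update s.nat a (Function.update (s.nat a) i v) }

noncomputable def setReal (s : State) (a i : ℕ) (v : ℝ) : State :=
  { s with real := Function.update s.real a (Function.update (s.real a) i v) }

end State

/-- `Exec p s t s'`: the program `p`, started in the memory state `s`, halts after `t` steps in the
memory state `s'`. -/
inductive Exec : Prog → State → ℕ → State → Prop where
  | skip (s : State) : Exec .skip s 1 s
  | setNat (a : ℕ) (i x : NatExp) (s : State) :
      Exec (.setNat a i x) s (i.steps + x.steps + 1) (s.setNat a (i.eval s) (x.eval s))
  | setReal (a : ℕ) (i : NatExp) (x : RealExp) (s : State) :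
      Exec (.setReal a i x) s (i.steps + x.steps + 1) (s.setReal a (i.eval s) (x.eval s))
  | seq {p q : Prog} {s s' s'' : State} {t t' : ℕ} (hp : Exec p s t s') (hq : Exec q s' t' s'') :
      Exec (.seq p q) s (t + t') s''
  | iteTrue {b : Test} {p q : Prog} {s s' : State} {t : ℕ} (hb : b.Holds s) (hp : Exec p s t s') :
      Exec (.ite b p q) s (b.steps + 1 + t) s'
  | iteFalse {b : Test} {p q : Prog} {s s' : State} {t : ℕ} (hb : ¬ b.Holds s)
      (hq : Exec q s t s') : Exec (.ite b p q) s (b.steps + 1 + t) s'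
  | loopTrue {b : Test} {p : Prog} {s s' s'' : State} {t t' : ℕ} (hb : b.Holds s)
      (hp : Exec p s t s') (hl : Exec (.loop b p) s' t' s'') :
      Exec (.loop b p) s (b.steps + 1 + t + t') s''
  | loopFalse {b : Test} {p : Prog} {s : State} (hb : ¬ b.Holds s) :
      Exec (.loop b p) s (b.steps + 1) s

end RAM

namespace SmallCutsInstance

/-- The memory at the start. Array 0 of natural numbers holds the number of nodes, the number of
edges of `H`, the number of edges of `G`, and `k`; the arrays 1 and 2 hold the two ends of the edges
of `H`, the arrays 3 and 4 those of the edges of `G`; array 0 of real numbers holds the costs.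
All other entries are zero. -/
noncomputable def input (I : SmallCutsInstance) : RAM.State where
  nat a i :=
    match a with
    | 0 => match i with
      | 0 => I.n
      | 1 => I.H.m
      | 2 => I.G.m
      | 3 => I.k
      | _ => 0
    | 1 => if h : i < I.H.m then (I.H.fst ⟨i, h⟩ : ℕ) else 0
    | 2 => if h : i < I.H.m then (I.H.snd ⟨i, h⟩ : ℕ) else 0
    | 3 => if h : i < I.G.m then (I.G.fst ⟨i, h⟩ : ℕ) else 0
    | 4 => if h : i < I.G.m then (I.G.snd ⟨i, h⟩ : ℕ) else 0
    | _ => 0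
  real a i :=
    match a with
    | 0 => if h : i < I.G.m then I.c ⟨i, h⟩ else 0
    | _ => 0

/-- The edge set that is read off the memory at the end: array 5 of natural numbers marks the chosen
edges of `G` by non-zero entries. -/
def output (I : SmallCutsInstance) (s : RAM.State) : Finset (Fin I.G.m) :=
  Finset.univ.filter fun e => s.nat 5 e ≠ 0

end SmallCutsInstance

/-- `β = ⌊(k - 1) / ⌈(l + 1) / 2⌉⌋`, for `k ≥ 1`. -/
def betaParam (k l : ℕ) : ℕ :=
  ⌊((k : ℚ) - 1) / (⌈((l : ℚ) + 1) / 2⌉₊ : ℚ)⌋₊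

set_option linter.unusedSectionVars false

/-! The algorithm is the primal-dual method with reverse deletion. Its ratio is at most 5 for every
`H`, and `6 - 1 / (β + 1) ≥ 5` because `β ≥ 0`.

For the edge set `J` chosen so far, let `d` be the cut function of `H` together with `k` copies of
`J`. A non-empty set has `d S < k` exactly if it is a small set of `H` that `J` does not cover,
where the whole node set counts as small. So the uncovered cuts are a sublevel set of a symmetric
submodular function. Its inclusion-minimal members are pairwise disjoint, and `J` is a solution if
and only if there are fewer than two of them (`isSolution_iff_card`). As long as there are two, the
dual variables of all of them grow at the same rate until an edge becomes tight; this edge is added.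
At the end, edges are examined in reverse order of addition and redundant ones are deleted. By weak
duality (`cost_le_five_mul`) it is enough that in each round the surviving edges have average degree
at most 5 over the minimal small sets (`sum_card_separates_le_five_mul`).

For this bound, each surviving edge has a witness, a small set that it alone covers, and uncrossing
makes the witnesses laminar (`exists_laminar_witness`). The structural fact is that a small set
properly meets at most one minimal small set (`IsSmall.meets_unique`). A potential with values 2 to
5 on the laminar forest does the counting: a set that is the smallest one around some minimal small
set has potential 5, and there are at most as many of these as minimal small sets; every other set
is charged to one of its children, and the child's potential also pays for the ends of the child's
edge (`endCount_add_rank_le`).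

Minimal small sets are found by maximum adjacency orderings. The last class of an ordering either
has cut weight below `k` and is itself a minimal small set (`LabelInv.found`), or no minimal small
set still sought separates it from its predecessor, so that the two may be merged
(`LabelInv.merge`). All loops run over nodes or edges, which gives the polynomial bound
(`exec_compile`). The machine cannot divide, so residual costs are kept up to a scaling factor that
is halved with each added edge. -/

/-! ## Cut functions -/

/-- Exactly one of the nodes `u` and `v` lies in `S`. -/
def Separates {V : Type*} (S : Finset V) (u v : V) : Prop :=
  (u ∈ S ∧ v ∉ S) ∨ (u ∉ S ∧ v ∈ S)

instance {V : Type*} [DecidableEq V] (S : Finset V) (u v : V) : Decidable (Separates S u v) :=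
  inferInstanceAs (Decidable (_ ∨ _))

/-- The total weight of the edges with exactly one end in `S`, where edge `e` joins `a e` and `b e`
and has weight `ω e`. -/
def cutWeight {V ι : Type*} [DecidableEq V] [Fintype ι] (a b : ι → V) (ω : ι → ℕ)
    (S : Finset V) : ℕ :=
  ∑ e, if Separates S (a e) (b e) then ω e else 0

section CutWeight

variable {V ι : Type*} [DecidableEq V] [Fintype ι] (a b : ι → V) (ω : ι → ℕ)

theorem cutWeight_inter_add_union (A B : Finset V) :
    cutWeight a b ω (A ∩ B) + cutWeight a b ω (A ∪ B) ≤ cutWeight a b ω A + cutWeight a b ω B := by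
  simp only [cutWeight, ← Finset.sum_add_distrib]
  refine Finset.sum_le_sum fun e _ => ?_
  by_cases h1 : a e ∈ A <;> by_cases h2 : a e ∈ B <;> by_cases h3 : b e ∈ A <;>
    by_cases h4 : b e ∈ B <;> simp [Separates, h1, h2, h3, h4]

theorem cutWeight_sdiff_add_sdiff (A B : Finset V) :
    cutWeight a b ω (A \ B) + cutWeight a b ω (B \ A) ≤ cutWeight a b ω A + cutWeight a b ω B := by
  simp only [cutWeight, ← Finset.sum_add_distrib]
  refine Finset.sum_le_sum fun e _ => ?_
  by_cases h1 : a e ∈ A <;> by_cases h2 : a e ∈ B <;> by_cases h3 : b e ∈ A <;>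
    by_cases h4 : b e ∈ B <;> simp [Separates, h1, h2, h3, h4]

theorem cutWeight_compl [Fintype V] (A : Finset V) : cutWeight a b ω Aᶜ = cutWeight a b ω A := by
  refine Finset.sum_congr rfl fun e _ => ?_
  by_cases h1 : a e ∈ A <;> by_cases h3 : b e ∈ A <;> simp [Separates, h1, h3]

/-- The inequality holds edge by edge. The factor two on `S` is needed for an edge inside `A` cut by
`S`, which is counted for both `S ∩ A` and `A \ S`. -/
theorem cutWeight_four_le (S A B : Finset V) (hAB : Disjoint A B) :
    cutWeight a b ω (S ∩ A) + cutWeight a b ω (A \ S) + cutWeight a b ω (S ∩ B)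
      + cutWeight a b ω (B \ S)
      ≤ cutWeight a b ω A + cutWeight a b ω B + (cutWeight a b ω S + cutWeight a b ω S) := by
  simp only [cutWeight, ← Finset.sum_add_distrib]
  refine Finset.sum_le_sum fun e _ => ?_
  have ha : a e ∈ A → a e ∉ B := fun h h' => Finset.disjoint_left.1 hAB h h'
  have hb : b e ∈ A → b e ∉ B := fun h h' => Finset.disjoint_left.1 hAB h h'
  by_cases h1 : a e ∈ A <;> by_cases h2 : a e ∈ B <;> by_cases h3 : b e ∈ A <;>
    by_cases h4 : b e ∈ B <;> by_cases h5 : a e ∈ S <;> by_cases h6 : b e ∈ S <;>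
    simp [Separates, h1, h2, h3, h4, h5, h6] <;> first | omega | tauto

end CutWeight

/-! ## Minimal small sets -/

/-- The non-empty sets (the set of all nodes included) of cut weight below `k`. -/
def IsSmall {V : Type*} (d : Finset V → ℕ) (k : ℕ) (S : Finset V) : Prop :=
  S.Nonempty ∧ d S < k

/-- The inclusion-minimal non-empty sets of cut weight below `k`. -/
def IsMinSmall {V : Type*} (d : Finset V → ℕ) (k : ℕ) (C : Finset V) : Prop :=
  IsSmall d k C ∧ ∀ D ⊆ C, IsSmall d k D → D = C

/-- The set of all inclusion-minimal non-empty sets of cut weight below `k`. -/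
noncomputable def minSmall {V : Type*} [Fintype V] (d : Finset V → ℕ) (k : ℕ) :
    Finset (Finset V) :=
  open scoped Classical in Finset.univ.filter (IsMinSmall d k)

theorem mem_minSmall {V : Type*} [Fintype V] {d : Finset V → ℕ} {k : ℕ} {C : Finset V} :
    C ∈ minSmall d k ↔ IsMinSmall d k C := by simp [minSmall]

theorem IsSmall.exists_minSmall {V : Type*} [Fintype V] {d : Finset V → ℕ} {k : ℕ}
    {S : Finset V} (h : IsSmall d k S) : ∃ C ∈ minSmall d k, C ⊆ S := by
  induction hn : S.card using Nat.strong_induction_on generalizing S with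
  | _ n ih =>
    by_cases hm : IsMinSmall d k S
    · exact ⟨S, mem_minSmall.2 hm, subset_rfl⟩
    · simp only [IsMinSmall, not_and, not_forall] at hm
      obtain ⟨D, hD, hD', hne⟩ := hm h
      obtain ⟨C, hC, hCD⟩ := ih D.card
        (hn ▸ Finset.card_lt_card (hD.ssubset_of_ne hne)) hD' rfl
      exact ⟨C, hC, hCD.trans hD⟩

section MinSmall

variable {V ι : Type*} [Fintype V] [DecidableEq V] [Fintype ι] {a b : ι → V} {ω : ι → ℕ} {k : ℕ}
  {C D S : Finset V}

local notation "d" => cutWeight a b ω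

theorem IsMinSmall.le_of_ssubset (hC : IsMinSmall d k C) (hD : D ⊂ C) (hne : D.Nonempty) :
    k ≤ d D := by
  by_contra h
  exact hD.ne (hC.2 D hD.subset ⟨hne, not_le.1 h⟩)

/-- If `C` and `D` met, both differences would be non-empty proper subsets, hence of weight at least
`k`, against posimodularity. -/
theorem IsMinSmall.disjoint (hC : IsMinSmall d k C) (hD : IsMinSmall d k D) (hne : C ≠ D) :
    Disjoint C D := by
  by_contra h
  rw [Finset.disjoint_iff_inter_eq_empty, ← ne_eq, ← Finset.nonempty_iff_ne_empty] at h
  have h1 : ¬ C ⊆ D := fun h' => hne (hD.2 C h' hC.1)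
  have h2 : ¬ D ⊆ C := fun h' => hne (hC.2 D h' hD.1).symm
  obtain ⟨z, hz⟩ := h
  rw [Finset.mem_inter] at hz
  have e1 := hC.le_of_ssubset (D := C \ D)
    ⟨Finset.sdiff_subset, fun h' => (Finset.mem_sdiff.1 (h' hz.1)).2 hz.2⟩
    (Finset.sdiff_nonempty.2 h1)
  have e2 := hD.le_of_ssubset (D := D \ C)
    ⟨Finset.sdiff_subset, fun h' => (Finset.mem_sdiff.1 (h' hz.2)).2 hz.1⟩
    (Finset.sdiff_nonempty.2 h2)
  have := cutWeight_sdiff_add_sdiff a b ω C D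
  have := hC.1.2
  have := hD.1.2
  omega

theorem IsMinSmall.eq_of_mem (hC : IsMinSmall d k C) (hD : IsMinSmall d k D) {z : V}
    (h1 : z ∈ C) (h2 : z ∈ D) : C = D := by
  by_contra h
  exact Finset.disjoint_left.1 (hC.disjoint hD h) h1 h2

/-- `C` meets `S` without being contained in it. -/
def Meets (S C : Finset V) : Prop := (S ∩ C).Nonempty ∧ ¬ C ⊆ S

theorem IsMinSmall.le_inter (hC : IsMinSmall d k C) (h : Meets S C) : k ≤ d (S ∩ C) :=
  hC.le_of_ssubset ⟨Finset.inter_subset_right,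
    fun h' => h.2 fun _ hz => (Finset.mem_inter.1 (h' hz)).1⟩ h.1

theorem IsMinSmall.le_sdiff (hC : IsMinSmall d k C) (h : Meets S C) : k ≤ d (C \ S) := by
  obtain ⟨z, hz⟩ := h.1
  rw [Finset.mem_inter] at hz
  exact hC.le_of_ssubset ⟨Finset.sdiff_subset,
    fun h' => (Finset.mem_sdiff.1 (h' hz.2)).2 hz.1⟩ (Finset.sdiff_nonempty.2 h.2)

/-- By minimality the four pieces into which `S` cuts `C` and `D` weigh at least `k` each, but
`cutWeight_four_le` bounds their sum by something below `4 * k`. -/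
theorem IsSmall.meets_unique (hS : IsSmall d k S) (hC : IsMinSmall d k C) (hD : IsMinSmall d k D)
    (h1 : Meets S C) (h2 : Meets S D) : C = D := by
  by_contra hne
  have := cutWeight_four_le a b ω S C D (hC.disjoint hD hne)
  have := hC.le_inter h1
  have := hC.le_sdiff h1
  have := hD.le_inter h2
  have := hD.le_sdiff h2
  have := hC.1.2
  have := hD.1.2
  have := hS.2
  omega

end MinSmall

/-! ## Laminar witnesses -/

/-- `S` is a small set, avoiding `r`, that `e` is the only edge of `J` to cover. -/
structure IsWitness {V κ : Type*} (d : Finset V → ℕ) (k : ℕ) (x y : κ → V) (J : Finset κ) (r : V)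
    (e : κ) (S : Finset V) : Prop where
  small : IsSmall d k S
  root : r ∉ S
  sep : Separates S (x e) (y e)
  unique : ∀ f ∈ J, Separates S (x f) (y f) → f = e

section Laminar

variable {V ι κ : Type*} [Fintype V] [DecidableEq V] [Fintype ι] {a b : ι → V} {ω : ι → ℕ} {k : ℕ}
  {x y : κ → V} {J : Finset κ} {r : V}

local notation "d" => cutWeight a b ω

theorem separates_compl {S : Finset V} {u v : V} : Separates Sᶜ u v ↔ Separates S u v := by
  simp [Separates]; tauto

/-- Cut weights are symmetric, so a set containing the root can be replaced by its complement. -/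
theorem exists_isWitness {e : κ} {S : Finset V} (hS : IsSmall d k S) (hne : S ≠ Finset.univ)
    (hsep : Separates S (x e) (y e)) (hu : ∀ f ∈ J, Separates S (x f) (y f) → f = e) :
    ∃ T, IsWitness d k x y J r e T := by
  by_cases hr : r ∈ S
  · refine ⟨Sᶜ, ⟨?_, by rw [cutWeight_compl]; exact hS.2⟩, by simpa using hr,
      separates_compl.2 hsep, fun f hf h => hu f hf (separates_compl.1 h)⟩
    rwa [Finset.nonempty_iff_ne_empty, ne_eq, Finset.compl_eq_empty_iff]
  · exact ⟨S, hS, hr, hsep, hu⟩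

/-- An edge cut by `A` but not by `B` has both ends in `B` or both outside. This and the next lemma
say which corner sets cut it in the two cases. -/
theorem Separates.corners_of_mem {A B : Finset V} {u v : V} (h : Separates A u v)
    (h' : ¬ Separates B u v) (hu : u ∈ B) :
    Separates (A ∩ B) u v ∧ Separates (B \ A) u v ∧ ¬ Separates (A ∪ B) u v ∧
      ¬ Separates (A \ B) u v := by
  simp only [Separates, Finset.mem_inter, Finset.mem_union, Finset.mem_sdiff] at *
  tauto

theorem Separates.corners_of_notMem {A B : Finset V} {u v : V} (h : Separates A u v)
    (h' : ¬ Separates B u v) (hu : u ∉ B) :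
    Separates (A \ B) u v ∧ Separates (A ∪ B) u v ∧ ¬ Separates (A ∩ B) u v ∧
      ¬ Separates (B \ A) u v := by
  simp only [Separates, Finset.mem_inter, Finset.mem_union, Finset.mem_sdiff] at *
  tauto

theorem Separates.of_inter {A B : Finset V} {u v : V} :
    Separates (A ∩ B) u v → Separates A u v ∨ Separates B u v := by
  simp only [Separates, Finset.mem_inter]; tauto

theorem Separates.of_union {A B : Finset V} {u v : V} :
    Separates (A ∪ B) u v → Separates A u v ∨ Separates B u v := by
  simp only [Separates, Finset.mem_union]; tauto

theorem Separates.of_sdiff {A B : Finset V} {u v : V} :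
    Separates (A \ B) u v → Separates A u v ∨ Separates B u v := by
  simp only [Separates, Finset.mem_sdiff]; tauto

/-- Each witness is chosen with minimum weight and, among those, minimum size. If two of them
crossed, two opposite corners would be candidates for the two edges; sub- or posimodularity forces
equal weights, and then one of the sizes is too large. -/
theorem exists_laminar_witness
    (hwit : ∀ e ∈ J, ∃ S, IsWitness d k x y J r e S) :
    ∃ w : κ → Finset V, (∀ e ∈ J, IsWitness d k x y J r e (w e)) ∧
      ∀ e ∈ J, ∀ f ∈ J, w e ⊆ w f ∨ w f ⊆ w e ∨ Disjoint (w e) (w f) := by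
  classical
  have key : ∀ e ∈ J, ∃ S, IsWitness d k x y J r e S ∧
      ∀ T, T.Nonempty → r ∉ T → Separates T (x e) (y e) →
        (∀ f ∈ J, Separates T (x f) (y f) → f = e) → d S ≤ d T ∧ (d T = d S → S.card ≤ T.card) := by
    intro e he
    obtain ⟨S, hS, hmin⟩ := Finset.exists_min_image
      (Finset.univ.filter fun S => IsWitness d k x y J r e S)
      -- Sizes are at most `Fintype.card V`, so this objective orders by weight and breaks ties by
      -- size.
      (fun S => d S * (Fintype.card V + 1) + S.card)
      (by obtain ⟨S, hS⟩ := hwit e he; exact ⟨S, by simpa using hS⟩)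
    simp only [Finset.mem_filter, Finset.mem_univ, true_and] at hS hmin
    refine ⟨S, hS, fun T h1 h2 h3 h4 => ?_⟩
    -- A set of weight at least `k` is heavier than the witness, so the comparison extends to sets
    -- that are not small.
    by_cases hT : d T < k
    · have := hmin T ⟨⟨h1, hT⟩, h2, h3, h4⟩
      have hc : T.card ≤ Fintype.card V := Finset.card_le_univ T
      constructor
      · by_contra hlt
        have : (d T + 1) * (Fintype.card V + 1) ≤ d S * (Fintype.card V + 1) :=
          Nat.mul_le_mul_right _ (by omega)
        nlinarith
      · intro h; rw [h] at this; omega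
    · have := hS.small.2
      exact ⟨by omega, fun h => by omega⟩
  choose! w hw hmin using key
  refine ⟨w, hw, fun e he f hf => ?_⟩
  by_contra hcon
  push Not at hcon
  obtain ⟨h1, h2, h3⟩ := hcon
  have hef : e ≠ f := by rintro rfl; exact h1 subset_rfl
  have wA := hw e he
  have wB := hw f hf
  have mA := hmin e he
  have mB := hmin f hf
  generalize w e = A at *
  generalize w f = B at *
  clear hmin hw hwit
  have hI : (A ∩ B).Nonempty := by
    rwa [Finset.nonempty_iff_ne_empty, ne_eq, ← Finset.disjoint_iff_inter_eq_empty]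
  have hP : (A \ B).Nonempty := Finset.sdiff_nonempty.2 h1
  have hQ : (B \ A).Nonempty := Finset.sdiff_nonempty.2 h2
  have rA := wA.root
  have rB := wB.root
  have sA := wA.sep
  have sB := wB.sep
  have uA := wA.unique
  have uB := wB.unique
  have nA : ¬ Separates A (x f) (y f) := fun h => hef (uA f hf h).symm
  have nB : ¬ Separates B (x e) (y e) := fun h => hef (uB e he h)
  have smod := cutWeight_inter_add_union a b ω A B
  have pmod := cutWeight_sdiff_add_sdiff a b ω A B
  have cI := Finset.card_pos.2 hI
  have cA := Finset.card_sdiff_add_card_inter A B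
  have cB := Finset.card_sdiff_add_card_inter B A
  rw [Finset.inter_comm B A] at cB
  have sub : ∀ T : Finset V, (∀ u v, Separates T u v → Separates A u v ∨ Separates B u v) →
      ∀ g ∈ J, Separates T (x g) (y g) → g = e ∨ g = f := fun T hT g hg h =>
    (hT _ _ h).imp (uA g hg) (uB g hg)
  have only : ∀ T : Finset V, (∀ u v, Separates T u v → Separates A u v ∨ Separates B u v) →
      ∀ g g', (g = e ∧ g' = f ∨ g = f ∧ g' = e) → ¬ Separates T (x g') (y g') →
      ∀ h ∈ J, Separates T (x h) (y h) → h = g := by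
    rintro T hT g g' (⟨rfl, rfl⟩ | ⟨rfl, rfl⟩) hn h hh hs
    · rcases sub T hT h hh hs with h' | h'
      · exact h'
      · exact absurd (h' ▸ hs) hn
    · rcases sub T hT h hh hs with h' | h'
      · exact absurd (h' ▸ hs) hn
      · exact h'
  have rI : r ∉ A ∩ B := fun h => rA (Finset.mem_inter.1 h).1
  have rU : r ∉ A ∪ B := fun h => (Finset.mem_union.1 h).elim rA rB
  have rP : r ∉ A \ B := fun h => rA (Finset.mem_sdiff.1 h).1
  have rQ : r ∉ B \ A := fun h => rB (Finset.mem_sdiff.1 h).1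
  have hU : (A ∪ B).Nonempty := hI.mono (Finset.inter_subset_union)
  -- Edge `e` is cut by `A` only and `f` by `B` only. Their positions decide whether the two
  -- differences, or intersection and union, take over as candidates.
  by_cases c1 : x e ∈ B <;> by_cases c2 : x f ∈ A
  · obtain ⟨e1, e2, e3, e4⟩ := sA.corners_of_mem nB c1
    obtain ⟨f1, f2, f3, f4⟩ := sB.corners_of_mem nA c2
    have q1 := mA (B \ A) hQ rQ e2 (only _ (fun _ _ h => h.of_sdiff.symm) e f (Or.inl ⟨rfl, rfl⟩) f4)
    have q2 := mB (A \ B) hP rP f2 (only _ (fun _ _ => Separates.of_sdiff) f e (Or.inr ⟨rfl, rfl⟩) e4)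
    have := q1.2 (by omega)
    have := q2.2 (by omega)
    omega
  · obtain ⟨e1, e2, e3, e4⟩ := sA.corners_of_mem nB c1
    obtain ⟨f1, f2, f3, f4⟩ := sB.corners_of_notMem nA c2
    rw [Finset.union_comm] at f2
    rw [Finset.inter_comm] at f3
    have q1 := mA (A ∩ B) hI rI e1 (only _ (fun _ _ => Separates.of_inter) e f (Or.inl ⟨rfl, rfl⟩) f3)
    have q2 := mB (A ∪ B) hU rU f2 (only _ (fun _ _ => Separates.of_union) f e (Or.inr ⟨rfl, rfl⟩) e3)
    have := q1.2 (by omega)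
    have := Finset.card_pos.2 hP
    omega
  · obtain ⟨e1, e2, e3, e4⟩ := sA.corners_of_notMem nB c1
    obtain ⟨f1, f2, f3, f4⟩ := sB.corners_of_mem nA c2
    rw [Finset.inter_comm] at f1
    rw [Finset.union_comm] at f3
    have q1 := mB (A ∩ B) hI rI f1 (only _ (fun _ _ => Separates.of_inter) f e (Or.inr ⟨rfl, rfl⟩) e3)
    have q2 := mA (A ∪ B) hU rU e2 (only _ (fun _ _ => Separates.of_union) e f (Or.inl ⟨rfl, rfl⟩) f3)
    have := q1.2 (by omega)
    have := Finset.card_pos.2 hQ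
    omega
  · obtain ⟨e1, e2, e3, e4⟩ := sA.corners_of_notMem nB c1
    obtain ⟨f1, f2, f3, f4⟩ := sB.corners_of_notMem nA c2
    have q1 := mA (A \ B) hP rP e1 (only _ (fun _ _ => Separates.of_sdiff) e f (Or.inl ⟨rfl, rfl⟩) f4)
    have q2 := mB (B \ A) hQ rQ f1 (only _ (fun _ _ h => h.of_sdiff.symm) f e (Or.inr ⟨rfl, rfl⟩) e4)
    have := q1.2 (by omega)
    omega

end Laminar

/-! ## Counting along a laminar family -/

section Counting

variable {V ι κ : Type*} [Fintype V] [DecidableEq V] [Fintype ι]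

/-- A laminar family of witnesses `w e`, `e ∈ J`, that avoid the node `r`. -/
structure LaminarWitness (a b : ι → V) (ω : ι → ℕ) (k : ℕ) (x y : κ → V) (J : Finset κ) (r : V)
    (w : κ → Finset V) : Prop where
  wit : ∀ e ∈ J, IsWitness (cutWeight a b ω) k x y J r e (w e)
  lam : ∀ e ∈ J, ∀ f ∈ J, w e ⊆ w f ∨ w f ⊆ w e ∨ Disjoint (w e) (w f)

/-- Some minimal small set is contained in `X` but in no smaller member of the family `w`. -/
def Colored (d : Finset V → ℕ) (k : ℕ) (J : Finset κ) (w : κ → Finset V) (X : Finset V) : Prop :=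
  ∃ C ∈ minSmall d k, C ⊆ X ∧ ∀ f ∈ J, w f ⊂ X → ¬ C ⊆ w f

/-- `w e` is maximal among the members of the family properly contained in `X`. -/
def IsChild (J : Finset κ) (w : κ → Finset V) (e : κ) (X : Finset V) : Prop :=
  e ∈ J ∧ w e ⊂ X ∧ ∀ f ∈ J, w e ⊂ w f → ¬ w f ⊂ X

/-- `z` lies in `X` but in no smaller member of the family. -/
def Own (J : Finset κ) (w : κ → Finset V) (X : Finset V) (z : V) : Prop :=
  z ∈ X ∧ ∀ f ∈ J, w f ⊂ X → z ∉ w f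

/-- `X` meets some minimal small set that it does not contain. -/
def Crossing (d : Finset V → ℕ) (k : ℕ) (X : Finset V) : Prop :=
  ∃ C ∈ minSmall d k, Meets X C

/-- The end of `e` in `w e`. -/
def innerEnd (x y : κ → V) (w : κ → Finset V) (e : κ) : V := if x e ∈ w e then x e else y e

/-- The end of `e` outside `w e`. -/
def outerEnd (x y : κ → V) (w : κ → Finset V) (e : κ) : V := if x e ∈ w e then y e else x e

/-- Some minimal small set contains `u` but not `v`. -/
def Leaves (d : Finset V → ℕ) (k : ℕ) (u v : V) : Prop :=
  ∃ C ∈ minSmall d k, u ∈ C ∧ v ∉ C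

variable {a b : ι → V} {ω : ι → ℕ} {k : ℕ} {x y : κ → V} {J : Finset κ} {r : V} {w : κ → Finset V}

local notation "d" => cutWeight a b ω

/-- If `C` were contained in `X`, no smaller member could contain `C`, since none contains `z`; then
`X` would be colored. -/
theorem Own.meets {X C : Finset V} {z : V} (hz : Own J w X z) (hC : C ∈ minSmall d k)
    (hzC : z ∈ C) (hX : ¬ Colored d k J w X) : Meets X C :=
  ⟨⟨z, Finset.mem_inter.2 ⟨hz.1, hzC⟩⟩, fun h =>
    hX ⟨C, hC, h, fun f hf hfX hCf => hz.2 f hf hfX (hCf hzC)⟩⟩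

theorem exists_isChild_of_ssubset {X : Finset V} {f : κ} (hf : f ∈ J) (hfX : w f ⊂ X) :
    ∃ e, IsChild J w e X ∧ w f ⊆ w e := by
  classical
  obtain ⟨e, he, hmax⟩ := Finset.exists_max_image (J.filter fun e => w f ⊆ w e ∧ w e ⊂ X)
    (fun e => (w e).card) ⟨f, by simp [hf, hfX]⟩
  simp only [Finset.mem_filter] at he hmax
  refine ⟨e, ⟨he.1, he.2.2, fun g hg h1 h2 => ?_⟩, he.2.1⟩
  have := hmax g ⟨hg, he.2.1.trans h1.subset, h2⟩
  have := Finset.card_lt_card h1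
  omega

namespace LaminarWitness

variable (h : LaminarWitness a b ω k x y J r w)
include h

theorem innerEnd_mem {e : κ} (he : e ∈ J) : innerEnd x y w e ∈ w e := by
  have := (h.wit e he).sep
  unfold innerEnd; unfold Separates at this
  split_ifs <;> tauto

theorem outerEnd_notMem {e : κ} (he : e ∈ J) : outerEnd x y w e ∉ w e := by
  have := (h.wit e he).sep
  unfold outerEnd; unfold Separates at this
  split_ifs <;> tauto

theorem separates_iff {e f : κ} (he : e ∈ J) (hf : f ∈ J) :
    (innerEnd x y w e ∈ w f ↔ outerEnd x y w e ∈ w f) ∨ e = f := by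
  have := (h.wit f hf).unique e he
  unfold Separates at this
  unfold innerEnd outerEnd
  split_ifs <;> tauto

theorem injOn : Set.InjOn w J := by
  intro e he f hf hef
  exact (h.wit f hf).unique e he (hef ▸ (h.wit e he).sep)

/-- A smaller member containing the inner end misses the outer end, so it would separate `e`; but it
separates only its own edge. -/
theorem own_innerEnd {e : κ} (he : e ∈ J) : Own J w (w e) (innerEnd x y w e) := by
  refine ⟨h.innerEnd_mem he, fun f hf hfe hin => ?_⟩
  rcases h.separates_iff he hf with h' | rfl
  · exact h.outerEnd_notMem he (hfe.subset (h'.1 hin))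
  · exact hfe.ne rfl

theorem eq_or_disjoint_of_isChild {X : Finset V} {e f : κ} (he : IsChild J w e X)
    (hf : IsChild J w f X) : e = f ∨ Disjoint (w e) (w f) := by
  rcases h.lam e he.1 f hf.1 with h1 | h1 | h1
  · rcases h1.eq_or_ssubset with h2 | h2
    · exact Or.inl (h.injOn he.1 hf.1 h2)
    · exact absurd hf.2.1 (he.2.2 f hf.1 h2)
  · rcases h1.eq_or_ssubset with h2 | h2
    · exact Or.inl (h.injOn hf.1 he.1 h2).symm
    · exact absurd he.2.1 (hf.2.2 e he.1 h2)
  · exact Or.inr h1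

/-- Neither `X` nor its smaller members separate `e`, apart from `w e` itself. A smaller member with
the outer end therefore has the inner end too and properly contains `w e`, against maximality of the
child. -/
theorem own_outerEnd {e : κ} {X : Finset V} (hX : X = Finset.univ ∨ ∃ f ∈ J, w f = X)
    (he : IsChild J w e X) : Own J w X (outerEnd x y w e) := by
  have hin := he.2.1.subset (h.innerEnd_mem he.1)
  refine ⟨?_, fun f hf hfX hout => ?_⟩
  · rcases hX with rfl | ⟨f, hf, rfl⟩
    · exact Finset.mem_univ _
    · rcases h.separates_iff he.1 hf with h' | rfl
      · exact h'.1 hin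
      · exact absurd rfl he.2.1.ne
  · rcases h.separates_iff he.1 hf with h' | rfl
    · have h1 := h'.2 hout
      rcases h.lam e he.1 f hf with h2 | h2 | h2
      · rcases h2.eq_or_ssubset with h3 | h3
        · exact h.outerEnd_notMem he.1 (h3 ▸ hout)
        · exact he.2.2 f hf h3 hfX
      · exact h.outerEnd_notMem he.1 (h2 hout)
      · exact Finset.disjoint_left.1 h2 (h.innerEnd_mem he.1) h1
    · exact h.outerEnd_notMem he.1 hout

/-- If `C` were contained in the uncolored set `X`, some smaller member would contain `C`. By
laminarity that member lies above `w e`, inside it, or apart from it, and each option is impossible.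
-/
theorem meets_parent {e : κ} {X C : Finset V} (he : IsChild J w e X) (hC : C ∈ minSmall d k)
    (hm : Meets (w e) C) (hX : ¬ Colored d k J w X) : Meets X C := by
  obtain ⟨z, hz⟩ := hm.1
  rw [Finset.mem_inter] at hz
  refine ⟨⟨z, Finset.mem_inter.2 ⟨he.2.1.subset hz.1, hz.2⟩⟩, fun hCX => hX ⟨C, hC, hCX, ?_⟩⟩
  intro f hf hfX hCf
  rcases h.lam e he.1 f hf with h2 | h2 | h2
  · rcases h2.eq_or_ssubset with h3 | h3
    · exact hm.2 (h3 ▸ hCf)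
    · exact he.2.2 f hf h3 hfX
  · exact hm.2 (hCf.trans h2)
  · exact Finset.disjoint_left.1 h2 hz.1 (hCf hz.2)

theorem meets_unique {e : κ} (he : e ∈ J) {C D : Finset V} (hC : C ∈ minSmall d k)
    (hD : D ∈ minSmall d k) (h1 : Meets (w e) C) (h2 : Meets (w e) D) : C = D :=
  (h.wit e he).small.meets_unique (mem_minSmall.1 hC) (mem_minSmall.1 hD) h1 h2

/-- A small set contains a minimal small set, so a leaf of the forest is colored. -/
theorem exists_child {e : κ} (he : e ∈ J) (hX : ¬ Colored d k J w (w e)) :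
    ∃ f, IsChild J w f (w e) := by
  obtain ⟨C, hC, hCX⟩ := (h.wit e he).small.exists_minSmall
  by_contra hno
  push Not at hno
  refine hX ⟨C, hC, hCX, fun f hf hfX _ => ?_⟩
  obtain ⟨g, hg, -⟩ := exists_isChild_of_ssubset hf hfX
  exact hno g hg

/-- If all children of an uncolored set `w e` are crossing, then its own nodes belong to the
minimal small set that it crosses. -/
theorem own_mem {e : κ} (he : e ∈ J) (hX : ¬ Colored d k J w (w e)) {C : Finset V}
    (hC : C ∈ minSmall d k) (hm : Meets (w e) C)
    (hch : ∀ f, IsChild J w f (w e) → Crossing d k (w f)) {z : V} (hz : Own J w (w e) z) :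
    z ∈ C := by
  classical
  have hCm := mem_minSmall.1 hC
  have hchC : ∀ f, IsChild J w f (w e) → Meets (w f) C := by
    intro f hf
    obtain ⟨D, hD, hDm⟩ := hch f hf
    exact h.meets_unique he hC hD hm (h.meets_parent hf hD hDm hX) ▸ hDm
  -- Children are added one at a time. Children are disjoint, so `w f` meets the union built so far
  -- only in `w f ∩ C`, which weighs at least `k`; submodularity keeps the new union below `k`.
  have hun : ∀ T : Finset κ, (∀ f ∈ T, IsChild J w f (w e)) → d (C ∪ T.biUnion w) < k := by
    intro T
    induction T using Finset.induction_on with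
    | empty => intro _; simpa using hCm.1.2
    | insert f T hfT ih =>
      intro hT
      have hf := hT f (Finset.mem_insert_self _ _)
      have h1 := ih fun g hg => hT g (Finset.mem_insert_of_mem hg)
      have h2 := cutWeight_inter_add_union a b ω (w f) (C ∪ T.biUnion w)
      have h3 : w f ∩ (C ∪ T.biUnion w) = w f ∩ C := by
        rw [Finset.inter_union_distrib_left]
        refine Finset.union_eq_left.2 fun z hz => ?_
        rw [Finset.mem_inter, Finset.mem_biUnion] at hz
        obtain ⟨hz1, g, hg, hz2⟩ := hz
        rcases h.eq_or_disjoint_of_isChild hf (hT g (Finset.mem_insert_of_mem hg)) with rfl | h4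
        · exact absurd hg hfT
        · exact absurd hz2 (Finset.disjoint_left.1 h4 hz1)
      have h4 := hCm.le_inter (hchC f hf)
      have h5 := (h.wit f hf.1).small.2
      have h6 : C ∪ (insert f T).biUnion w = w f ∪ (C ∪ T.biUnion w) := by
        rw [Finset.biUnion_insert, Finset.union_left_comm]
      rw [h3] at h2
      rw [h6]
      omega
  by_contra hzC
  set T := J.filter fun f => IsChild J w f (w e) with hT
  have hTc : ∀ f ∈ T, IsChild J w f (w e) := fun f hf => (Finset.mem_filter.1 hf).2
  have hsub : T.biUnion w ⊆ w e :=
    Finset.biUnion_subset.2 fun f hf => (hTc f hf).2.1.subset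
  have h1 := hun T hTc
  -- Posimodularity against this union, with `C \ w e` of weight at least `k`, makes the rest of `w
  -- e` small if it is non-empty. A minimal small set in that rest lies in no child, so `w e` would
  -- be colored.
  have h2 := cutWeight_sdiff_add_sdiff a b ω (w e) (C ∪ T.biUnion w)
  have h3 : (C ∪ T.biUnion w) \ w e = C \ w e := by
    rw [Finset.union_sdiff_distrib, Finset.sdiff_eq_empty_iff_subset.2 hsub, Finset.union_empty]
  have h4 := hCm.le_sdiff hm
  have h5 := (h.wit e he).small.2
  rw [h3] at h2
  have hsm : IsSmall d k (w e \ (C ∪ T.biUnion w)) := by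
    refine ⟨⟨z, ?_⟩, by omega⟩
    simp only [Finset.mem_sdiff, Finset.mem_union, Finset.mem_biUnion, not_or, not_exists, not_and]
    exact ⟨hz.1, hzC, fun f hf => hz.2 f (hTc f hf).1 (hTc f hf).2.1⟩
  obtain ⟨D, hD, hDs⟩ := hsm.exists_minSmall
  refine hX ⟨D, hD, hDs.trans Finset.sdiff_subset, fun f hf hfX hDf => ?_⟩
  obtain ⟨g, hg, hfg⟩ := exists_isChild_of_ssubset hf hfX
  obtain ⟨v, hv⟩ := (mem_minSmall.1 hD).1.1
  have hv' := hDs hv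
  simp only [Finset.mem_sdiff, Finset.mem_union, Finset.mem_biUnion, not_or, not_exists,
    not_and] at hv'
  exact hv'.2.2 g (Finset.mem_filter.2 ⟨hg.1, hg⟩) (hfg (hDf hv))




/-- Used to see that distinct uncolored sets are charged to distinct children. -/
theorem child_parent_unique {X Y : Finset V} {e : κ} (hX : ∃ f ∈ J, w f = X)
    (hY : ∃ f ∈ J, w f = Y) (h1 : IsChild J w e X) (h2 : IsChild J w e Y) : X = Y := by
  obtain ⟨f, hf, rfl⟩ := hX
  obtain ⟨g, hg, rfl⟩ := hY
  rcases h.lam f hf g hg with h3 | h3 | h3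
  · rcases h3.eq_or_ssubset with h4 | h4
    · exact h4
    · exact absurd h4 (h2.2.2 f hf h1.2.1)
  · rcases h3.eq_or_ssubset with h4 | h4
    · exact h4.symm
    · exact absurd h4 (h1.2.2 g hg h2.2.1)
  · have := h.innerEnd_mem h1.1
    exact absurd (h2.2.1.subset this) (Finset.disjoint_left.1 h3 (h1.2.1.subset this))

end LaminarWitness

/-! ### The potential argument -/

open scoped Classical in
/-- The number of ends of `e` that lie in a minimal small set not containing the other end. -/
noncomputable def endCount (δ : Finset V → ℕ) (k : ℕ) (x y : κ → V) (w : κ → Finset V) (e : κ) :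
    ℕ :=
  (if Leaves δ k (innerEnd x y w e) (outerEnd x y w e) then 1 else 0) +
    if Leaves δ k (outerEnd x y w e) (innerEnd x y w e) then 1 else 0

open scoped Classical in
/-- The potential of a node of the laminar family. -/
noncomputable def rank (δ : Finset V → ℕ) (k : ℕ) (J : Finset κ) (w : κ → Finset V)
    (X : Finset V) : ℕ :=
  if Colored δ k J w X then 5 else if ¬ Crossing δ k X then 4 else
    if ∃ f, IsChild J w f X ∧ ¬ Crossing δ k (w f) then 3 else 2

/-- All potentials are at least 2. This makes the natural subtraction `rank - endCount` exact. -/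
theorem endCount_le_rank (δ : Finset V → ℕ) (e : κ) (X : Finset V) :
    endCount δ k x y w e ≤ rank δ k J w X := by
  unfold endCount rank
  split_ifs <;> omega

-- Minimal small sets are disjoint, so each end of an edge accounts for at most one of the sets that
-- the edge covers.
open scoped Classical in
theorem sum_card_separates_le (x y : κ → V) (J : Finset κ) (w : κ → Finset V) :
    ∑ C ∈ minSmall d k, (J.filter fun e => Separates C (x e) (y e)).card ≤
      ∑ e ∈ J, endCount d k x y w e := by
  have key : ∀ u v : V, ∑ C ∈ minSmall d k, (if u ∈ C ∧ v ∉ C then 1 else 0) ≤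
      if Leaves d k u v then 1 else 0 := by
    intro u v
    rw [← Finset.card_filter]
    by_cases hl : Leaves d k u v
    · rw [if_pos hl, Finset.card_le_one]
      intro C hC D hD
      simp only [Finset.mem_filter, mem_minSmall] at hC hD
      exact hC.1.eq_of_mem hD.1 hC.2.1 hD.2.1
    · rw [if_neg hl, Nat.le_zero, Finset.card_eq_zero, Finset.filter_eq_empty_iff]
      exact fun C hC huv => hl ⟨C, hC, huv⟩
  simp only [Finset.card_filter]
  rw [Finset.sum_comm]
  refine Finset.sum_le_sum fun e _ => ?_
  refine le_trans ?_ (add_le_add (key _ _) (key _ _))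
  rw [← Finset.sum_add_distrib]
  refine Finset.sum_le_sum fun C _ => ?_
  unfold innerEnd outerEnd Separates
  by_cases h1 : x e ∈ C <;> by_cases h2 : y e ∈ C <;> by_cases h3 : x e ∈ w e <;>
    simp [h1, h2, h3]

namespace LaminarWitness

variable (h : LaminarWitness a b ω k x y J r w)
include h

/-- By `Own.meets`, a leaving outer end makes the uncolored set `w g` crossing, and a leaving inner
end does the same for `w e` if that is uncolored. If `w g` is not crossing (potential 4), neither is
`w e`, so the outer end counts nothing and the inner end counts only when `w e` has potential 5. If
`w g` has potential 3, the chosen child is not crossing: its potential is 5, or it is 4 and the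
inner end counts nothing. If `w g` has potential 2, a colored child has room for both ends. An
uncolored child crosses the same minimal small set `C` as `w g`, and `own_mem` puts the outer end
into `C`, so the inner end counts nothing; if the child has potential 2 as well, its inner end also
lies in `C` and the outer end counts nothing. -/
theorem endCount_add_rank_le {e g : κ} (hg : g ∈ J) (he : IsChild J w e (w g))
    (hX : ¬ Colored d k J w (w g))
    (hfav : (∃ f, IsChild J w f (w g) ∧ ¬ Crossing d k (w f)) → ¬ Crossing d k (w e)) :
    endCount d k x y w e + rank d k J w (w g) ≤ rank d k J w (w e) := by
  have hin := h.own_innerEnd he.1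
  have hout := h.own_outerEnd (Or.inr ⟨g, hg, rfl⟩) he
  have o_zero : ¬ Crossing d k (w g) →
      ¬ Leaves d k (outerEnd x y w e) (innerEnd x y w e) := by
    rintro hc ⟨C, hC, h1, -⟩
    exact hc ⟨C, hC, hout.meets hC h1 hX⟩
  have i_zero : ¬ Colored d k J w (w e) → ¬ Crossing d k (w e) →
      ¬ Leaves d k (innerEnd x y w e) (outerEnd x y w e) := by
    rintro hcol hc ⟨C, hC, h1, -⟩
    exact hc ⟨C, hC, hin.meets hC h1 hcol⟩
  have crossing_parent : Crossing d k (w e) → Crossing d k (w g) := by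
    rintro ⟨C, hC, hm⟩
    exact ⟨C, hC, h.meets_parent he hC hm hX⟩
  -- the case that all children of `w g` are crossing
  have full : Crossing d k (w g) → (¬ ∃ f, IsChild J w f (w g) ∧ ¬ Crossing d k (w f)) →
      ¬ Colored d k J w (w e) →
      ¬ Leaves d k (innerEnd x y w e) (outerEnd x y w e) ∧
        ((¬ ∃ f, IsChild J w f (w e) ∧ ¬ Crossing d k (w f)) →
          ¬ Leaves d k (outerEnd x y w e) (innerEnd x y w e)) := by
    rintro - hall hcol
    push Not at hall
    obtain ⟨C, hC, hm⟩ := hall e he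
    have hmg := h.meets_parent he hC hm hX
    have houtC := h.own_mem hg hX hC hmg hall hout
    constructor
    · rintro ⟨D, hD, h1, h2⟩
      have hDm := hin.meets hD h1 hcol
      have := h.meets_unique he.1 hC hD hm hDm
      exact h2 (this ▸ houtC)
    · rintro hall' ⟨D, hD, h1, h2⟩
      push Not at hall'
      have hinC := h.own_mem he.1 hcol hC hm hall' hin
      have := h.meets_unique hg hC hD hmg (hout.meets hD h1 hX)
      exact h2 (this ▸ hinC)
  unfold endCount rank
  rw [if_neg hX]
  by_cases h1 : Crossing d k (w g)
  · by_cases h2 : ∃ f, IsChild J w f (w g) ∧ ¬ Crossing d k (w f)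
    · have h3 := hfav h2
      rw [if_neg (not_not.2 h1), if_pos h2]
      by_cases h4 : Colored d k J w (w e)
      · rw [if_pos h4]; split_ifs <;> omega
      · rw [if_neg h4, if_pos h3, if_neg (i_zero h4 h3)]; split_ifs <;> omega
    · rw [if_neg (not_not.2 h1), if_neg h2]
      by_cases h4 : Colored d k J w (w e)
      · rw [if_pos h4]; split_ifs <;> omega
      · obtain ⟨f1, f2⟩ := full h1 h2 h4
        have h5 : Crossing d k (w e) := by
          by_contra h5; exact h2 ⟨e, he, h5⟩
        rw [if_neg h4, if_neg (not_not.2 h5), if_neg f1]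
        by_cases h6 : ∃ f, IsChild J w f (w e) ∧ ¬ Crossing d k (w f)
        · rw [if_pos h6]; split_ifs <;> omega
        · rw [if_neg h6, if_neg (f2 h6)]
  · have h3 : ¬ Crossing d k (w e) := fun h3 => h1 (crossing_parent h3)
    rw [if_pos h1, if_neg (o_zero h1)]
    by_cases h4 : Colored d k J w (w e)
    · rw [if_pos h4]; split_ifs <;> omega
    · rw [if_neg h4, if_pos h3, if_neg (i_zero h4 h3)]

-- Summing the charging inequality over the uncolored sets, the potentials of these sets cancel and
-- only the colored ones remain. Each colored set contributes 5, and they inject into the minimal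
-- small sets.
open scoped Classical in
theorem sum_endCount_le : ∑ e ∈ J, endCount d k x y w e ≤ 5 * (minSmall d k).card := by
  -- The child to be charged is a non-crossing one whenever there is one, as `endCount_add_rank_le`
  -- requires.
  have hfav : ∀ g ∈ J, ¬ Colored d k J w (w g) → ∃ e, IsChild J w e (w g) ∧
      ((∃ f, IsChild J w f (w g) ∧ ¬ Crossing d k (w f)) → ¬ Crossing d k (w e)) := by
    intro g hg hX
    by_cases hex : ∃ f, IsChild J w f (w g) ∧ ¬ Crossing d k (w f)
    · obtain ⟨f, hf⟩ := hex
      exact ⟨f, hf.1, fun _ => hf.2⟩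
    · obtain ⟨f, hf⟩ := h.exists_child hg hX
      exact ⟨f, hf, fun h' => absurd h' hex⟩
  choose! fav hchild hcross using hfav
  have hsplit := Finset.sum_filter_add_sum_filter_not J (fun e => Colored d k J w (w e))
    (fun e => rank d k J w (w e))
  have hcol : ∑ e ∈ J with Colored d k J w (w e), rank d k J w (w e) ≤
      5 * (minSmall d k).card := by
    have h1 : ∀ e ∈ J.filter (fun e => Colored d k J w (w e)), rank d k J w (w e) = 5 :=
      fun e he => if_pos (Finset.mem_filter.1 he).2
    rw [Finset.sum_congr rfl h1, Finset.sum_const, smul_eq_mul, mul_comm]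
    refine Nat.mul_le_mul_left _ ?_
    have h2 : ∀ e ∈ J.filter (fun e => Colored d k J w (w e)), ∃ C ∈ minSmall d k, C ⊆ w e ∧
        ∀ f ∈ J, w f ⊂ w e → ¬ C ⊆ w f := fun e he => (Finset.mem_filter.1 he).2
    choose! c hc hcs hcm using h2
    refine Finset.card_le_card_of_injOn c hc fun e he f hf hef => ?_
    have he' := (Finset.mem_filter.1 he).1
    have hf' := (Finset.mem_filter.1 hf).1
    rcases h.lam e he' f hf' with h3 | h3 | h3
    · rcases h3.eq_or_ssubset with h4 | h4
      · exact h.injOn he' hf' h4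
      · exact absurd (hef ▸ hcs e he) (hcm f hf e he' h4)
    · rcases h3.eq_or_ssubset with h4 | h4
      · exact (h.injOn hf' he' h4).symm
      · exact absurd (hef.symm ▸ hcs f hf) (hcm e he f hf' h4)
    · obtain ⟨z, hz⟩ := (mem_minSmall.1 (hc e he)).1.1
      exact absurd (hcs f hf (hef ▸ hz)) (Finset.disjoint_left.1 h3 (hcs e he hz))
  have hunc : ∑ e ∈ J with ¬ Colored d k J w (w e), rank d k J w (w e) ≤
      ∑ e ∈ J, (rank d k J w (w e) - endCount d k x y w e) := by
    calc ∑ e ∈ J with ¬ Colored d k J w (w e), rank d k J w (w e)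
        ≤ ∑ g ∈ J with ¬ Colored d k J w (w g),
            (rank d k J w (w (fav g)) - endCount d k x y w (fav g)) := by
          refine Finset.sum_le_sum fun g hg => ?_
          rw [Finset.mem_filter] at hg
          have := h.endCount_add_rank_le hg.1 (hchild g hg.1 hg.2) hg.2 (hcross g hg.1 hg.2)
          omega
      _ = ∑ e ∈ (J.filter fun g => ¬ Colored d k J w (w g)).image fav,
            (rank d k J w (w e) - endCount d k x y w e) := by
          rw [Finset.sum_image]
          intro g hg g' hg' hgg
          rw [Finset.mem_coe, Finset.mem_filter] at hg hg'
          refine h.injOn hg.1 hg'.1 (h.child_parent_unique ⟨g, hg.1, rfl⟩ ⟨g', hg'.1, rfl⟩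
            (hchild g hg.1 hg.2) (hgg ▸ hchild g' hg'.1 hg'.2))
      _ ≤ _ := by
          refine Finset.sum_le_sum_of_subset fun e he => ?_
          obtain ⟨g, hg, rfl⟩ := Finset.mem_image.1 he
          rw [Finset.mem_filter] at hg
          exact (hchild g hg.1 hg.2).1
  have hsub : ∑ e ∈ J, (rank d k J w (w e) - endCount d k x y w e) +
      ∑ e ∈ J, endCount d k x y w e = ∑ e ∈ J, rank d k J w (w e) := by
    rw [← Finset.sum_add_distrib]
    exact Finset.sum_congr rfl fun e _ => Nat.sub_add_cancel (endCount_le_rank d e (w e))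
  omega

end LaminarWitness

open scoped Classical in
/-- If every edge of `J` is the only edge of `J` in some small cut, then the minimal small sets have
average degree at most five in `J`. -/
theorem sum_card_separates_le_five_mul (a b : ι → V) (ω : ι → ℕ) (k : ℕ) (x y : κ → V)
    (J : Finset κ) (hwit : ∀ e ∈ J, ∃ S, IsSmall (cutWeight a b ω) k S ∧ S ≠ Finset.univ ∧
      Separates S (x e) (y e) ∧ ∀ f ∈ J, Separates S (x f) (y f) → f = e) :
    ∑ C ∈ minSmall (cutWeight a b ω) k, (J.filter fun e => Separates C (x e) (y e)).card ≤
      5 * (minSmall (cutWeight a b ω) k).card := by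
  rcases (minSmall (cutWeight a b ω) k).eq_empty_or_nonempty with hemp | ⟨C, hC⟩
  · simp [hemp]
  · obtain ⟨r, -⟩ := (mem_minSmall.1 hC).1.1
    obtain ⟨w, hw, hlam⟩ := exists_laminar_witness (a := a) (b := b) (ω := ω) (k := k) (x := x)
      (y := y) (J := J) (r := r) (fun e he => by
        obtain ⟨S, h1, h2, h3, h4⟩ := hwit e he
        exact exists_isWitness h1 h2 h3 h4)
    exact (sum_card_separates_le x y J w).trans
      (LaminarWitness.sum_endCount_le ⟨hw, hlam⟩)

end Counting

/-! ## Programs with bounded loops -/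

namespace RAM

/-- Programs all of whose loops run through `0, 1, …, N - 1`, where the number `N` is an entry of
the array `0`. -/
inductive Cmd where
  | skip
  | setNat (a : ℕ) (i x : NatExp)
  | setReal (a : ℕ) (i : NatExp) (x : RealExp)
  | seq (p q : Cmd)
  | ite (b : Test) (p q : Cmd)
  /-- repeat `p`, where entry `0` of the array `c` counts from `0` to the entry `b` of array `0` -/
  | loop (c b : ℕ) (p : Cmd)

namespace Cmd

open scoped Classical in
/-- The memory after the execution of a command. -/
noncomputable def run : Cmd → State → State
  | skip, s => s
  | setNat a i x, s => s.setNat a (i.eval s) (x.eval s)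
  | setReal a i x, s => s.setReal a (i.eval s) (x.eval s)
  | seq p q, s => q.run (p.run s)
  | ite b p q, s => if b.Holds s then p.run s else q.run s
  | loop c b p, s =>
      Nat.rec (s.setNat c 0 0) (fun i s' => (p.run s').setNat c 0 (i + 1)) (s.nat 0 b)

/-- The numbers of the arrays of natural numbers that a command may change. -/
def writes : Cmd → List ℕ
  | skip => []
  | setNat a _ _ => [a]
  | setReal _ _ _ => []
  | seq p q => p.writes ++ q.writes
  | ite _ p q => p.writes ++ q.writes
  | loop c _ p => c :: p.writes

/-- The command changes no real numbers. -/
def noReal : Cmd → Bool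
  | skip => true
  | setNat _ _ _ => true
  | setReal _ _ _ => false
  | seq p q => p.noReal && q.noReal
  | ite _ p q => p.noReal && q.noReal
  | loop _ _ p => p.noReal

/-- The loops of the command are controlled by the first three entries of the array `0` and do not
change their counters. -/
def wf : Cmd → Bool
  | skip => true
  | setNat _ _ _ => true
  | setReal _ _ _ => true
  | seq p q => p.wf && q.wf
  | ite _ p q => p.wf && q.wf
  | loop c b p => p.wf && decide (b < 3) && !p.writes.contains c

/-- The command as a program of the random access machine. -/
def compile : Cmd → Prog
  | skip => .skip
  | setNat a i x => .setNat a i x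
  | setReal a i x => .setReal a i x
  | seq p q => .seq p.compile q.compile
  | ite b p q => .ite b p.compile q.compile
  | loop c b p => .seq (.setNat c (.const 0) (.const 0))
      (.loop (.not (.natLe (.load 0 (.const b)) (.load c (.const 0))))
        (.seq p.compile (.setNat c (.const 0) (.add (.load c (.const 0)) (.const 1)))))

open Polynomial in
/-- A bound on the number of steps, in terms of a bound on the lengths of the loops. -/
noncomputable def time : Cmd → Polynomial ℕ
  | skip => 1
  | setNat _ i x => C (i.steps + x.steps + 1)
  | setReal _ i x => C (i.steps + x.steps + 1)
  | seq p q => p.time + q.time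
  | ite b p q => C (b.steps + 1) + p.time + q.time
  -- Resetting the counter takes 3 steps and the final failing test 7; each round takes 7 steps for
  -- the test and 6 for the increment, besides the body.
  | loop _ _ p => 10 + X * (13 + p.time)

end Cmd

@[simp] theorem State.nat_setNat (s : State) (a i v b j : ℕ) :
    (s.setNat a i v).nat b j = if b = a ∧ j = i then v else s.nat b j := by
  unfold State.setNat Function.update
  by_cases h1 : b = a
  · subst h1; by_cases h2 : j = i <;> simp [h2]
  · simp [h1]

theorem State.nat_setNat_of_ne (s : State) (a i v : ℕ) {b : ℕ} (h : b ≠ a) :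
    (s.setNat a i v).nat b = s.nat b := by
  funext j; simp [h]

@[simp] theorem State.real_setNat (s : State) (a i v : ℕ) : (s.setNat a i v).real = s.real := rfl

@[simp] theorem State.nat_setReal (s : State) (a i : ℕ) (v : ℝ) : (s.setReal a i v).nat = s.nat :=
  rfl

@[simp] theorem State.real_setReal (s : State) (a i : ℕ) (v : ℝ) (b j : ℕ) :
    (s.setReal a i v).real b j = if b = a ∧ j = i then v else s.real b j := by
  unfold State.setReal Function.update
  by_cases h1 : b = a
  · subst h1; by_cases h2 : j = i <;> simp [h2]
  · simp [h1]

namespace Cmd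

theorem run_seq (p q : Cmd) (s : State) : (seq p q).run s = q.run (p.run s) := rfl

theorem run_setNat (a : ℕ) (i x : NatExp) (s : State) :
    (setNat a i x).run s = s.setNat a (i.eval s) (x.eval s) := rfl

theorem run_nat (p : Cmd) (s : State) {a : ℕ} (ha : a ∉ p.writes) : (p.run s).nat a = s.nat a := by
  induction p generalizing s with
  | skip => rfl
  | setNat b i x => exact s.nat_setNat_of_ne _ _ _ (by simpa [writes] using ha)
  | setReal => rfl
  | seq p q hp hq =>
    simp only [writes, List.mem_append, not_or] at ha
    rw [run, hq _ ha.2, hp _ ha.1]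
  | ite b p q hp hq =>
    simp only [writes, List.mem_append, not_or] at ha
    rw [run]
    split_ifs
    · exact hp _ ha.1
    · exact hq _ ha.2
  | loop c b p hp =>
    simp only [writes, List.mem_cons, not_or] at ha
    rw [run]
    generalize s.nat 0 b = m
    induction m with
    | zero => exact s.nat_setNat_of_ne _ _ _ ha.1
    | succ m ih => exact (State.nat_setNat_of_ne _ _ _ _ ha.1).trans ((hp _ ha.2).trans ih)

theorem run_real (p : Cmd) (s : State) (h : p.noReal = true) : (p.run s).real = s.real := by
  induction p generalizing s with
  | skip => rfl
  | setNat b i x => rfl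
  | setReal => simp [noReal] at h
  | seq p q hp hq =>
    simp only [noReal, Bool.and_eq_true] at h
    rw [run, hq _ h.2, hp _ h.1]
  | ite b p q hp hq =>
    simp only [noReal, Bool.and_eq_true] at h
    rw [run]
    split_ifs
    · exact hp _ h.1
    · exact hq _ h.2
  | loop c b p hp =>
    rw [run]
    generalize s.nat 0 b = m
    induction m with
    | zero => rfl
    | succ m ih => exact (hp _ h).trans ih

/-- Reasoning about loops by invariants. -/
theorem run_loop_induction {c b n : ℕ} {p : Cmd} (s : State) (P : ℕ → State → Prop)
    (hn : s.nat 0 b = n) (h0 : P 0 (s.setNat c 0 0))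
    (hstep : ∀ i < n, ∀ s' : State, (∀ a ∉ (loop c b p).writes, s'.nat a = s.nat a) →
      (p.noReal = true → s'.real = s.real) → s'.nat c 0 = i → P i s' →
        P (i + 1) ((p.run s').setNat c 0 (i + 1))) :
    P n ((loop c b p).run s) := by
  rw [run, hn]
  have key : ∀ j ≤ n, ∀ s', s' = Nat.rec (motive := fun _ => State) (s.setNat c 0 0)
      (fun i s' => (p.run s').setNat c 0 (i + 1)) j →
      P j s' ∧ (∀ a ∉ (loop c b p).writes, s'.nat a = s.nat a) ∧
        (p.noReal = true → s'.real = s.real) ∧ s'.nat c 0 = j := by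
    intro j
    induction j with
    | zero =>
      rintro - s' rfl
      refine ⟨h0, fun a ha => s.nat_setNat_of_ne _ _ _ ?_, fun _ => rfl, by simp⟩
      simp only [writes, List.mem_cons, not_or] at ha
      exact ha.1
    | succ j ih =>
      rintro hj s' rfl
      obtain ⟨h1, h2, h3, h4⟩ := ih (by omega) _ rfl
      refine ⟨hstep j (by omega) _ h2 h3 h4 h1, fun a ha => ?_, fun hr => ?_, by simp⟩
      · have ha' := ha
        simp only [writes, List.mem_cons, not_or] at ha'
        exact (State.nat_setNat_of_ne _ _ _ _ ha'.1).trans ((p.run_nat _ ha'.2).trans (h2 a ha))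
      · exact (p.run_real _ hr).trans (h3 hr)
  exact (key n le_rfl _ rfl).1

/-- Array 0 is never written, so in nested loops too the lengths stay those of the initial memory,
and `N` bounds them throughout. -/
theorem exec_compile (p : Cmd) (hp : p.wf = true) (h0 : 0 ∉ p.writes) (N : ℕ) (s : State)
    (hs : ∀ j < 3, s.nat 0 j ≤ N) :
    ∃ t ≤ p.time.eval N, Exec p.compile s t (p.run s) := by
  induction p generalizing s with
  | skip => exact ⟨1, by simp [time], Exec.skip s⟩
  | setNat a i x => exact ⟨_, by simp [time], Exec.setNat a i x s⟩
  | setReal a i x => exact ⟨_, by simp [time], Exec.setReal a i x s⟩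
  | seq p q ihp ihq =>
    simp only [wf, Bool.and_eq_true] at hp
    simp only [writes, List.mem_append, not_or] at h0
    obtain ⟨t, ht, h⟩ := ihp hp.1 h0.1 s hs
    obtain ⟨t', ht', h'⟩ := ihq hp.2 h0.2 (p.run s) (by rwa [p.run_nat s h0.1])
    exact ⟨t + t', by simp only [time, Polynomial.eval_add]; omega, Exec.seq h h'⟩
  | ite b p q ihp ihq =>
    simp only [wf, Bool.and_eq_true] at hp
    simp only [writes, List.mem_append, not_or] at h0
    obtain ⟨t, ht, h⟩ := ihp hp.1 h0.1 s hs
    obtain ⟨t', ht', h'⟩ := ihq hp.2 h0.2 s hs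
    by_cases hb : b.Holds s
    · refine ⟨b.steps + 1 + t, ?_, ?_⟩
      · simp only [time, Polynomial.eval_add, Polynomial.eval_C]; omega
      · rw [run, if_pos hb]; exact Exec.iteTrue hb h
    · refine ⟨b.steps + 1 + t', ?_, ?_⟩
      · simp only [time, Polynomial.eval_add, Polynomial.eval_C]; omega
      · rw [run, if_neg hb]; exact Exec.iteFalse hb h'
  | loop c b p ih =>
    simp only [wf, Bool.and_eq_true, decide_eq_true_eq, Bool.not_eq_true',
      List.contains_eq_mem, decide_eq_false_iff_not] at hp
    simp only [writes, List.mem_cons, not_or] at h0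
    obtain ⟨⟨hp, hb⟩, hc⟩ := hp
    set S : ℕ → State := fun m => Nat.rec (motive := fun _ => State) (s.setNat c 0 0)
      (fun i s' => (p.run s').setNat c 0 (i + 1)) m with hS
    have hS0 : ∀ m, (S m).nat 0 = s.nat 0 := by
      intro m
      induction m with
      | zero => exact s.nat_setNat_of_ne _ _ _ h0.1
      | succ m ihm =>
        exact (State.nat_setNat_of_ne _ _ _ _ h0.1).trans ((p.run_nat _ h0.2).trans ihm)
    have hSc : ∀ m, (S m).nat c 0 = m := by
      intro m
      cases m <;> simp [hS]
    -- Induction on the number `r` of rounds still to come; `S j` is the memory after `j` rounds.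
    have key : ∀ r j, j + r = s.nat 0 b → ∃ t ≤ 7 + r * (13 + p.time.eval N),
        Exec (.loop (.not (.natLe (.load 0 (.const b)) (.load c (.const 0))))
          (.seq p.compile (.setNat c (.const 0) (.add (.load c (.const 0)) (.const 1)))))
          (S j) t (S (s.nat 0 b)) := by
      intro r
      induction r with
      | zero =>
        intro j hj
        rw [← hj, add_zero]
        refine ⟨_, ?_, Exec.loopFalse ?_⟩
        · simp [Test.steps, NatExp.steps]
        · simp only [Test.Holds, NatExp.eval, hS0, hSc, not_not]; omega
      | succ r ihr =>
        intro j hj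
        obtain ⟨t', ht', h'⟩ := ihr (j + 1) (by omega)
        obtain ⟨t, ht, h⟩ := ih hp h0.2 (S j) (by rwa [hS0])
        have hset := Exec.setNat c (.const 0) (.add (.load c (.const 0)) (.const 1)) (p.run (S j))
        have hend : (p.run (S j)).setNat c ((NatExp.const 0).eval (p.run (S j)))
            ((NatExp.add (.load c (.const 0)) (.const 1)).eval (p.run (S j))) = S (j + 1) := by
          simp only [NatExp.eval, p.run_nat _ hc, hSc]
          rfl
        rw [hend] at hset
        refine ⟨_, ?_, Exec.loopTrue ?_ (Exec.seq h hset) h'⟩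
        · simp only [Test.steps, NatExp.steps]
          nlinarith
        · simp only [Test.Holds, NatExp.eval, hS0, hSc]; omega
    obtain ⟨t, ht, h⟩ := key (s.nat 0 b) 0 (by omega)
    refine ⟨_, ?_, Exec.seq (Exec.setNat c (.const 0) (.const 0) s) h⟩
    have := Nat.mul_le_mul_right (13 + p.time.eval N) (hs b hb)
    simp only [time, NatExp.steps, Polynomial.eval_add, Polynomial.eval_mul, Polynomial.eval_X,
      Polynomial.eval_ofNat]
    omega

end Cmd

end RAM

/-! ## Maximum adjacency orderings -/

section MaxAdjacency

variable {V ι : Type*} [Fintype V] [DecidableEq V] [Fintype ι]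

theorem sum_ite_add_sum_ite_le {ω : ι → ℕ} {P Q R : ι → Prop} [DecidablePred P] [DecidablePred Q]
    [DecidablePred R] (hP : ∀ e, P e → R e) (hQ : ∀ e, Q e → R e) (hPQ : ∀ e, P e → ¬ Q e) :
    (∑ e, if P e then ω e else 0) + (∑ e, if Q e then ω e else 0) ≤
      ∑ e, if R e then ω e else 0 := by
  rw [← Finset.sum_add_distrib]
  refine Finset.sum_le_sum fun e _ => ?_
  by_cases h1 : P e
  · simp [h1, hP e h1, hPQ e h1]
  · by_cases h2 : Q e
    · simp [h1, h2, hQ e h2]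
    · simp [h1, h2]

theorem sum_ite_le_sum_ite {ω : ι → ℕ} {P R : ι → Prop} [DecidablePred P] [DecidablePred R]
    (hP : ∀ e, P e → R e) :
    (∑ e, if P e then ω e else 0) ≤ ∑ e, if R e then ω e else 0 := by
  refine Finset.sum_le_sum fun e _ => ?_
  by_cases h1 : P e
  · simp [h1, hP e h1]
  · simp [h1]

theorem sum_ite_le_add {ω : ι → ℕ} {P Q R : ι → Prop} [DecidablePred P] [DecidablePred Q]
    [DecidablePred R] (hR : ∀ e, R e → P e ∨ Q e) :
    (∑ e, if R e then ω e else 0) ≤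
      (∑ e, if P e then ω e else 0) + ∑ e, if Q e then ω e else 0 := by
  rw [← Finset.sum_add_distrib]
  refine Finset.sum_le_sum fun e _ => ?_
  by_cases h1 : R e
  · rcases hR e h1 with h2 | h2 <;> simp [h1, h2]
  · simp [h1]

/-- The weight of the edges between `A` and the nodes of class `c`. -/
def adjWeight (a b : ι → V) (ω : ι → ℕ) (cls : V → ℕ) (A : Finset V) (c : ℕ) : ℕ :=
  ∑ e, if (a e ∈ A ∧ cls (b e) = c) ∨ (b e ∈ A ∧ cls (a e) = c) then ω e else 0

/-- The nodes of class `c`. -/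
def classSet (cls : V → ℕ) (c : ℕ) : Finset V := Finset.univ.filter fun v => cls v = c

@[simp] theorem mem_classSet {cls : V → ℕ} {c : ℕ} {v : V} : v ∈ classSet cls c ↔ cls v = c := by
  simp [classSet]

open scoped Classical in
/-- The weight of the edges inside `A` between classes in `σ` and classes outside `σ`. -/
noncomputable def cutInside (a b : ι → V) (ω : ι → ℕ) (cls : V → ℕ) (A : Finset V)
    (σ : ℕ → Prop) : ℕ :=
  ∑ e, if a e ∈ A ∧ b e ∈ A ∧ ¬ (σ (cls (a e)) ↔ σ (cls (b e))) then ω e else 0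

/-- `A` is the set of the nodes scanned so far in a maximum adjacency ordering of the classes of
`cls`, starting from class `0`; the last two classes are `last` and `prev`, and `key` is the
weight between `last` and the classes before it. -/
structure MaxAdj (a b : ι → V) (ω : ι → ℕ) (cls : V → ℕ) (A : Finset V) (last prev key : ℕ) :
    Prop where
  sat : ∀ u v, cls u = cls v → u ∈ A → v ∈ A
  zero : ∀ v, cls v = 0 → v ∈ A
  last_zero : last = 0 → ∀ v ∈ A, cls v = 0
  last_mem : last ≠ 0 → ∃ v ∈ A, cls v = last
  prev_mem : prev ≠ 0 → ∃ v, cls v = prev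
  prev_ne : last ≠ 0 → prev ≠ last
  -- The invariant that carries the induction: once `v` is scanned, it becomes `key_le`. The union
  -- of classes `σ` avoids class 0 because the sets still sought do.
  next_le : ∀ σ : ℕ → Prop, ¬ σ 0 → ∀ v ∉ A, (σ (cls v) ↔ ¬ σ last) →
    adjWeight a b ω cls A (cls v) ≤ cutInside a b ω cls (A ∪ classSet cls (cls v)) σ
  key_eq : last ≠ 0 → key = adjWeight a b ω cls (A \ classSet cls last) last
  key_le : last ≠ 0 → ∀ σ : ℕ → Prop, ¬ σ 0 → (σ last ↔ ¬ σ prev) →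
    key ≤ cutInside a b ω cls A σ

variable {a b : ι → V} {ω : ι → ℕ} {cls : V → ℕ} {A : Finset V} {last prev key : ℕ}

/-- With `last = 0` and `¬ σ 0`, the condition on `v` says that its class belongs to `σ`, so all
edges from class 0 to it are cut. -/
theorem MaxAdj.init : MaxAdj a b ω cls (classSet cls 0) 0 0 0 where
  sat u v h := by simp [h]
  zero v h := by simpa using h
  last_zero _ v h := by simpa using h
  last_mem h := absurd rfl h
  prev_mem h := absurd rfl h
  prev_ne h := absurd rfl h
  next_le σ h0 v hv hσ := by
    classical
    refine sum_ite_le_sum_ite fun e he => ?_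
    simp only [mem_classSet, Finset.mem_union] at *
    have hσ' : σ (cls v) := hσ.2 h0
    rcases he with ⟨h1, h2⟩ | ⟨h1, h2⟩
    · rw [h1, h2]; simp [h0, hσ']
    · rw [h1, h2]; simp [h0, hσ']
  key_eq h := absurd rfl h
  key_le h := absurd rfl h

/-- The edges between classes `p` and `q` are cut by `σ` and lie inside `E`, but not inside `B`,
which misses one of the two classes. So they may be counted in addition. -/
theorem cutInside_add_adjWeight_le {B E : Finset V} {σ : ℕ → Prop} {p q : ℕ} (hB : B ⊆ E)
    (hp : classSet cls p ⊆ E) (hq : classSet cls q ⊆ E) (hσ : ¬ (σ p ↔ σ q))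
    (hdis : (∀ z ∈ B, cls z ≠ p) ∨ ∀ z ∈ B, cls z ≠ q) :
    cutInside a b ω cls B σ + adjWeight a b ω cls (classSet cls p) q ≤ cutInside a b ω cls E σ := by
  classical
  refine sum_ite_add_sum_ite_le ?_ ?_ ?_
  · rintro e ⟨h1, h2, h3⟩
    exact ⟨hB h1, hB h2, h3⟩
  · rintro e (⟨h1, h2⟩ | ⟨h1, h2⟩)
    · refine ⟨hp h1, hq (mem_classSet.2 h2), ?_⟩
      rwa [mem_classSet.1 h1, h2]
    · refine ⟨hq (mem_classSet.2 h2), hp h1, ?_⟩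
      rwa [mem_classSet.1 h1, h2, iff_comm]
  · rintro e ⟨h1, h2, -⟩ he
    simp only [mem_classSet] at he
    rcases hdis with h | h
    · exact he.elim (fun h' => h _ h1 h'.1) (fun h' => h _ h2 h'.1)
    · exact he.elim (fun h' => h _ h2 h'.2) (fun h' => h _ h1 h'.2)

/-- The edges from the new scanned set to an unscanned class `u` come from the old set or from the
class of `v`. The latter are cut by `σ` when `u` and `v` lie on different sides; it remains to bound
the former. -/
theorem MaxAdj.step (h : MaxAdj a b ω cls A last prev key) {v : V} (hv : v ∉ A)
    (hmax : ∀ u ∉ A, adjWeight a b ω cls A (cls u) ≤ adjWeight a b ω cls A (cls v)) :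
    MaxAdj a b ω cls (A ∪ classSet cls (cls v)) (cls v) last (adjWeight a b ω cls A (cls v)) := by
  classical
  have hv0 : cls v ≠ 0 := fun h0 => hv (h.zero v h0)
  have hdis : ∀ u ∈ A, cls u ≠ cls v := fun u hu hc => hv (h.sat u v hc hu)
  refine ⟨?_, ?_, ?_, ?_, ?_, ?_, ?_, ?_, ?_⟩
  · intro u w huw hu
    simp only [Finset.mem_union, mem_classSet] at *
    rcases hu with hu | hu
    · exact Or.inl (h.sat u w huw hu)
    · exact Or.inr (huw ▸ hu)
  · exact fun u hu => Finset.mem_union_left _ (h.zero u hu)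
  · exact fun h0 => absurd h0 hv0
  · exact fun _ => ⟨v, by simp, rfl⟩
  · intro hl
    obtain ⟨u, -, hu⟩ := h.last_mem hl
    exact ⟨u, hu⟩
  · rintro - heq
    by_cases hl : last = 0
    · exact hv0 (heq ▸ hl)
    · obtain ⟨u, hu, hu'⟩ := h.last_mem hl
      exact hdis u hu (hu'.trans heq)
  · intro σ h0 u hu hσ
    simp only [Finset.mem_union, mem_classSet, not_or] at hu
    have hdisu : ∀ z ∈ A, cls z ≠ cls u := fun z hz hc => hu.1 (h.sat z u hc hz)
    have e1 : adjWeight a b ω cls (A ∪ classSet cls (cls v)) (cls u) ≤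
        adjWeight a b ω cls A (cls u) + adjWeight a b ω cls (classSet cls (cls v)) (cls u) := by
      refine sum_ite_le_add fun e he => ?_
      simp only [Finset.mem_union] at he
      tauto
    have hvE : classSet cls (cls v) ⊆ A ∪ classSet cls (cls v) ∪ classSet cls (cls u) :=
      Finset.subset_union_right.trans Finset.subset_union_left
    -- If `σ` switches sides at `v`, the choice of `v` bounds the old part by the key of `v`, and
    -- the invariant applies to `v`. Otherwise `u` already lay opposite to `last`, and the invariant
    -- applies to `u`.
    by_cases hc : σ (cls v) ↔ ¬ σ last
    · have e2 := h.next_le σ h0 v hv hc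
      have e3 := hmax u hu.1
      have e4 := cutInside_add_adjWeight_le (a := a) (b := b) (ω := ω) (cls := cls) (σ := σ)
        (B := A ∪ classSet cls (cls v)) (p := cls v) (q := cls u) Finset.subset_union_left
        hvE Finset.subset_union_right (by rw [hσ]; exact fun hn => iff_not_self hn) (Or.inr ?_)
      · omega
      · intro z hz
        rcases Finset.mem_union.1 hz with hz | hz
        · exact hdisu z hz
        · exact fun hzu => hu.2 (hzu.symm.trans (mem_classSet.1 hz))
    · have hc1 : σ (cls v) ↔ σ last := by
        by_contra hn
        exact hc (not_iff_comm.1 (not_iff.1 hn)).symm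
      have hc' : σ (cls u) ↔ ¬ σ last := by rw [hσ, hc1]
      have e2 := h.next_le σ h0 u hu.1 hc'
      have e4 := cutInside_add_adjWeight_le (a := a) (b := b) (ω := ω) (cls := cls) (σ := σ)
        (B := A ∪ classSet cls (cls u)) (p := cls v) (q := cls u)
        (Finset.union_subset_union_left Finset.subset_union_left)
        hvE Finset.subset_union_right (by rw [hσ]; exact fun hn => iff_not_self hn) (Or.inl ?_)
      · omega
      · intro z hz
        rcases Finset.mem_union.1 hz with hz | hz
        · exact hdis z hz
        · exact fun hzv => hu.2 ((mem_classSet.1 hz).symm.trans hzv)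
  · intro _
    congr 1
    rw [Finset.union_sdiff_right, eq_comm, Finset.sdiff_eq_self_iff_disjoint,
      Finset.disjoint_left]
    exact fun u hu hu' => hdis u hu (by simpa using hu')
  · intro _ σ h0 hσ
    exact h.next_le σ h0 v hv hσ

/-- With the next theorem: among unions of classes that avoid class 0 and contain exactly one of
`last` and `prev`, none has smaller cut weight than the class `last`. -/
theorem MaxAdj.key_eq_cutWeight (h : MaxAdj a b ω cls Finset.univ last prev key)
    (hl : last ≠ 0) : key = cutWeight a b ω (classSet cls last) := by
  rw [h.key_eq hl]
  refine Finset.sum_congr rfl fun e _ => ?_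
  simp only [Separates, mem_classSet, Finset.mem_sdiff, Finset.mem_univ, true_and]
  congr 1
  rw [eq_iff_iff]
  tauto

open scoped Classical in
theorem MaxAdj.key_le_cutWeight (h : MaxAdj a b ω cls Finset.univ last prev key)
    (hl : last ≠ 0) (σ : ℕ → Prop) (h0 : ¬ σ 0) (hσ : σ last ↔ ¬ σ prev) :
    key ≤ cutWeight a b ω (Finset.univ.filter fun v => σ (cls v)) := by
  refine (h.key_le hl σ h0 hσ).trans (sum_ite_le_sum_ite fun e he => ?_)
  simp only [Separates, Finset.mem_filter, Finset.mem_univ, true_and] at *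
  tauto

/-! ## Finding the minimal small sets -/

/-- `lab` labels the nodes of the minimal small sets found so far by `1, …, cnt`. Classes of `cls`
have been merged if they are not separated by a minimal small set yet to be found; class `0` consists
of nodes that lie in no such set. -/
structure LabelInv (d : Finset V → ℕ) (k : ℕ) (cls lab : V → ℕ) (cnt : ℕ) : Prop where
  min : ∀ C ∈ minSmall d k, (∀ v ∈ C, cls v ≠ 0 ∧ ∀ u, cls u = cls v → u ∈ C) ∨
    ∃ l, 1 ≤ l ∧ l ≤ cnt ∧ ∀ v, lab v = l ↔ v ∈ C
  lab_min : ∀ l, 1 ≤ l → l ≤ cnt → ∃ C ∈ minSmall d k, ∀ v, lab v = l ↔ v ∈ C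
  lab_cls : ∀ v, lab v ≠ 0 → cls v = 0
  lab_le : ∀ v, lab v ≤ cnt

/-- `lab` labels the nodes of the minimal small sets by `1, …, cnt` and all other nodes by `0`. -/
structure IsLabeling (d : Finset V → ℕ) (k : ℕ) (lab : V → ℕ) (cnt : ℕ) : Prop where
  min : ∀ C ∈ minSmall d k, ∃ l, 1 ≤ l ∧ l ≤ cnt ∧ ∀ v, lab v = l ↔ v ∈ C
  lab_min : ∀ l, 1 ≤ l → l ≤ cnt → ∃ C ∈ minSmall d k, ∀ v, lab v = l ↔ v ∈ C
  lab_le : ∀ v, lab v ≤ cnt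

theorem LabelInv.init (d : Finset V → ℕ) (k : ℕ) {cls : V → ℕ} (h0 : ∀ v, cls v ≠ 0)
    (hinj : Function.Injective cls) : LabelInv d k cls (fun _ => 0) 0 where
  min C _ := Or.inl fun v hv => ⟨h0 v, fun u hu => hinj hu ▸ hv⟩
  lab_min l h1 h2 := by omega
  lab_cls v h := absurd rfl h
  lab_le v := le_rfl

theorem LabelInv.isLabeling {d : Finset V → ℕ} {k : ℕ} {cls lab : V → ℕ} {cnt : ℕ}
    (h : LabelInv d k cls lab cnt) (h0 : ∀ v, cls v = 0) : IsLabeling d k lab cnt where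
  min C hC := by
    refine (h.min C hC).resolve_left fun h' => ?_
    obtain ⟨v, hv⟩ := (mem_minSmall.1 hC).1.1
    exact (h' v hv).1 (h0 v)
  lab_min := h.lab_min
  lab_le := h.lab_le

variable {k cnt : ℕ} {lab : V → ℕ}

/-- A minimal small set inside the class `c` is still unlabeled, since labeled nodes have class 0.
Unlabeled ones are unions of classes, so it is the whole class. The others are disjoint from it, so
its nodes may move to class 0. -/
theorem LabelInv.found (h : LabelInv (cutWeight a b ω) k cls lab cnt) {c : ℕ} (hc : c ≠ 0)
    (hne : ∃ v, cls v = c) (hlt : cutWeight a b ω (classSet cls c) < k) :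
    LabelInv (cutWeight a b ω) k (fun v => if cls v = c then 0 else cls v)
      (fun v => if cls v = c then cnt + 1 else lab v) (cnt + 1) := by
  obtain ⟨v0, hv0⟩ := hne
  have hlab : ∀ v, cls v = c → lab v = 0 := fun v hv => by
    by_contra h'
    exact hc (hv ▸ h.lab_cls v h')
  have hdone : ∀ C : Finset V, ∀ l, 1 ≤ l → (∀ v, lab v = l ↔ v ∈ C) → l ≤ cnt →
      ∀ v, (if cls v = c then cnt + 1 else lab v) = l ↔ v ∈ C := by
    intro C l h1 h2 h3 v
    by_cases hv : cls v = c
    · rw [if_pos hv, ← h2 v, hlab v hv]; omega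
    · rw [if_neg hv, h2 v]
  have hmem : classSet cls c ∈ minSmall (cutWeight a b ω) k := by
    obtain ⟨C, hC, hCs⟩ := IsSmall.exists_minSmall (d := cutWeight a b ω) (k := k)
      (S := classSet cls c) ⟨⟨v0, by simpa using hv0⟩, hlt⟩
    obtain ⟨v, hv⟩ := (mem_minSmall.1 hC).1.1
    have hvc : cls v = c := by simpa using hCs hv
    rcases h.min C hC with h1 | ⟨l, h1, h2, h3⟩
    · have : C = classSet cls c := by
        refine hCs.antisymm fun u hu => (h1 v hv).2 u ?_
        rw [hvc]; simpa using hu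
      exact this ▸ hC
    · have := (h3 v).2 hv
      have := hlab v hvc
      omega
  refine ⟨fun C hC => ?_, fun l h1 h2 => ?_, fun v hv => ?_, fun v => ?_⟩
  · rcases h.min C hC with h1 | ⟨l, h1, h2, h3⟩
    · by_cases hCc : C = classSet cls c
      · refine Or.inr ⟨cnt + 1, by omega, le_rfl, fun v => ?_⟩
        have := h.lab_le v
        rw [hCc, mem_classSet]
        split_ifs with hv
        · simp [hv]
        · simp only [hv, iff_false]; omega
      · left
        have hout : ∀ v ∈ C, cls v ≠ c := fun v hv hvc => hCc <|
          (mem_minSmall.1 hC).eq_of_mem (mem_minSmall.1 hmem) hv (by simpa using hvc)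
        intro v hv
        rw [if_neg (hout v hv)]
        refine ⟨(h1 v hv).1, fun u hu => ?_⟩
        split_ifs at hu with huc
        · exact absurd hu.symm (h1 v hv).1
        · exact (h1 v hv).2 u hu
    · exact Or.inr ⟨l, h1, by omega, hdone C l h1 h3 h2⟩
  · by_cases hl : l ≤ cnt
    · obtain ⟨C, hC, h3⟩ := h.lab_min l h1 hl
      exact ⟨C, hC, hdone C l h1 h3 hl⟩
    · refine ⟨_, hmem, fun v => ?_⟩
      have := h.lab_le v
      rw [mem_classSet]
      split_ifs with hv
      · simp only [hv, iff_true]; omega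
      · simp only [hv, iff_false]; omega
  · split_ifs at hv ⊢ with hvc
    · rfl
    · exact h.lab_cls v hv
  · have := h.lab_le v
    split_ifs <;> omega

-- An unlabeled minimal small set is a union of classes of weight below `k`, so it contains both of
-- the classes `c` and `p` or neither. For `p = 0` this discards class `c`.
open scoped Classical in
theorem LabelInv.merge (h : LabelInv (cutWeight a b ω) k cls lab cnt) {c p : ℕ} (hc : c ≠ 0)
    (hcp : p ≠ c) (hle : ∀ σ : ℕ → Prop, ¬ σ 0 → (σ c ↔ ¬ σ p) →
      k ≤ cutWeight a b ω (Finset.univ.filter fun v => σ (cls v))) :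
    LabelInv (cutWeight a b ω) k (fun v => if cls v = c then p else cls v) lab cnt := by
  refine ⟨fun C hC => ?_, h.lab_min, fun v hv => ?_, h.lab_le⟩
  · rcases h.min C hC with h1 | h1
    · left
      have h2 : ¬ ((∃ u ∈ C, cls u = c) ↔ ¬ ∃ u ∈ C, cls u = p) := by
        intro h2
        have := hle (fun l => ∃ u ∈ C, cls u = l) (fun ⟨u, hu, hu0⟩ => (h1 u hu).1 hu0) h2
        refine absurd (mem_minSmall.1 hC).1.2 (not_lt.2 (this.trans_eq (congrArg _ ?_)))
        ext v
        simp only [Finset.mem_filter, Finset.mem_univ, true_and]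
        exact ⟨fun ⟨u, hu, huv⟩ => (h1 u hu).2 v huv.symm, fun hv => ⟨v, hv, rfl⟩⟩
      have h3 : (∃ u ∈ C, cls u = c) ↔ ∃ u ∈ C, cls u = p :=
        not_iff_not.1 (not_iff.1 h2)
      intro v hv
      by_cases hvc : cls v = c
      · obtain ⟨u, hu, hup⟩ := h3.1 ⟨v, hv, hvc⟩
        simp only [hvc, if_true]
        refine ⟨hup ▸ (h1 u hu).1, fun z hz => ?_⟩
        split_ifs at hz with hzc
        · exact (h1 v hv).2 z (hzc.trans hvc.symm)
        · exact (h1 u hu).2 z (hz.trans hup.symm)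
      · simp only [hvc, if_false]
        refine ⟨(h1 v hv).1, fun z hz => ?_⟩
        split_ifs at hz with hzc
        · obtain ⟨u, hu, huc⟩ := h3.2 ⟨v, hv, hz.symm⟩
          exact (h1 u hu).2 z (hzc.trans huc.symm)
        · exact (h1 v hv).2 z hz
    · exact Or.inr h1
  · have := h.lab_cls v hv
    rw [if_neg (by omega)]
    exact this

/-- The number of classes other than class `0`. -/
def numClasses (cls : V → ℕ) : ℕ := ((Finset.univ.image cls).erase 0).card

/-- Class `c` disappears and no new class arises. Hence as many phases as there are nodes suffice.
-/
theorem numClasses_lt {c p : ℕ} (hc : c ≠ 0) (hne : ∃ v, cls v = c) (hpc : p ≠ c)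
    (hp : p ≠ 0 → ∃ v, cls v = p) :
    numClasses (fun v => if cls v = c then p else cls v) < numClasses cls := by
  refine Finset.card_lt_card ⟨fun l hl => ?_, fun hs => ?_⟩
  · simp only [Finset.mem_erase, Finset.mem_image, Finset.mem_univ, true_and] at *
    obtain ⟨h0, v, hv⟩ := hl
    refine ⟨h0, ?_⟩
    split_ifs at hv with hvc
    · exact hv ▸ hp (hv ▸ h0)
    · exact ⟨v, hv⟩
  · obtain ⟨v, hv⟩ := hne
    have : c ∈ _ := hs (by
      simp only [Finset.mem_erase, Finset.mem_image, Finset.mem_univ, true_and]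
      exact ⟨hc, v, hv⟩)
    simp only [Finset.mem_erase, Finset.mem_image, Finset.mem_univ, true_and] at this
    obtain ⟨-, u, hu⟩ := this
    split_ifs at hu with huc
    · exact hpc hu
    · exact huc hu

theorem eq_zero_of_numClasses (h : numClasses cls = 0) (v : V) : cls v = 0 := by
  by_contra hv
  have : cls v ∈ (Finset.univ.image cls).erase 0 := by simp [hv]
  rw [Finset.card_eq_zero.1 h] at this
  simp at this

theorem numClasses_le (cls : V → ℕ) : numClasses cls ≤ Fintype.card V :=
  (Finset.card_le_card (Finset.erase_subset _ _)).trans Finset.card_image_le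

section Labeling

variable {d : Finset V → ℕ} (h : IsLabeling d k lab cnt)
include h

theorem IsLabeling.card_eq : (minSmall d k).card = cnt := by
  choose! l hl1 hl2 hl using h.min
  choose! C hC hCl using h.lab_min
  have h1 : (minSmall d k).card ≤ (Finset.Icc 1 cnt).card := by
    refine Finset.card_le_card_of_injOn l
      (fun D hD => Finset.mem_coe.2 (Finset.mem_Icc.2 ⟨hl1 D hD, hl2 D hD⟩)) ?_
    intro D hD E hE hDE
    ext v
    rw [← hl D hD, ← hl E hE, hDE]
  have h2 : (Finset.Icc 1 cnt).card ≤ (minSmall d k).card := by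
    refine Finset.card_le_card_of_injOn C (fun i hi => ?_) fun i hi j hj hij => ?_
    · rw [Finset.mem_coe, Finset.mem_Icc] at hi
      exact hC i hi.1 hi.2
    · rw [Finset.mem_coe, Finset.mem_Icc] at hi hj
      obtain ⟨v, hv⟩ := (mem_minSmall.1 (hC i hi.1 hi.2)).1.1
      have e1 := (hCl i hi.1 hi.2 v).2 hv
      have e2 := (hCl j hj.1 hj.2 v).2 (hij ▸ hv)
      omega
  simp only [Nat.card_Icc, Nat.add_sub_cancel] at h1 h2
  omega

/-- By disjointness each end lies in at most one minimal small set, which its label identifies. So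
the labels alone determine the rate, 0, 1 or 2, at which an edge is paid. -/
theorem IsLabeling.card_separates (u v : V) :
    ((minSmall d k).filter fun C => Separates C u v).card =
      if lab u = lab v then 0 else (if lab u = 0 then 0 else 1) + if lab v = 0 then 0 else 1 := by
  have one : ∀ u v : V, lab u ≠ lab v →
      ((minSmall d k).filter fun C => u ∈ C ∧ v ∉ C).card = if lab u = 0 then 0 else 1 := by
    intro u v huv
    split_ifs with hu
    · rw [Finset.card_eq_zero, Finset.filter_eq_empty_iff]
      rintro C hC ⟨h1, -⟩
      obtain ⟨l, hl1, -, hl⟩ := h.min C hC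
      have := (hl u).2 h1
      omega
    · rw [Finset.card_eq_one]
      obtain ⟨C, hC, hl⟩ := h.lab_min (lab u) (by omega) (h.lab_le u)
      refine ⟨C, ?_⟩
      ext D
      simp only [Finset.mem_filter, Finset.mem_singleton]
      constructor
      · rintro ⟨hD, h1, h2⟩
        obtain ⟨l, -, -, hl'⟩ := h.min D hD
        ext z
        rw [← hl, ← hl', (hl' u).2 h1]
      · rintro rfl
        exact ⟨hC, (hl u).1 rfl, fun hv => huv ((hl v).2 hv).symm⟩
  by_cases huv : lab u = lab v
  · rw [if_pos huv, Finset.card_eq_zero, Finset.filter_eq_empty_iff]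
    intro C hC hs
    obtain ⟨l, hl1, -, hl⟩ := h.min C hC
    unfold Separates at hs
    rw [← hl, ← hl, huv] at hs
    tauto
  rw [if_neg huv]
  have hor : (minSmall d k).filter (fun C => Separates C u v) =
      (minSmall d k).filter (fun C => u ∈ C ∧ v ∉ C) ∪
        (minSmall d k).filter (fun C => v ∈ C ∧ u ∉ C) := by
    ext C
    simp only [Finset.mem_filter, Finset.mem_union]
    unfold Separates
    tauto
  rw [hor, Finset.card_union_of_disjoint, one u v huv, one v u (Ne.symm huv)]
  rw [Finset.disjoint_filter]
  tauto

end Labeling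

end MaxAdjacency

/-! ## Program fragments -/

namespace RAM

/-- Entry `0` of an array, used as a variable. -/
def NatExp.var (a : ℕ) : NatExp := .load a (.const 0)

/-- Equality of natural numbers. -/
def Test.eq (x y : NatExp) : Test := .and (.natLe x y) (.natLe y x)

/-- Disjunction. -/
def Test.or (b d : Test) : Test := .not (.and (.not b) (.not d))

/-- The test that always succeeds. -/
def Test.true : Test := .natLe (.const 0) (.const 0)

theorem NatExp.eval_var {s : State} {a : ℕ} : (NatExp.var a).eval s = s.nat a 0 := rfl

theorem Test.holds_eq {s : State} {x y : NatExp} :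
    (Test.eq x y).Holds s ↔ x.eval s = y.eval s := by
  simp only [Test.eq, Test.Holds]; omega

theorem Test.holds_or {s : State} {b d : Test} :
    (Test.or b d).Holds s ↔ b.Holds s ∨ d.Holds s := by
  simp only [Test.or, Test.Holds]; tauto

theorem Test.holds_not {s : State} {b : Test} : (Test.not b).Holds s ↔ ¬ b.Holds s := Iff.rfl

theorem Test.holds_and {s : State} {b d : Test} :
    (Test.and b d).Holds s ↔ b.Holds s ∧ d.Holds s := Iff.rfl

theorem Test.holds_true {s : State} : Test.true.Holds s := le_refl 0

namespace Cmd

/-- Add up the values of `x` for which `t` holds. -/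
def sumLoop (c b acc : ℕ) (t : Test) (x : NatExp) : Cmd :=
  .loop c b (.ite t (.setNat acc (.const 0) (.add (.var acc) x)) .skip)

open scoped Classical in
theorem run_sumLoop {c b acc : ℕ} {t : Test} {x : NatExp} (s : State) (f : ℕ → ℕ) (hca : acc ≠ c)
    (hf : ∀ i < s.nat 0 b, ∀ s' : State, (∀ a, a ≠ c → a ≠ acc → s'.nat a = s.nat a) →
      s'.nat c 0 = i → (if t.Holds s' then x.eval s' else 0) = f i) :
    ((sumLoop c b acc t x).run s).nat acc 0 = s.nat acc 0 + ∑ i ∈ Finset.range (s.nat 0 b), f i := by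
  refine run_loop_induction (p := .ite t _ .skip) s
    (fun i s' => s'.nat acc 0 = s.nat acc 0 + ∑ j ∈ Finset.range i, f j) rfl ?_ ?_
  · simp [hca]
  · intro i hi s' hs' _ hc hP
    have h := hf i hi s' (fun a h1 h2 => hs' a (by simp [writes, h1, h2])) hc
    rw [Finset.sum_range_succ, ← h, ← add_assoc, ← hP, run]
    split_ifs with ht <;> simp [run, hca, NatExp.eval, NatExp.eval_var]

/-- Assign `x` to the entries `i` of the array `a` for which `t` holds. -/
def mapLoop (c b a : ℕ) (t : Test) (x : NatExp) : Cmd :=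
  .loop c b (.ite t (.setNat a (.var c) x) .skip)

-- The test and the value may read entry `i` of the array being changed, since it is still untouched
-- in round `i`; this permits relabeling in place.
open scoped Classical in
theorem run_mapLoop {c b a : ℕ} {t : Test} {x : NatExp} (s : State) (T : ℕ → Prop) (X : ℕ → ℕ)
    (hca : a ≠ c)
    (hf : ∀ i < s.nat 0 b, ∀ s' : State, (∀ a', a' ≠ c → a' ≠ a → s'.nat a' = s.nat a') →
      s'.nat c 0 = i → s'.nat a i = s.nat a i → (t.Holds s' ↔ T i) ∧ (T i → x.eval s' = X i))
    (j : ℕ) :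
    ((mapLoop c b a t x).run s).nat a j = if j < s.nat 0 b ∧ T j then X j else s.nat a j := by
  refine run_loop_induction (p := .ite t _ .skip) s
    (fun i s' => ∀ j, s'.nat a j = if j < i ∧ T j then X j else s.nat a j) rfl ?_ ?_ j
  · simp [hca]
  · intro i hi s' hs' _ hc hP j
    have h := hf i hi s' (fun a' h1 h2 => hs' a' (by simp [writes, h1, h2])) hc
      (by rw [hP i, if_neg (by simp)])
    rw [run]
    split_ifs with ht hj hj
    · by_cases hji : j = i
      · subst hji
        simp [run, hca, NatExp.eval_var, hc, h.2 hj.2]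
      · simp only [run, State.nat_setNat, NatExp.eval_var, hc, hca, hji, false_and, and_false, if_false]
        rw [hP, if_pos ⟨by omega, hj.2⟩]
    · have hji : j ≠ i := by
        rintro rfl
        exact hj ⟨by omega, h.1.1 ht⟩
      simp only [run, State.nat_setNat, NatExp.eval_var, hc, hca, hji, false_and, and_false, if_false]
      rw [hP, if_neg fun h' => hj ⟨by omega, h'.2⟩]
    · have hji : j ≠ i := by
        rintro rfl
        exact ht (h.1.2 hj.2)
      simp only [run, State.nat_setNat, hca, false_and, if_false]
      rw [hP, if_pos ⟨by omega, hj.2⟩]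
    · simp only [run, State.nat_setNat, hca, false_and, if_false]
      rw [hP, if_neg fun h' => hj ⟨by omega, h'.2⟩]

end Cmd

end RAM

/-! ## The program that labels the minimal small sets

Array 6 holds the labels and array 7 their number; array 8 holds the classes, array 9 marks the scanned
nodes, the arrays 10, 11, 12 hold the last two scanned classes and the key of the last one, the arrays
13, 14 the best candidate for the next class and its key, array 15 the key of the current
candidate. -/

namespace RAM.Cmd

open NatExp in
/-- Edge number `c`, whose ends are in the arrays `p` and `q`, joins a scanned node and the class of
node number `w`. -/
def adjTest (p q c w : ℕ) : Test :=
  .or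
    (.and (.not (.eq (load 9 (load p (var c))) (const 0)))
      (.eq (load 8 (load q (var c))) (load 8 (var w))))
    (.and (.not (.eq (load 9 (load q (var c))) (const 0)))
      (.eq (load 8 (load p (var c))) (load 8 (var w))))

open NatExp in
/-- Compute the key of the class of a node. -/
def keyCmd : Cmd :=
  .seq (.setNat 15 (const 0) (const 0)) <|
  .seq (sumLoop 25 1 15 (adjTest 1 2 25 24) (const 1))
    -- The multigraph with `k` copies of the chosen edges is never built: each of these edges adds
    -- `k` to the key.
    (sumLoop 26 2 15 (.and (.not (.eq (load 5 (var 26)) (const 0))) (adjTest 3 4 26 24))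
      (load 0 (const 3)))

open NatExp in
/-- Find the class with the largest key. -/
def selectCmd : Cmd :=
  -- The candidate is stored increased by one; 0 means that there is none.
  .seq (.setNat 13 (const 0) (const 0)) <|
  .loop 24 0 <|
    .ite (.eq (load 9 (var 24)) (const 0))
      (.seq keyCmd <|
        .ite (.or (.eq (var 13) (const 0)) (.not (.natLe (var 15) (var 14))))
          (.seq (.setNat 13 (const 0) (add (var 24) (const 1)))
            (.setNat 14 (const 0) (var 15)))
          .skip)
      .skip

open NatExp in
/-- Scan one more class. -/
def scanCmd : Cmd :=
  .seq selectCmd <|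
  .ite (.not (.eq (var 13) (const 0)))
    (.seq (.setNat 11 (const 0) (var 10)) <|
      .seq (.setNat 10 (const 0) (load 8 (sub (var 13) (const 1)))) <|
      .seq (.setNat 12 (const 0) (var 14)) <|
      mapLoop 27 0 9 (.eq (load 8 (var 27)) (var 10)) (const 1))
    .skip

open NatExp in
/-- Compute a maximum adjacency ordering. -/
def orderCmd : Cmd :=
  .seq (.setNat 10 (const 0) (const 0)) <|
  .seq (.setNat 11 (const 0) (const 0)) <|
  .seq (.setNat 12 (const 0) (const 0)) <|
  .seq (mapLoop 22 0 9 .true (const 0)) <|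
  .seq (mapLoop 22 0 9 (.eq (load 8 (var 22)) (const 0)) (const 1)) <|
  .loop 23 0 scanCmd

open NatExp in
/-- Label or merge the last class of the ordering. -/
def phaseCmd : Cmd :=
  .seq orderCmd <|
  .ite (.not (.eq (var 10) (const 0)))
    (.ite (.not (.natLe (load 0 (const 3)) (var 12)))
      (.seq (.setNat 7 (const 0) (add (var 7) (const 1))) <|
        .seq (mapLoop 28 0 6 (.eq (load 8 (var 28)) (var 10)) (var 7)) <|
        mapLoop 28 0 8 (.eq (load 8 (var 28)) (var 10)) (const 0))
      (mapLoop 29 0 8 (.eq (load 8 (var 29)) (var 10)) (var 11)))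
    .skip

open NatExp in
/-- Label the minimal small sets. -/
def labelCmd : Cmd :=
  .seq (.setNat 7 (const 0) (const 0)) <|
  .seq (mapLoop 20 0 6 .true (const 0)) <|
  -- Initial classes are singletons numbered from 1, as class 0 is reserved for discarded nodes.
  .seq (mapLoop 20 0 8 .true (add (var 20) (const 1))) <|
  .loop 21 0 phaseCmd

end RAM.Cmd

/-! ### The residual graph in memory and its keys -/

namespace SmallCutsInstance

open RAM

/-- The input arrays are in place. -/
def Loaded (I : SmallCutsInstance) (s : State) : Prop := ∀ a < 5, s.nat a = I.input.nat a

/-- One end of an edge of the union of `H` and `G`. -/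
def endA (I : SmallCutsInstance) : Fin I.H.m ⊕ Fin I.G.m → Fin I.n := Sum.elim I.H.fst I.G.fst

/-- The other end of an edge of the union of `H` and `G`. -/
def endB (I : SmallCutsInstance) : Fin I.H.m ⊕ Fin I.G.m → Fin I.n := Sum.elim I.H.snd I.G.snd

/-- The edges of `H` have weight one, the edges of `J` have weight `k`. -/
def weight (I : SmallCutsInstance) (J : Finset (Fin I.G.m)) : Fin I.H.m ⊕ Fin I.G.m → ℕ :=
  Sum.elim (fun _ => 1) (fun e => if e ∈ J then I.k else 0)

/-- The cut function of `H` and `k` copies of `J`. -/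
def residualCut (I : SmallCutsInstance) (J : Finset (Fin I.G.m)) (S : Finset (Fin I.n)) : ℕ :=
  cutWeight I.endA I.endB (I.weight J) S

/-- An array that is indexed by nodes. -/
def nodeArray (I : SmallCutsInstance) (s : State) (a : ℕ) : Fin I.n → ℕ := fun v => s.nat a v

/-- The nodes marked by array 9. -/
def scanned (I : SmallCutsInstance) (s : State) : Finset (Fin I.n) :=
  Finset.univ.filter fun v => s.nat 9 v ≠ 0

variable {I : SmallCutsInstance} {s : State}

@[simp] theorem mem_scanned {v : Fin I.n} : v ∈ I.scanned s ↔ s.nat 9 v ≠ 0 := by simp [scanned]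

@[simp] theorem mem_output {e : Fin I.G.m} : e ∈ I.output s ↔ s.nat 5 e ≠ 0 := by simp [output]

namespace Loaded

variable (h : I.Loaded s)
include h

theorem n : s.nat 0 0 = I.n := by rw [h 0 (by omega)]; rfl
theorem mH : s.nat 0 1 = I.H.m := by rw [h 0 (by omega)]; rfl
theorem mG : s.nat 0 2 = I.G.m := by rw [h 0 (by omega)]; rfl
theorem k : s.nat 0 3 = I.k := by rw [h 0 (by omega)]; rfl
theorem fstH (e : Fin I.H.m) : s.nat 1 e = I.H.fst e := by rw [h 1 (by omega)]; simp [input]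
theorem sndH (e : Fin I.H.m) : s.nat 2 e = I.H.snd e := by rw [h 2 (by omega)]; simp [input]
theorem fstG (e : Fin I.G.m) : s.nat 3 e = I.G.fst e := by rw [h 3 (by omega)]; simp [input]
theorem sndG (e : Fin I.G.m) : s.nat 4 e = I.G.snd e := by rw [h 4 (by omega)]; simp [input]

theorem of_eq {s' : State} (h' : ∀ a < 5, s'.nat a = s.nat a) : I.Loaded s' :=
  fun a ha => (h' a ha).trans (h a ha)

end Loaded

theorem output_congr {s' : State} (h : s'.nat 5 = s.nat 5) : I.output s' = I.output s := by
  unfold output; rw [h]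

theorem run_keyCmd (h : I.Loaded s) (v : Fin I.n) (hv : s.nat 24 0 = v) :
    (Cmd.keyCmd.run s).nat 15 0 = adjWeight I.endA I.endB (I.weight (I.output s))
      (I.nodeArray s 8) (I.scanned s) (I.nodeArray s 8 v) := by
  classical
  have e0 : ∀ s' : State, (∀ a, a ≠ 15 → a ≠ 25 → a ≠ 26 → s'.nat a = s.nat a) →
      ∀ p q c, (c = 25 ∨ c = 26) → p < 5 → q < 5 →
      ((Cmd.adjTest p q c 24).Holds s' ↔
        (s.nat 9 (s.nat p (s'.nat c 0)) ≠ 0 ∧ s.nat 8 (s.nat q (s'.nat c 0)) = s.nat 8 v) ∨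
        (s.nat 9 (s.nat q (s'.nat c 0)) ≠ 0 ∧ s.nat 8 (s.nat p (s'.nat c 0)) = s.nat 8 v)) := by
    intro s' hs' p q c hc hp hq
    simp only [Cmd.adjTest, Test.holds_or, Test.holds_and, Test.holds_not, Test.holds_eq,
      NatExp.eval, NatExp.eval_var, hs' 8 (by omega) (by omega) (by omega), hs' 9 (by omega) (by omega) (by omega),
      hs' p (by omega) (by omega) (by omega), hs' q (by omega) (by omega) (by omega),
      hs' 24 (by omega) (by omega) (by omega), hv, ne_eq]
  simp only [Cmd.keyCmd, Cmd.run]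
  rw [Cmd.run_sumLoop _ (fun e => if s.nat 5 e ≠ 0 ∧
      ((s.nat 9 (s.nat 3 e) ≠ 0 ∧ s.nat 8 (s.nat 4 e) = s.nat 8 v) ∨
        (s.nat 9 (s.nat 4 e) ≠ 0 ∧ s.nat 8 (s.nat 3 e) = s.nat 8 v)) then I.k else 0) (by omega),
    Cmd.run_sumLoop _ (fun e =>
      if (s.nat 9 (s.nat 1 e) ≠ 0 ∧ s.nat 8 (s.nat 2 e) = s.nat 8 v) ∨
        (s.nat 9 (s.nat 2 e) ≠ 0 ∧ s.nat 8 (s.nat 1 e) = s.nat 8 v) then 1 else 0) (by omega)]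
  · rw [Cmd.run_nat _ _ (by simp [Cmd.sumLoop, Cmd.writes])]
    simp only [State.nat_setNat, NatExp.eval, Nat.reduceEqDiff, and_self, if_true, if_false, h.mH, h.mG, zero_add]
    rw [adjWeight, Fintype.sum_sum_type, Finset.sum_range, Finset.sum_range]
    congr 1
    · refine Finset.sum_congr rfl fun e _ => ?_
      simp only [h.fstH, h.sndH, mem_scanned, endA, endB, weight, nodeArray, Sum.elim_inl]
    · refine Finset.sum_congr rfl fun e _ => ?_
      simp only [h.fstG, h.sndG, mem_scanned, endA, endB, weight, nodeArray, Sum.elim_inr,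
        mem_output]
      split_ifs <;> first | rfl | tauto
  · intro i _ s' hs' hc
    rw [e0 s' _ 1 2 25 (by omega) (by omega) (by omega), hc]
    · simp only [NatExp.eval]
      split_ifs <;> rfl
    · intro a h1 h2 _
      rw [hs' a h2 h1, State.nat_setNat_of_ne _ _ _ _ h1]
  · intro i _ s' hs' hc
    have hs'' : ∀ a, a ≠ 15 → a ≠ 25 → a ≠ 26 → s'.nat a = s.nat a := by
      intro a h1 h2 h3
      rw [hs' a h3 h1, Cmd.run_nat _ _ (by simp [Cmd.sumLoop, Cmd.writes, h1, h2]),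
        State.nat_setNat_of_ne _ _ _ _ h1]
    rw [Test.holds_and, e0 s' hs'' 3 4 26 (by omega) (by omega) (by omega), hc]
    simp only [Test.holds_not, Test.holds_eq, NatExp.eval, NatExp.eval_var, hc,
      hs'' 5 (by omega) (by omega) (by omega), hs'' 0 (by omega) (by omega) (by omega), h.k, ne_eq]

end SmallCutsInstance

/-! ### Correctness of one scanning step -/

namespace SmallCutsInstance

open RAM

variable {I : SmallCutsInstance} {s : State}

/-- The key of the class of a node. -/
def nodeKey (I : SmallCutsInstance) (s : State) (v : Fin I.n) : ℕ :=
  adjWeight I.endA I.endB (I.weight (I.output s)) (I.nodeArray s 8) (I.scanned s)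
    (I.nodeArray s 8 v)

theorem nodeKey_congr {s' : State} (h5 : s'.nat 5 = s.nat 5) (h8 : s'.nat 8 = s.nat 8)
    (h9 : s'.nat 9 = s.nat 9) : I.nodeKey s' = I.nodeKey s := by
  funext v
  unfold nodeKey nodeArray scanned output
  rw [h5, h8, h9]

theorem run_selectCmd (h : I.Loaded s) :
    ((Cmd.selectCmd.run s).nat 13 0 = 0 ∧ ∀ v : Fin I.n, s.nat 9 v ≠ 0) ∨
      ∃ v : Fin I.n, (Cmd.selectCmd.run s).nat 13 0 = v + 1 ∧ s.nat 9 v = 0 ∧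
        (Cmd.selectCmd.run s).nat 14 0 = I.nodeKey s v ∧
        ∀ u : Fin I.n, s.nat 9 u = 0 → I.nodeKey s u ≤ I.nodeKey s v := by
  -- The redundant bounds by `I.n` turn the claim into the last instance of the loop invariant.
  have key : ((Cmd.selectCmd.run s).nat 13 0 = 0 ∧
        ∀ v : Fin I.n, (v : ℕ) < I.n → s.nat 9 v ≠ 0) ∨
      ∃ v : Fin I.n, (v : ℕ) < I.n ∧ (Cmd.selectCmd.run s).nat 13 0 = v + 1 ∧ s.nat 9 v = 0 ∧
        (Cmd.selectCmd.run s).nat 14 0 = I.nodeKey s v ∧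
        ∀ u : Fin I.n, (u : ℕ) < I.n → s.nat 9 u = 0 → I.nodeKey s u ≤ I.nodeKey s v := by
    unfold Cmd.selectCmd
    rw [Cmd.run]
    refine Cmd.run_loop_induction (n := I.n) _ (fun (i : ℕ) (s' : State) =>
      (s'.nat 13 0 = 0 ∧ ∀ v : Fin I.n, (v : ℕ) < i → s.nat 9 v ≠ 0) ∨
      ∃ v : Fin I.n, (v : ℕ) < i ∧ s'.nat 13 0 = v + 1 ∧ s.nat 9 v = 0 ∧
        s'.nat 14 0 = I.nodeKey s v ∧
        ∀ u : Fin I.n, (u : ℕ) < i → s.nat 9 u = 0 → I.nodeKey s u ≤ I.nodeKey s v) ?_ ?_ ?_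
    · rw [Cmd.run, State.nat_setNat_of_ne _ _ _ _ (by decide), h.n]
    · left
      simp [Cmd.run, NatExp.eval]
    · intro i hi s' hs' _ hc hP
      have fr : ∀ a, a ∉ [13, 14, 15, 24, 25, 26] → s'.nat a = s.nat a := by
        intro a ha
        simp only [List.mem_cons, List.not_mem_nil, not_or, or_false] at ha
        rw [hs' a (by simp [Cmd.writes, Cmd.keyCmd, Cmd.sumLoop, ha]), Cmd.run,
          State.nat_setNat_of_ne _ _ _ _ ha.1]
      have hL : I.Loaded s' := h.of_eq fun a ha => fr a (by simp; omega)
      have h9 := fr 9 (by decide)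
      set v : Fin I.n := ⟨i, hi⟩ with hv
      have hk : (Cmd.keyCmd.run s').nat 15 0 = I.nodeKey s v := by
        rw [run_keyCmd hL v hc, ← nodeKey_congr (fr 5 (by decide)) (fr 8 (by decide)) h9]
        rfl
      have hk13 : (Cmd.keyCmd.run s').nat 13 = s'.nat 13 := Cmd.run_nat _ _ (by decide)
      have hk14 : (Cmd.keyCmd.run s').nat 14 = s'.nat 14 := Cmd.run_nat _ _ (by decide)
      have hk24 : (Cmd.keyCmd.run s').nat 24 = s'.nat 24 := Cmd.run_nat _ _ (by decide)
      have hlt : ∀ u : Fin I.n, (u : ℕ) < i + 1 → u ≠ v → (u : ℕ) < i := fun u hu hne => by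
        have : (u : ℕ) ≠ i := fun hui => hne (Fin.ext hui)
        omega
      rw [Cmd.run]
      split_ifs with ht
      · rw [Test.holds_eq] at ht
        simp only [NatExp.eval, NatExp.eval_var, h9, hc] at ht
        rw [Cmd.run, Cmd.run]
        split_ifs with ht'
        · rw [Test.holds_or, Test.holds_eq, Test.holds_not] at ht'
          simp only [NatExp.eval, NatExp.eval_var, hk13, hk14, hk, Test.Holds, not_le] at ht'
          right
          refine ⟨v, by simp [hv], ?_, ht, ?_, ?_⟩
          · simp [Cmd.run, NatExp.eval, NatExp.eval_var, hk24, hc, hv]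
          · simp [Cmd.run, NatExp.eval, NatExp.eval_var, hk]
          · intro u hu hu9
            by_cases huv : u = v
            · rw [huv]
            · have hui := hlt u hu huv
              rcases hP with ⟨-, hP⟩ | ⟨w, hw, h1, h2, h3, h4⟩
              · exact absurd hu9 (hP u hui)
              · have := h4 u hui hu9
                omega
        · rw [Test.holds_or, Test.holds_eq, Test.holds_not] at ht'
          simp only [NatExp.eval, NatExp.eval_var, hk13, hk14, hk, Test.Holds, not_le,
            not_or, not_lt] at ht'
          right
          rcases hP with ⟨hP, -⟩ | ⟨w, hw, h1, h2, h3, h4⟩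
          · exact absurd hP ht'.1
          · refine ⟨w, by omega, ?_, h2, ?_, ?_⟩
            · simpa [Cmd.run, hk13] using h1
            · simpa [Cmd.run, hk14] using h3
            · intro u hu hu9
              by_cases huv : u = v
              · rw [huv]; omega
              · exact h4 u (hlt u hu huv) hu9
      · rw [Test.holds_eq] at ht
        simp only [NatExp.eval, NatExp.eval_var, h9, hc] at ht
        have hne : ∀ u : Fin I.n, s.nat 9 u = 0 → u ≠ v := by
          rintro u hu rfl
          exact ht hu
        rcases hP with ⟨hP, hP'⟩ | ⟨w, hw, h1, h2, h3, h4⟩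
        · left
          refine ⟨by simpa [Cmd.run] using hP, fun u hu hu9 => ?_⟩
          exact hP' u (hlt u hu (hne u hu9)) hu9
        · right
          refine ⟨w, by omega, by simpa [Cmd.run] using h1, h2, by simpa [Cmd.run] using h3,
            fun u hu hu9 => h4 u (hlt u hu (hne u hu9)) hu9⟩
  rcases key with ⟨h1, h2⟩ | ⟨v, hv, h1, h2, h3, h4⟩
  · exact Or.inl ⟨h1, fun v => h2 v v.2⟩
  · exact Or.inr ⟨v, h1, h2, h3, fun u => h4 u u.2⟩

/-- The memory holds a maximum adjacency ordering up to the scanned nodes. -/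
def IsMaxAdj (I : SmallCutsInstance) (s : State) : Prop :=
  MaxAdj I.endA I.endB (I.weight (I.output s)) (I.nodeArray s 8) (I.scanned s) (s.nat 10 0)
    (s.nat 11 0) (s.nat 12 0)

/-- The number of unscanned nodes drops until it is 0, so `I.n` rounds scan everything. -/
theorem run_scanCmd (h : I.Loaded s) (hM : I.IsMaxAdj s) :
    I.IsMaxAdj (Cmd.scanCmd.run s) ∧
      ((I.scanned s)ᶜ.card = 0 → (I.scanned (Cmd.scanCmd.run s))ᶜ.card = 0) ∧
      ((I.scanned s)ᶜ.card ≠ 0 →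
        (I.scanned (Cmd.scanCmd.run s))ᶜ.card < (I.scanned s)ᶜ.card) := by
  have fr : ∀ a, a ∉ [13, 14, 15, 24, 25, 26] → (Cmd.selectCmd.run s).nat a = s.nat a := by
    intro a ha
    simp only [List.mem_cons, List.not_mem_nil, not_or, or_false] at ha
    exact Cmd.run_nat _ _ (by simp [Cmd.writes, Cmd.selectCmd, Cmd.keyCmd, Cmd.sumLoop, ha])
  have hsel := run_selectCmd h
  unfold Cmd.scanCmd
  rw [Cmd.run, Cmd.run]
  generalize Cmd.selectCmd.run s = s1 at *
  have hM1 : I.IsMaxAdj s1 := by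
    unfold IsMaxAdj nodeArray scanned output at *
    rw [fr 5 (by decide), fr 8 (by decide), fr 9 (by decide), fr 10 (by decide),
      fr 11 (by decide), fr 12 (by decide)]
    exact hM
  have hsc1 : I.scanned s1 = I.scanned s := by
    unfold scanned; rw [fr 9 (by decide)]
  have hcls1 : I.nodeArray s1 8 = I.nodeArray s 8 := by
    unfold nodeArray; rw [fr 8 (by decide)]
  split_ifs with ht
  · rw [Test.holds_not, Test.holds_eq] at ht
    simp only [NatExp.eval, NatExp.eval_var] at ht
    rcases hsel with ⟨h1, -⟩ | ⟨v, h1, h2, h3, h4⟩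
    · exact absurd h1 ht
    simp only [Cmd.run]
    generalize hs2 : State.setNat _ 10 _ _ = s2
    generalize hs3 : State.setNat _ 12 _ _ = s3
    have e2 : ∀ a, a ≠ 10 → a ≠ 11 → s2.nat a = s1.nat a := by
      intro a ha hb
      rw [← hs2, State.nat_setNat_of_ne _ _ _ _ ha, State.nat_setNat_of_ne _ _ _ _ hb]
    have e3 : ∀ a, a ≠ 12 → s3.nat a = s2.nat a := by
      intro a ha
      rw [← hs3, State.nat_setNat_of_ne _ _ _ _ ha]
    have e11 : s3.nat 11 0 = s.nat 10 0 := by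
      rw [e3 11 (by decide), ← hs2]
      simp [NatExp.eval, NatExp.eval_var, fr 10 (by decide)]
    have e10 : s3.nat 10 0 = I.nodeArray s 8 v := by
      rw [e3 10 (by decide), ← hs2]
      simp [NatExp.eval, NatExp.eval_var, nodeArray, h1, fr 8 (by decide)]
    have e12 : s3.nat 12 0 = I.nodeKey s v := by
      rw [← hs3]
      simp [NatExp.eval, NatExp.eval_var, e2 14 (by decide) (by decide), h3]
    have e8 : s3.nat 8 = s.nat 8 := by
      rw [e3 8 (by decide), e2 8 (by decide) (by decide), fr 8 (by decide)]
    have e9 : s3.nat 9 = s.nat 9 := by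
      rw [e3 9 (by decide), e2 9 (by decide) (by decide), fr 9 (by decide)]
    have e5 : s3.nat 5 = s.nat 5 := by
      rw [e3 5 (by decide), e2 5 (by decide) (by decide), fr 5 (by decide)]
    have e0 : s3.nat 0 0 = I.n := by
      rw [e3 0 (by decide), e2 0 (by decide) (by decide), fr 0 (by decide), h.n]
    set p := Cmd.mapLoop 27 0 9 (Test.eq (.load 8 (.var 27)) (.var 10)) (.const 1) with hp
    have fr4 : ∀ a, a ≠ 27 → a ≠ 9 → (p.run s3).nat a = s3.nat a := by
      intro a ha hb
      exact Cmd.run_nat _ _ (by simp [hp, Cmd.mapLoop, Cmd.writes, ha, hb])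
    have hmap : ∀ j, (p.run s3).nat 9 j =
        if j < s3.nat 0 0 ∧ s.nat 8 j = I.nodeArray s 8 v then 1 else s3.nat 9 j := by
      classical
      intro j
      rw [hp, Cmd.run_mapLoop s3 (fun j => s.nat 8 j = I.nodeArray s 8 v) (fun _ => 1)
        (by decide) _ j]
      · split_ifs <;> rfl
      · intro i hi s' hs' hc _
        rw [Test.holds_eq]
        simp [NatExp.eval, NatExp.eval_var, hs' 8 (by decide) (by decide),
          hs' 10 (by decide) (by decide), hc, e8, e10]
    have hscan : I.scanned (p.run s3) =
        I.scanned s ∪ classSet (I.nodeArray s 8) (I.nodeArray s 8 v) := by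
      ext u
      rw [Finset.mem_union, mem_scanned, mem_scanned, mem_classSet, hmap, e9, e0]
      simp only [u.2, true_and, nodeArray]
      split_ifs with hu <;> simp [hu]
    have hv : v ∉ I.scanned s := by simp [h2]
    have hlt : (I.scanned (p.run s3))ᶜ.card < (I.scanned s)ᶜ.card := by
      refine Finset.card_lt_card ⟨?_, ?_⟩
      · rw [hscan]
        exact Finset.compl_subset_compl.2 Finset.subset_union_left
      · rw [hscan]
        intro hsub
        have := hsub (Finset.mem_compl.2 hv)
        simp at this
    refine ⟨?_, fun h0 => by omega, fun _ => hlt⟩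
    have hstep := hM.step hv (fun u hu => h4 u (by simpa using hu))
    unfold IsMaxAdj
    rw [hscan, fr4 10 (by decide) (by decide), fr4 11 (by decide) (by decide),
      fr4 12 (by decide) (by decide), e10, e11, e12,
      output_congr ((fr4 5 (by decide) (by decide)).trans e5)]
    have : I.nodeArray (p.run s3) 8 = I.nodeArray s 8 := by
      unfold nodeArray; rw [fr4 8 (by decide) (by decide), e8]
    rw [this]
    exact hstep
  · rw [Test.holds_not, Test.holds_eq, not_not] at ht
    simp only [NatExp.eval, NatExp.eval_var] at ht
    rcases hsel with ⟨-, h1⟩ | ⟨v, h1, -⟩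
    · have hz : (I.scanned s)ᶜ.card = 0 := by
        rw [Finset.card_eq_zero, Finset.compl_eq_empty_iff, Finset.eq_univ_iff_forall]
        simpa using h1
      simp only [Cmd.run]
      rw [hsc1]
      exact ⟨hM1, fun h0 => h0, fun h0 => absurd hz h0⟩
    · omega

end SmallCutsInstance

/-! ### Correctness of the orderings and of the labeling -/

namespace SmallCutsInstance

open RAM

variable {I : SmallCutsInstance} {s : State}

theorem isMaxAdj_congr {s' : State} (h : ∀ a ∈ [5, 8, 9, 10, 11, 12], s'.nat a = s.nat a) :
    I.IsMaxAdj s' ↔ I.IsMaxAdj s := by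
  unfold IsMaxAdj nodeArray scanned output
  rw [h 5 (by decide), h 8 (by decide), h 9 (by decide), h 10 (by decide), h 11 (by decide),
    h 12 (by decide)]

theorem scanned_congr {s' : State} (h : s'.nat 9 = s.nat 9) : I.scanned s' = I.scanned s := by
  unfold scanned; rw [h]

theorem run_orderCmd (h : I.Loaded s) :
    I.IsMaxAdj (Cmd.orderCmd.run s) ∧ I.scanned (Cmd.orderCmd.run s) = Finset.univ := by
  unfold Cmd.orderCmd
  simp only [Cmd.run_seq, Cmd.run_setNat]
  generalize hs1 : State.setNat _ 12 _ _ = s1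
  have e1 : ∀ a, a ∉ [10, 11, 12] → s1.nat a = s.nat a := by
    intro a ha
    simp only [List.mem_cons, List.not_mem_nil, not_or, or_false] at ha
    rw [← hs1, State.nat_setNat_of_ne _ _ _ _ ha.2.2, State.nat_setNat_of_ne _ _ _ _ ha.2.1,
      State.nat_setNat_of_ne _ _ _ _ ha.1]
  have z10 : s1.nat 10 0 = 0 := by simp [← hs1, NatExp.eval]
  have z11 : s1.nat 11 0 = 0 := by simp [← hs1, NatExp.eval]
  have z12 : s1.nat 12 0 = 0 := by simp [← hs1, NatExp.eval]
  set p := Cmd.mapLoop 22 0 9 Test.true (.const 0) with hp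
  set q := Cmd.mapLoop 22 0 9 (Test.eq (.load 8 (.var 22)) (.const 0)) (.const 1) with hq
  have frp : ∀ s : State, ∀ a, a ≠ 22 → a ≠ 9 → (p.run s).nat a = s.nat a := by
    intro s a ha hb
    exact Cmd.run_nat _ _ (by simp [hp, Cmd.mapLoop, Cmd.writes, ha, hb])
  have frq : ∀ s : State, ∀ a, a ≠ 22 → a ≠ 9 → (q.run s).nat a = s.nat a := by
    intro s a ha hb
    exact Cmd.run_nat _ _ (by simp [hq, Cmd.mapLoop, Cmd.writes, ha, hb])
  have e2 : ∀ a, a ∉ [9, 10, 11, 12, 22] → (q.run (p.run s1)).nat a = s.nat a := by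
    intro a ha
    simp only [List.mem_cons, List.not_mem_nil, not_or, or_false] at ha
    rw [frq _ a (by omega) (by omega), frp _ a (by omega) (by omega), e1 a (by simp; omega)]
  have hp9 : ∀ j < I.n, (p.run s1).nat 9 j = 0 := by
    intro j hj
    rw [hp, Cmd.run_mapLoop s1 (fun _ => True) (fun _ => 0) (by decide) _ j]
    · rw [if_pos ⟨by rw [e1 0 (by decide), h.n]; exact hj, trivial⟩]
    · intro i _ s' _ _ _
      exact ⟨iff_of_true Test.holds_true trivial, fun _ => rfl⟩
  have hscan : I.scanned (q.run (p.run s1)) = classSet (I.nodeArray s 8) 0 := by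
    classical
    ext u
    rw [mem_scanned, mem_classSet, hq, Cmd.run_mapLoop (p.run s1) (fun j => s.nat 8 j = 0)
      (fun _ => 1) (by decide) _ u]
    · rw [hp9 u u.2, frp _ 0 (by decide) (by decide), e1 0 (by decide), h.n]
      simp [nodeArray]
    · intro i _ s' hs' hc _
      rw [Test.holds_eq]
      simp [NatExp.eval, NatExp.eval_var, hs' 8 (by decide) (by decide), hc,
        frp _ 8 (by decide) (by decide), e1 8 (by decide)]
  have hmax : I.IsMaxAdj (q.run (p.run s1)) := by
    unfold IsMaxAdj
    rw [hscan, frq _ 10 (by decide) (by decide), frq _ 11 (by decide) (by decide),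
      frq _ 12 (by decide) (by decide), frp _ 10 (by decide) (by decide),
      frp _ 11 (by decide) (by decide), frp _ 12 (by decide) (by decide), z10, z11, z12,
      show I.nodeArray (q.run (p.run s1)) 8 = I.nodeArray s 8 by
        unfold nodeArray; rw [e2 8 (by decide)]]
    exact MaxAdj.init
  generalize q.run (p.run s1) = s2 at *
  have key := Cmd.run_loop_induction (c := 23) (b := 0) (p := Cmd.scanCmd) (n := I.n) s2
    (fun i s' => I.IsMaxAdj s' ∧ (I.scanned s')ᶜ.card ≤ I.n - i)
    (by rw [e2 0 (by decide), h.n]) ?_ ?_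
  · refine ⟨key.1, ?_⟩
    rw [← Finset.compl_eq_empty_iff, ← Finset.card_eq_zero]
    have := key.2
    omega
  · refine ⟨(isMaxAdj_congr fun a ha => State.nat_setNat_of_ne _ _ _ _ ?_).2 hmax, ?_⟩
    · rintro rfl; simp at ha
    · exact (Finset.card_le_univ _).trans (by simp)
  · rintro i hi s' hs' - hc ⟨hP1, hP2⟩
    have hL : I.Loaded s' := h.of_eq fun a ha => by
      rw [hs' a (by
        simp [Cmd.writes, Cmd.scanCmd, Cmd.selectCmd, Cmd.keyCmd, Cmd.sumLoop, Cmd.mapLoop]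
        omega), e2 a (by simp; omega)]
    obtain ⟨h1, h2, h3⟩ := run_scanCmd hL hP1
    refine ⟨(isMaxAdj_congr fun a ha => State.nat_setNat_of_ne _ _ _ _ ?_).2 h1, ?_⟩
    · rintro rfl; simp at ha
    · rw [scanned_congr (State.nat_setNat_of_ne _ _ _ _ (by decide))]
      omega

/-- The invariant of the labeling program. -/
def IsLabelInv (I : SmallCutsInstance) (J : Finset (Fin I.G.m)) (s : State) : Prop :=
  LabelInv (cutWeight I.endA I.endB (I.weight J)) I.k (I.nodeArray s 8) (I.nodeArray s 6)
    (s.nat 7 0)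

/-- The three branches are `LabelInv.found`, `LabelInv.merge` and the idle phase with only class 0
left; truncated subtraction covers the last. -/
theorem run_phaseCmd (h : I.Loaded s) (hinv : I.IsLabelInv (I.output s) s) :
    I.IsLabelInv (I.output s) (Cmd.phaseCmd.run s) ∧
      numClasses (I.nodeArray (Cmd.phaseCmd.run s) 8) ≤ numClasses (I.nodeArray s 8) - 1 := by
  classical
  obtain ⟨hmax, huniv⟩ := run_orderCmd h
  have fr : ∀ a, (a < 9 ∨ 27 < a) → (Cmd.orderCmd.run s).nat a = s.nat a := by
    intro a ha
    refine Cmd.run_nat _ _ ?_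
    simp [Cmd.writes, Cmd.orderCmd, Cmd.scanCmd, Cmd.selectCmd, Cmd.keyCmd, Cmd.sumLoop,
      Cmd.mapLoop]
    omega
  unfold Cmd.phaseCmd
  rw [Cmd.run]
  generalize Cmd.orderCmd.run s = s1 at *
  have hcls : I.nodeArray s1 8 = I.nodeArray s 8 := by
    unfold nodeArray; rw [fr 8 (by decide)]
  have hinv1 : I.IsLabelInv (I.output s) s1 := by
    unfold IsLabelInv nodeArray at *
    rw [fr 8 (by decide), fr 7 (by decide), fr 6 (by decide)]
    exact hinv
  unfold IsMaxAdj at hmax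
  rw [huniv, hcls, output_congr (fr 5 (by decide))] at hmax
  have hn : s1.nat 0 0 = I.n := by rw [fr 0 (by decide), h.n]
  rw [Cmd.run]
  split_ifs with ht
  · rw [Test.holds_not, Test.holds_eq] at ht
    simp only [NatExp.eval, NatExp.eval_var] at ht
    have hmem : ∃ v, I.nodeArray s 8 v = s1.nat 10 0 := by
      obtain ⟨v, -, hv⟩ := hmax.last_mem ht
      exact ⟨v, hv⟩
    rw [Cmd.run]
    split_ifs with ht'
    · rw [Test.holds_not] at ht'
      simp only [NatExp.eval, NatExp.eval_var, Test.Holds, fr 0 (by decide), h.k, not_le] at ht'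
      rw [hmax.key_eq_cutWeight ht] at ht'
      have hfound := LabelInv.found hinv ht hmem ht'
      have hnum := numClasses_lt (p := 0) ht hmem (Ne.symm ht) (fun h => absurd rfl h)
      simp only [Cmd.run]
      generalize hs2 : State.setNat _ 7 _ _ = s2
      have e2 : ∀ a, a ≠ 7 → s2.nat a = s1.nat a := fun a ha => by
        rw [← hs2, State.nat_setNat_of_ne _ _ _ _ ha]
      have e27 : s2.nat 7 0 = s.nat 7 0 + 1 := by
        simp [← hs2, NatExp.eval, NatExp.eval_var, fr 7 (by decide)]
      set p := Cmd.mapLoop 28 0 6 (Test.eq (.load 8 (.var 28)) (.var 10)) (.var 7) with hp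
      set q := Cmd.mapLoop 28 0 8 (Test.eq (.load 8 (.var 28)) (.var 10)) (.const 0) with hq
      have frp : ∀ s : State, ∀ a, a ≠ 28 → a ≠ 6 → (p.run s).nat a = s.nat a := by
        intro s a ha hb
        exact Cmd.run_nat _ _ (by simp [hp, Cmd.mapLoop, Cmd.writes, ha, hb])
      have frq : ∀ s : State, ∀ a, a ≠ 28 → a ≠ 8 → (q.run s).nat a = s.nat a := by
        intro s a ha hb
        exact Cmd.run_nat _ _ (by simp [hq, Cmd.mapLoop, Cmd.writes, ha, hb])
      have h6 : I.nodeArray (q.run (p.run s2)) 6 =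
          fun v => if I.nodeArray s 8 v = s1.nat 10 0 then s.nat 7 0 + 1 else I.nodeArray s 6 v := by
        funext v
        unfold nodeArray
        rw [frq _ 6 (by decide) (by decide), hp, Cmd.run_mapLoop s2
          (fun j => s.nat 8 j = s1.nat 10 0) (fun _ => s.nat 7 0 + 1) (by decide) _ v]
        · rw [e2 0 (by decide), hn, e2 6 (by decide), fr 6 (by decide)]
          simp
        · intro i _ s' hs' hc _
          rw [Test.holds_eq]
          simp [NatExp.eval, NatExp.eval_var, hs' 8 (by decide) (by decide), hc,
            hs' 10 (by decide) (by decide), hs' 7 (by decide) (by decide), e2 8 (by decide),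
            e2 10 (by decide), fr 8 (by decide), e27]
      have h8 : I.nodeArray (q.run (p.run s2)) 8 =
          fun v => if I.nodeArray s 8 v = s1.nat 10 0 then 0 else I.nodeArray s 8 v := by
        funext v
        unfold nodeArray
        rw [hq, Cmd.run_mapLoop (p.run s2)
          (fun j => s.nat 8 j = s1.nat 10 0) (fun _ => 0) (by decide) _ v]
        · rw [frp _ 0 (by decide) (by decide), frp _ 8 (by decide) (by decide), e2 0 (by decide),
            hn, e2 8 (by decide), fr 8 (by decide)]
          simp
        · intro i _ s' hs' hc hi
          rw [Test.holds_eq]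
          simp [NatExp.eval, NatExp.eval_var, hc, hi, hs' 10 (by decide) (by decide),
            e2 8 (by decide), e2 10 (by decide), fr 8 (by decide),
            frp _ 8 (by decide) (by decide), frp _ 10 (by decide) (by decide)]
      have h7 : (q.run (p.run s2)).nat 7 0 = s.nat 7 0 + 1 := by
        rw [frq _ 7 (by decide) (by decide), frp _ 7 (by decide) (by decide), e27]
      unfold IsLabelInv
      rw [h6, h7, h8]
      exact ⟨hfound, by omega⟩
    · rw [Test.holds_not, not_not] at ht'
      simp only [NatExp.eval, NatExp.eval_var, Test.Holds, fr 0 (by decide), h.k] at ht'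
      have hmerge := LabelInv.merge hinv ht (hmax.prev_ne ht) (fun σ h0 hσ =>
        ht'.trans (hmax.key_le_cutWeight ht σ h0 hσ))
      have hnum := numClasses_lt ht hmem (hmax.prev_ne ht) hmax.prev_mem
      set q := Cmd.mapLoop 29 0 8 (Test.eq (.load 8 (.var 29)) (.var 10)) (.var 11) with hq
      have frq : ∀ s : State, ∀ a, a ≠ 29 → a ≠ 8 → (q.run s).nat a = s.nat a := by
        intro s a ha hb
        exact Cmd.run_nat _ _ (by simp [hq, Cmd.mapLoop, Cmd.writes, ha, hb])
      have h8 : I.nodeArray (q.run s1) 8 =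
          fun v => if I.nodeArray s 8 v = s1.nat 10 0 then s1.nat 11 0 else I.nodeArray s 8 v := by
        funext v
        unfold nodeArray
        rw [hq, Cmd.run_mapLoop s1
          (fun j => s.nat 8 j = s1.nat 10 0) (fun _ => s1.nat 11 0) (by decide) _ v]
        · rw [hn, fr 8 (by decide)]
          simp
        · intro i _ s' hs' hc hi
          rw [Test.holds_eq]
          simp [NatExp.eval, NatExp.eval_var, hc, hi, hs' 10 (by decide) (by decide),
            hs' 11 (by decide) (by decide), fr 8 (by decide)]
      unfold IsLabelInv
      rw [h8, frq _ 7 (by decide) (by decide), fr 7 (by decide),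
        show I.nodeArray (q.run s1) 6 = I.nodeArray s 6 by
          unfold nodeArray; rw [frq _ 6 (by decide) (by decide), fr 6 (by decide)]]
      exact ⟨hmerge, by omega⟩
  · rw [Test.holds_not, Test.holds_eq, not_not] at ht
    simp only [NatExp.eval, NatExp.eval_var] at ht
    refine ⟨hinv1, ?_⟩
    have : numClasses (I.nodeArray s 8) = 0 := by
      unfold numClasses
      rw [Finset.card_eq_zero, Finset.eq_empty_iff_forall_notMem]
      intro c hc
      simp only [Finset.mem_erase, Finset.mem_image, Finset.mem_univ, true_and] at hc
      obtain ⟨hc, v, rfl⟩ := hc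
      exact hc (hmax.last_zero ht v (Finset.mem_univ v))
    rw [Cmd.run, hcls, this]

theorem labelCmd_writes {a : ℕ} (ha : a < 6 ∨ (15 < a ∧ a < 20) ∨ 29 < a) :
    a ∉ Cmd.labelCmd.writes := by
  simp [Cmd.writes, Cmd.labelCmd, Cmd.phaseCmd, Cmd.orderCmd, Cmd.scanCmd, Cmd.selectCmd,
    Cmd.keyCmd, Cmd.sumLoop, Cmd.mapLoop]
  omega

theorem phaseCmd_writes {a : ℕ} (ha : a < 6 ∨ (15 < a ∧ a < 22) ∨ 29 < a) :
    a ∉ Cmd.phaseCmd.writes := by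
  simp [Cmd.writes, Cmd.phaseCmd, Cmd.orderCmd, Cmd.scanCmd, Cmd.selectCmd,
    Cmd.keyCmd, Cmd.sumLoop, Cmd.mapLoop]
  omega

theorem run_labelCmd (h : I.Loaded s) :
    IsLabeling (I.residualCut (I.output s)) I.k (I.nodeArray (Cmd.labelCmd.run s) 6)
      ((Cmd.labelCmd.run s).nat 7 0) := by
  unfold Cmd.labelCmd
  simp only [Cmd.run_seq, Cmd.run_setNat]
  generalize hs1 : State.setNat _ 7 _ _ = s1
  have e1 : ∀ a, a ≠ 7 → s1.nat a = s.nat a := fun a ha => by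
    rw [← hs1, State.nat_setNat_of_ne _ _ _ _ ha]
  have z7 : s1.nat 7 0 = 0 := by simp [← hs1, NatExp.eval]
  set p := Cmd.mapLoop 20 0 6 Test.true (.const 0) with hp
  set q := Cmd.mapLoop 20 0 8 Test.true (.add (.var 20) (.const 1)) with hq
  have frp : ∀ s : State, ∀ a, a ≠ 20 → a ≠ 6 → (p.run s).nat a = s.nat a := by
    intro s a ha hb
    exact Cmd.run_nat _ _ (by simp [hp, Cmd.mapLoop, Cmd.writes, ha, hb])
  have frq : ∀ s : State, ∀ a, a ≠ 20 → a ≠ 8 → (q.run s).nat a = s.nat a := by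
    intro s a ha hb
    exact Cmd.run_nat _ _ (by simp [hq, Cmd.mapLoop, Cmd.writes, ha, hb])
  have e2 : ∀ a, a ∉ [6, 7, 8, 20] → (q.run (p.run s1)).nat a = s.nat a := by
    intro a ha
    simp only [List.mem_cons, List.not_mem_nil, not_or, or_false] at ha
    rw [frq _ a (by omega) (by omega), frp _ a (by omega) (by omega), e1 a (by omega)]
  have h6 : I.nodeArray (q.run (p.run s1)) 6 = fun _ => 0 := by
    funext v
    unfold nodeArray
    rw [frq _ 6 (by decide) (by decide), hp, Cmd.run_mapLoop s1 (fun _ => True) (fun _ => 0)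
      (by decide) _ v]
    · rw [if_pos ⟨by rw [e1 0 (by decide), h.n]; exact v.2, trivial⟩]
    · intro i _ s' _ _ _
      exact ⟨iff_of_true Test.holds_true trivial, fun _ => rfl⟩
  have h8 : I.nodeArray (q.run (p.run s1)) 8 = fun v : Fin I.n => (v : ℕ) + 1 := by
    funext v
    unfold nodeArray
    rw [hq, Cmd.run_mapLoop (p.run s1) (fun _ => True) (fun j => j + 1) (by decide) _ v]
    · rw [if_pos ⟨by rw [frp _ 0 (by decide) (by decide), e1 0 (by decide), h.n]; exact v.2,
        trivial⟩]
    · intro i _ s' _ hc _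
      exact ⟨iff_of_true Test.holds_true trivial, fun _ => by
        simp [NatExp.eval, NatExp.eval_var, hc]⟩
  have hinit : I.IsLabelInv (I.output s) (q.run (p.run s1)) := by
    unfold IsLabelInv
    rw [h6, h8, frq _ 7 (by decide) (by decide), frp _ 7 (by decide) (by decide), z7]
    exact LabelInv.init _ _ (fun v => by omega) (fun u v huv => Fin.ext (by simpa using huv))
  generalize q.run (p.run s1) = s2 at *
  have key := Cmd.run_loop_induction (c := 21) (b := 0) (p := Cmd.phaseCmd) (n := I.n) s2
    (fun i s' => I.IsLabelInv (I.output s) s' ∧ numClasses (I.nodeArray s' 8) ≤ I.n - i)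
    (by rw [e2 0 (by decide), h.n]) ?_ ?_
  · refine LabelInv.isLabeling key.1 (eq_zero_of_numClasses ?_)
    have := key.2
    omega
  · refine ⟨?_, (numClasses_le _).trans (by simp)⟩
    unfold IsLabelInv nodeArray
    rw [State.nat_setNat_of_ne _ _ _ _ (by decide), State.nat_setNat_of_ne _ _ _ _ (by decide),
      State.nat_setNat_of_ne _ _ _ _ (by decide)]
    exact hinit
  · rintro i hi s' hs' - hc ⟨hP1, hP2⟩
    have fr : ∀ a < 6, s'.nat a = s.nat a := fun a ha => by
      rw [hs' a (by
        rw [Cmd.writes, List.mem_cons, not_or]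
        exact ⟨by omega, phaseCmd_writes (by omega)⟩), e2 a (by simp; omega)]
    have hL : I.Loaded s' := h.of_eq fun a ha => fr a (by omega)
    rw [← output_congr (fr 5 (by omega))] at hP1
    obtain ⟨h1, h2⟩ := run_phaseCmd hL hP1
    rw [output_congr (fr 5 (by omega))] at h1
    unfold IsLabelInv nodeArray at *
    rw [State.nat_setNat_of_ne _ _ _ _ (by decide), State.nat_setNat_of_ne _ _ _ _ (by decide),
      State.nat_setNat_of_ne _ _ _ _ (by decide)]
    exact ⟨h1, by omega⟩

end SmallCutsInstance

/-! ## Analysis of the primal-dual method -/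

namespace SmallCutsInstance

variable {I : SmallCutsInstance}

theorem residualCut_eq (J : Finset (Fin I.G.m)) (S : Finset (Fin I.n)) :
    I.residualCut J S = I.H.cutSize S + (I.G.delta J S).card * I.k := by
  unfold residualCut cutWeight
  rw [Fintype.sum_sum_type]
  congr 1
  · unfold Multigraph.cutSize Multigraph.delta
    rw [Finset.card_filter]
    exact Finset.sum_congr rfl fun e _ => rfl
  · unfold Multigraph.delta
    rw [Finset.card_eq_sum_ones, Finset.sum_filter, Finset.sum_mul, ← Finset.sum_subset
      (Finset.subset_univ J) (fun e _ he => by simp [weight, he])]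
    refine Finset.sum_congr rfl fun e he => ?_
    simp only [endA, endB, weight, Sum.elim_inr, he, if_true, ite_mul, one_mul, zero_mul]
    rfl

/-- A single covering edge of `J` already contributes weight `k`. -/
theorem isSmall_residualCut {J : Finset (Fin I.G.m)} {S : Finset (Fin I.n)} :
    IsSmall (I.residualCut J) I.k S ↔
      S.Nonempty ∧ I.H.cutSize S < I.k ∧
        ∀ e ∈ J, ¬ Separates S (I.G.fst e) (I.G.snd e) := by
  have hd : (∀ e ∈ J, ¬ Separates S (I.G.fst e) (I.G.snd e)) ↔ (I.G.delta J S).card = 0 := by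
    rw [Finset.card_eq_zero, Multigraph.delta, Finset.filter_eq_empty_iff]
    rfl
  rw [hd, IsSmall, residualCut_eq]
  have := I.k_pos
  constructor
  · rintro ⟨h1, h2⟩
    refine ⟨h1, by omega, ?_⟩
    by_contra h0
    have := Nat.mul_le_mul_right I.k (Nat.one_le_iff_ne_zero.2 h0)
    omega
  · rintro ⟨h1, h2, h3⟩
    exact ⟨h1, by rw [h3]; omega⟩

theorem isSolution_iff {J : Finset (Fin I.G.m)} : I.IsSolution J ↔
    ∀ S, IsSmall (I.residualCut J) I.k S → S = Finset.univ := by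
  constructor
  · intro h S hS
    by_contra hne
    rw [isSmall_residualCut] at hS
    have := h S ⟨hS.1, hne, hS.2.1⟩
    obtain ⟨e, he⟩ := Finset.card_pos.1 this
    rw [Multigraph.delta, Finset.mem_filter] at he
    exact hS.2.2 e he.1 he.2
  · rintro h S ⟨h1, h2, h3⟩
    by_contra h0
    refine h2 (h S (isSmall_residualCut.2 ⟨h1, h3, fun e he hs => h0 ?_⟩))
    exact Finset.card_pos.2 ⟨e, Finset.mem_filter.2 ⟨he, hs⟩⟩

theorem ne_univ_of_two_le {J : Finset (Fin I.G.m)}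
    (h : 2 ≤ (minSmall (I.residualCut J) I.k).card) {C : Finset (Fin I.n)}
    (hC : C ∈ minSmall (I.residualCut J) I.k) : C ≠ Finset.univ := by
  rintro rfl
  obtain ⟨D, hD, hne⟩ := Finset.exists_mem_ne (by omega : 1 < (minSmall (I.residualCut J) I.k).card) Finset.univ
  exact hne ((mem_minSmall.1 hC).2 D (Finset.subset_univ D) (mem_minSmall.1 hD).1)

/-- If a proper set is small, so is its complement, and the two contain different minimal small
sets. Conversely, for a solution the only small set is the whole node set. -/
theorem isSolution_iff_card {J : Finset (Fin I.G.m)} : I.IsSolution J ↔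
    (minSmall (I.residualCut J) I.k).card < 2 := by
  constructor
  · intro h
    by_contra hlt
    rw [not_lt] at hlt
    obtain ⟨C, hC⟩ := Finset.card_pos.1 (by omega : 0 < (minSmall (I.residualCut J) I.k).card)
    exact ne_univ_of_two_le hlt hC (isSolution_iff.1 h C (mem_minSmall.1 hC).1)
  · intro h
    rw [isSolution_iff]
    intro S hS
    by_contra hne
    have hS' : IsSmall (I.residualCut J) I.k Sᶜ := by
      refine ⟨?_, ?_⟩
      · rwa [Finset.nonempty_iff_ne_empty, ne_eq, Finset.compl_eq_empty_iff]
      · have := cutWeight_compl I.endA I.endB (I.weight J) S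
        exact this.trans_lt hS.2
    obtain ⟨C, hC, hCS⟩ := hS.exists_minSmall
    obtain ⟨D, hD, hDS⟩ := hS'.exists_minSmall
    have hCD : C = D := Finset.card_le_one.1 (by omega) C hC D hD
    obtain ⟨v, hv⟩ := (mem_minSmall.1 hC).1.1
    exact Finset.mem_compl.1 (hDS (hCD ▸ hv)) (hCS hv)

theorem IsSolution.mono {J K : Finset (Fin I.G.m)} (h : I.IsSolution J) (hJK : J ⊆ K) :
    I.IsSolution K := fun S hS =>
  (h S hS).trans (Finset.card_le_card (Finset.filter_subset_filter _ hJK))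

/-- The number of minimal uncovered sets that the edge `e` covers, if `J` has been chosen so far. -/
noncomputable def mult (I : SmallCutsInstance) (J : Finset (Fin I.G.m)) (e : Fin I.G.m) : ℕ :=
  ((minSmall (I.residualCut J) I.k).filter
    fun C => Separates C (I.G.fst e) (I.G.snd e)).card

theorem mult_eq_zero {J : Finset (Fin I.G.m)} {e : Fin I.G.m} (he : e ∈ J) : I.mult J e = 0 := by
  rw [mult, Finset.card_eq_zero, Finset.filter_eq_empty_iff]
  intro C hC
  exact (isSmall_residualCut.1 (mem_minSmall.1 hC).1).2.2 e he

theorem sum_mult (J K : Finset (Fin I.G.m)) : ∑ e ∈ K, I.mult J e =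
    ∑ C ∈ minSmall (I.residualCut J) I.k,
      (K.filter fun e => Separates C (I.G.fst e) (I.G.snd e)).card := by
  simp only [mult, Finset.card_filter]
  exact Finset.sum_comm

/-- The lower-bound half of the duality: every minimal small set is then a proper small cut, which a
solution covers at least once. -/
theorem card_le_sum_mult {J K : Finset (Fin I.G.m)}
    (h : 2 ≤ (minSmall (I.residualCut J) I.k).card) (hK : I.IsSolution K) :
    (minSmall (I.residualCut J) I.k).card ≤ ∑ e ∈ K, I.mult J e := by
  rw [sum_mult, Finset.card_eq_sum_ones]
  refine Finset.sum_le_sum fun C hC => ?_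
  have hs := isSmall_residualCut.1 (mem_minSmall.1 hC).1
  exact hK C ⟨hs.1, ne_univ_of_two_le h hC, hs.2.1⟩

theorem exists_mult_ne_zero {J K : Finset (Fin I.G.m)}
    (h : 2 ≤ (minSmall (I.residualCut J) I.k).card) (hK : I.IsSolution K) :
    ∃ e, I.mult J e ≠ 0 := by
  by_contra hno
  push Not at hno
  have := card_le_sum_mult h hK
  simp only [hno, Finset.sum_const_zero] at this
  omega

/-! ### The growth phase -/

/-- The edge set whose elements, increased by one, are the first `i` entries of `o`. -/
def added (I : SmallCutsInstance) (o : ℕ → ℕ) (i : ℕ) : Finset (Fin I.G.m) :=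
  Finset.univ.filter fun e => ∃ j < i, o j = e + 1

theorem mem_added {o : ℕ → ℕ} {i : ℕ} {e : Fin I.G.m} :
    e ∈ I.added o i ↔ ∃ j < i, o j = e + 1 := by simp [added]

theorem added_mono (o : ℕ → ℕ) {i j : ℕ} (h : i ≤ j) : I.added o i ⊆ I.added o j := by
  intro e he
  rw [mem_added] at *
  obtain ⟨l, hl, hl'⟩ := he
  exact ⟨l, by omega, hl'⟩

theorem added_congr {o o' : ℕ → ℕ} {i : ℕ} (h : ∀ j < i, o j = o' j) :
    I.added o i = I.added o' i := by
  ext e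
  simp only [mem_added]
  exact ⟨fun ⟨j, hj, h'⟩ => ⟨j, hj, (h j hj).symm.trans h'⟩, fun ⟨j, hj, h'⟩ =>
    ⟨j, hj, (h j hj).trans h'⟩⟩

/-- The invariant of the growth phase: `r` are the scaled residual costs and `o` is the order in
which the edges have been chosen. -/
structure GrowInv (I : SmallCutsInstance) (i : ℕ) (o : ℕ → ℕ) (r : Fin I.G.m → ℝ) : Prop where
  zero : ∀ j ≥ i, o j = 0
  inj : ∀ j j', o j ≠ 0 → o j = o j' → j = j'
  le : ∀ j, o j ≤ I.G.m
  nonneg : ∀ e, 0 ≤ r e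
  tight : ∀ e ∈ I.added o i, r e = 0
  -- The true residual cost is `θ * r e`, and `ε j` is the amount by which round `j` raises the dual
  -- variable of every minimal small set.
  dual : ∃ θ > (0 : ℝ), ∃ ε : ℕ → ℝ, (∀ j, 0 ≤ ε j) ∧
    (∀ j, ε j ≠ 0 → 2 ≤ (minSmall (I.residualCut (I.added o j)) I.k).card) ∧
    ∀ e, I.c e = θ * r e + ∑ j ∈ Finset.range i, ε j * I.mult (I.added o j) e
  -- On feasible instances each round adds a new edge until the edges form a solution, so `I.G.m`
  -- rounds are enough.
  progress : (∃ J, I.IsSolution J) → I.IsSolution (I.added o i) ∨ i ≤ (I.added o i).card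

theorem GrowInv.init : I.GrowInv 0 (fun _ => 0) I.c where
  zero _ _ := rfl
  inj _ _ h := absurd rfl h
  le _ := Nat.zero_le _
  nonneg := I.c_nonneg
  tight e he := by simp [added] at he
  dual := ⟨1, one_pos, fun _ => 0, fun _ => le_rfl, fun _ h => absurd rfl h, by simp⟩
  progress _ := Or.inr (Nat.zero_le _)

variable {i : ℕ} {o : ℕ → ℕ} {r : Fin I.G.m → ℝ}

theorem GrowInv.idle (h : I.GrowInv i o r)
    (hsol : (∃ J, I.IsSolution J) → I.IsSolution (I.added o i)) : I.GrowInv (i + 1) o r := by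
  have hadd : I.added o (i + 1) = I.added o i := by
    refine (added_mono o (Nat.le_succ i)).antisymm' fun e he => ?_
    rw [mem_added] at *
    obtain ⟨j, hj, hj'⟩ := he
    refine ⟨j, ?_, hj'⟩
    by_contra hji
    rw [h.zero j (by omega)] at hj'
    omega
  obtain ⟨θ, hθ, ε, hε, hε2, hc⟩ := h.dual
  refine ⟨fun j hj => h.zero j (by omega), h.inj, h.le, h.nonneg, hadd ▸ h.tight,
    ⟨θ, hθ, fun j => if j < i then ε j else 0, fun j => ?_, fun j hj => ?_, fun e => ?_⟩, fun hf => ?_⟩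
  · dsimp only
    split_ifs
    · exact hε j
    · exact le_rfl
  · dsimp only at hj
    split_ifs at hj with hji
    · exact hε2 j hj
    · exact absurd rfl hj
  · dsimp only
    rw [Finset.sum_range_succ, if_neg (lt_irrefl i), zero_mul, add_zero, hc e]
    congr 1
    refine Finset.sum_congr rfl fun j hj => ?_
    rw [if_pos (Finset.mem_range.1 hj)]
  · rw [hadd]
    exact Or.inl (hsol hf)

/-- Here `b` is the least value of `2 * r f / mult f` over edges of non-zero multiplicity, attained
at `e`. Doubling the residual costs before subtracting keeps all quantities free of division. -/
theorem GrowInv.grow (h : I.GrowInv i o r)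
    (h2 : 2 ≤ (minSmall (I.residualCut (I.added o i)) I.k).card) {e : Fin I.G.m} {b : ℝ}
    (he : I.mult (I.added o i) e ≠ 0) (hb : I.mult (I.added o i) e * b = 2 * r e)
    (hmin : ∀ f, I.mult (I.added o i) f * b ≤ 2 * r f) {o' : ℕ → ℕ}
    (ho' : ∀ j, o' j = if j = i then (e : ℕ) + 1 else o j) {r' : Fin I.G.m → ℝ}
    (hr' : ∀ f, r' f = 2 * r f - I.mult (I.added o i) f * b) : I.GrowInv (i + 1) o' r' := by
  have heJ : e ∉ I.added o i := fun h' => he (mult_eq_zero h')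
  have hpre : ∀ j ≤ i, I.added o' j = I.added o j := fun j hj =>
    added_congr fun l hl => by rw [ho', if_neg (by omega)]
  have hadd : I.added o' (i + 1) = insert e (I.added o i) := by
    ext f
    rw [Finset.mem_insert, mem_added, mem_added]
    constructor
    · rintro ⟨j, hj, hj'⟩
      rw [ho'] at hj'
      split_ifs at hj' with hji
      · exact Or.inl (Fin.ext (by omega))
      · exact Or.inr ⟨j, by omega, hj'⟩
    · rintro (rfl | ⟨j, hj, hj'⟩)
      · exact ⟨i, by omega, by rw [ho', if_pos rfl]⟩
      · exact ⟨j, by omega, by rw [ho', if_neg (by omega), hj']⟩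
  have hb0 : 0 ≤ b := by
    have h1 : (0 : ℝ) < I.mult (I.added o i) e := by exact_mod_cast Nat.pos_of_ne_zero he
    have h2 := h.nonneg e
    by_contra hneg
    nlinarith
  have hnew : ∀ j, o j ≠ (e : ℕ) + 1 := by
    intro j hj
    refine heJ (mem_added.2 ⟨j, ?_, hj⟩)
    by_contra hji
    rw [h.zero j (by omega)] at hj
    omega
  refine ⟨fun j hj => ?_, fun j j' h1 h2 => ?_, fun j => ?_, fun f => ?_, fun f hf => ?_, ?_,
    fun hf => ?_⟩
  · rw [ho', if_neg (by omega), h.zero j (by omega)]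
  · rw [ho'] at h1
    rw [ho', ho'] at h2
    split_ifs at h1 h2 with e1 e2 e2
    · omega
    · exact absurd h2.symm (hnew j')
    · exact absurd h2 (hnew j)
    · exact h.inj j j' h1 h2
  · rw [ho']
    have := h.le j
    split_ifs <;> omega
  · rw [hr']
    linarith [hmin f]
  · rw [hadd, Finset.mem_insert] at hf
    rw [hr']
    rcases hf with rfl | hf
    · linarith
    · rw [mult_eq_zero hf, h.tight f hf]; simp
  · obtain ⟨θ, hθ, ε, hε, hε2, hc⟩ := h.dual
    -- Halving the scale undoes the doubling, as `θ * r f = θ / 2 * r' f + θ / 2 * b * mult f`; so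
    -- the dual increase is `θ / 2 * b`.
    refine ⟨θ / 2, by positivity, fun j => if j < i then ε j else if j = i then θ / 2 * b else 0,
      fun j => ?_, fun j hj => ?_, fun f => ?_⟩
    · dsimp only
      split_ifs
      · exact hε j
      · positivity
      · exact le_rfl
    · dsimp only at hj
      split_ifs at hj with h1 h3
      · rw [hpre j (by omega)]; exact hε2 j hj
      · rw [h3, hpre i le_rfl]; exact h2
      · exact absurd rfl hj
    · dsimp only
      rw [Finset.sum_range_succ, if_neg (lt_irrefl i), if_pos rfl, hpre i le_rfl, hc f, hr']
      have : ∑ j ∈ Finset.range i, (if j < i then ε j else if j = i then θ / 2 * b else 0) *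
          (I.mult (I.added o' j) f : ℝ) =
          ∑ j ∈ Finset.range i, ε j * I.mult (I.added o j) f := by
        refine Finset.sum_congr rfl fun j hj => ?_
        rw [Finset.mem_range] at hj
        rw [if_pos hj, hpre j hj.le]
      rw [this]
      ring
  · right
    rw [hadd, Finset.card_insert_of_notMem heJ]
    rcases h.progress hf with h1 | h1
    · rw [isSolution_iff_card] at h1
      omega
    · omega

theorem GrowInv.isSolution (h : I.GrowInv I.G.m o r) (hf : ∃ J, I.IsSolution J) :
    I.IsSolution (I.added o I.G.m) := by
  rcases h.progress hf with h1 | h1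
  · exact h1
  · have : I.added o I.G.m = Finset.univ := by
      rw [← Finset.card_eq_iff_eq_univ, Fintype.card_fin]
      exact le_antisymm ((Finset.card_le_univ _).trans (by simp)) h1
    obtain ⟨J, hJ⟩ := hf
    rw [this]
    exact hJ.mono (Finset.subset_univ J)

/-! ### The deletion phase and the cost bound -/

/-- The invariant of the deletion phase: the edges added at time `p` or later have been
examined. -/
structure PruneInv (I : SmallCutsInstance) (o : ℕ → ℕ) (p : ℕ) (K : Finset (Fin I.G.m)) :
    Prop where
  sol : I.IsSolution K
  sup : I.added o p ⊆ K
  sub : K ⊆ I.added o I.G.m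
  -- The cut is also uncovered by the edges added before `e`, including those deleted later; hence
  -- it is still small in every round up to the addition of `e`.
  wit : ∀ e ∈ K, ∀ j ≥ p, o j = (e : ℕ) + 1 → ∃ S, S.Nonempty ∧ S ≠ Finset.univ ∧
    I.H.cutSize S < I.k ∧ Separates S (I.G.fst e) (I.G.snd e) ∧
    ∀ f ∈ K ∪ I.added o j, Separates S (I.G.fst f) (I.G.snd f) → f = e

variable {p : ℕ} {K : Finset (Fin I.G.m)}

theorem PruneInv.skip (h : I.PruneInv o (p + 1) K) (hp : o p = 0) : I.PruneInv o p K where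
  sol := h.sol
  sup := (added_mono o (Nat.le_succ p)).trans h.sup
  sub := h.sub
  wit e he j hj hje := by
    refine h.wit e he j ?_ hje
    by_contra hlt
    have : j = p := by omega
    rw [this, hp] at hje
    omega

theorem PruneInv.delete (h : I.PruneInv o (p + 1) K)
    (hinj : ∀ j j', o j ≠ 0 → o j = o j' → j = j') {e : Fin I.G.m} (hp : o p = (e : ℕ) + 1)
    (hsol : I.IsSolution (K.erase e)) : I.PruneInv o p (K.erase e) where
  sol := hsol
  sup f hf := by
    refine Finset.mem_erase.2 ⟨?_, h.sup (added_mono o (Nat.le_succ p) hf)⟩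
    rintro rfl
    obtain ⟨j, hj, hj'⟩ := mem_added.1 hf
    have := hinj j p (by omega) (hj'.trans hp.symm)
    omega
  sub := (Finset.erase_subset _ _).trans h.sub
  wit f hf j hj hjf := by
    rw [Finset.mem_erase] at hf
    have hjp : j ≠ p := by
      rintro rfl
      exact hf.1 (Fin.ext (by omega))
    obtain ⟨S, h1, h2, h3, h4, h5⟩ := h.wit f hf.2 j (by omega) hjf
    exact ⟨S, h1, h2, h3, h4, fun g hg =>
      h5 g (Finset.union_subset_union_left (Finset.erase_subset _ _) hg)⟩

/-- A small cut that `K.erase e` misses serves as the witness. All edges added before `e` are still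
in `K.erase e`, so they miss it too, and `e` covers it because `K` is a solution. -/
theorem PruneInv.keep (h : I.PruneInv o (p + 1) K)
    (hinj : ∀ j j', o j ≠ 0 → o j = o j' → j = j') {e : Fin I.G.m} (hp : o p = (e : ℕ) + 1)
    (hsol : ¬ I.IsSolution (K.erase e)) : I.PruneInv o p K where
  sol := h.sol
  sup := (added_mono o (Nat.le_succ p)).trans h.sup
  sub := h.sub
  wit f hf j hj hjf := by
    by_cases hjp : j = p
    · subst hjp
      have hfe : f = e := Fin.ext (by omega)
      subst hfe
      rw [isSolution_iff] at hsol
      push Not at hsol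
      obtain ⟨S, hS, hne⟩ := hsol
      rw [isSmall_residualCut] at hS
      have hsub : I.added o j ⊆ K.erase f := fun g hg => by
        refine Finset.mem_erase.2 ⟨?_, h.sup (added_mono o (Nat.le_succ j) hg)⟩
        rintro rfl
        obtain ⟨l, hl, hl'⟩ := mem_added.1 hg
        have := hinj l j (by omega) (hl'.trans hp.symm)
        omega
      have honly : ∀ g ∈ K ∪ I.added o j, Separates S (I.G.fst g) (I.G.snd g) → g = f := by
        intro g hg hs
        by_contra hgf
        rcases Finset.mem_union.1 hg with hg | hg
        · exact hS.2.2 g (Finset.mem_erase.2 ⟨hgf, hg⟩) hs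
        · exact hS.2.2 g (hsub hg) hs
      refine ⟨S, hS.1, hne, hS.2.1, ?_, honly⟩
      obtain ⟨g, hg⟩ := Finset.card_pos.1 (h.sol S ⟨hS.1, hne, hS.2.1⟩)
      rw [Multigraph.delta, Finset.mem_filter] at hg
      have hgf := honly g (Finset.mem_union_left _ hg.1) hg.2
      exact hgf ▸ hg.2
    · exact h.wit f hf j (by omega) hjf

/-- Edges chosen before round `i` have multiplicity 0. Each other edge of `K` was added in some
round `j ≥ i`, and its witness is uncovered by the first `j` edges, hence small in round `i`. -/
theorem PruneInv.sum_mult_le (h : I.PruneInv o 0 K) (i : ℕ) :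
    ∑ e ∈ K, I.mult (I.added o i) e ≤
      5 * (minSmall (I.residualCut (I.added o i)) I.k).card := by
  classical
  have h1 : ∑ e ∈ K, I.mult (I.added o i) e =
      ∑ e ∈ K \ I.added o i, I.mult (I.added o i) e := by
    refine (Finset.sum_subset Finset.sdiff_subset fun e he he' => mult_eq_zero ?_).symm
    by_contra hne
    exact he' (Finset.mem_sdiff.2 ⟨he, hne⟩)
  rw [h1, sum_mult]
  refine sum_card_separates_le_five_mul I.endA I.endB (I.weight (I.added o i)) I.k I.G.fst
    I.G.snd (K \ I.added o i) fun e he => ?_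
  rw [Finset.mem_sdiff] at he
  obtain ⟨j, hj, hje⟩ := mem_added.1 (h.sub he.1)
  have hij : i ≤ j := by
    by_contra hlt
    exact he.2 (mem_added.2 ⟨j, by omega, hje⟩)
  obtain ⟨S, h1, h2, h3, h4, h5⟩ := h.wit e he.1 j (Nat.zero_le j) hje
  refine ⟨S, isSmall_residualCut.2 ⟨h1, h3, fun f hf hs => ?_⟩, h2, h4, fun f hf hs => ?_⟩
  · have := h5 f (Finset.mem_union_right _ (added_mono o hij hf)) hs
    exact he.2 (this ▸ hf)
  · exact h5 f (Finset.mem_union_left _ (Finset.mem_sdiff.1 hf).1) hs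

/-- Weak duality. The edges of `K` are tight, so its cost is the sum over `j` of `ε j` times the
total degree in `K` of the minimal small sets of round `j`, which is at most 5 times their number. A
solution `J` covers each of them and pays at least `ε j` times that number. -/
theorem cost_le_five_mul (hG : I.GrowInv I.G.m o r) (hP : I.PruneInv o 0 K)
    {J : Finset (Fin I.G.m)} (hJ : I.IsSolution J) : I.cost K ≤ 5 * I.cost J := by
  obtain ⟨θ, hθ, ε, hε, hε2, hc⟩ := hG.dual
  have hK : I.cost K = ∑ j ∈ Finset.range I.G.m,
      ε j * ((∑ e ∈ K, I.mult (I.added o j) e : ℕ) : ℝ) := by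
    unfold cost
    rw [Finset.sum_congr rfl fun e he => by
      rw [hc e, hG.tight e (hP.sub he), mul_zero, zero_add], Finset.sum_comm]
    refine Finset.sum_congr rfl fun j _ => ?_
    rw [Nat.cast_sum, Finset.mul_sum]
  have hJ' : ∑ j ∈ Finset.range I.G.m,
      ε j * ((∑ e ∈ J, I.mult (I.added o j) e : ℕ) : ℝ) ≤ I.cost J := by
    unfold cost
    simp_rw [Nat.cast_sum, Finset.mul_sum]
    rw [Finset.sum_comm]
    refine Finset.sum_le_sum fun e _ => ?_
    rw [hc e]
    have := mul_nonneg hθ.le (hG.nonneg e)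
    linarith
  rw [hK]
  refine le_trans ?_ (mul_le_mul_of_nonneg_left hJ' (by norm_num))
  rw [Finset.mul_sum]
  refine Finset.sum_le_sum fun j _ => ?_
  by_cases h0 : ε j = 0
  · simp [h0]
  · have h1 := hP.sum_mult_le j
    have h2 := card_le_sum_mult (hε2 j h0) hJ
    have h3 : ((∑ e ∈ K, I.mult (I.added o j) e : ℕ) : ℝ) ≤
        5 * ((∑ e ∈ J, I.mult (I.added o j) e : ℕ) : ℝ) := by
      exact_mod_cast h1.trans (Nat.mul_le_mul_left 5 h2)
    calc _ ≤ ε j * (5 * ((∑ e ∈ J, I.mult (I.added o j) e : ℕ) : ℝ)) :=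
          mul_le_mul_of_nonneg_left h3 (hε j)
      _ = _ := by ring

end SmallCutsInstance

/-! ## The primal-dual program

Array 16 holds the selected edge, increased by one, and array 17 the order in which edges are chosen.
Array 0 of real numbers holds the residual costs, array 1 the best value and array 2 the current one. -/

namespace RAM.Cmd

/-- The label of the node at one end of edge number `c`; the ends are in the array `p`. -/
def labelAt (p c : ℕ) : NatExp := .load 6 (.load p (.var c))

/-- The ends of the edge have different labels. -/
def diffTest (c : ℕ) : Test := .not (.eq (labelAt 3 c) (labelAt 4 c))

/-- One of the labels of the ends of the edge is zero. -/
def zeroTest (c : ℕ) : Test := .or (.eq (labelAt 3 c) (.const 0)) (.eq (labelAt 4 c) (.const 0))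

/-- The residual cost of edge number `c`. -/
def residual (c : ℕ) : RealExp := .load 0 (.var c)

/-- Find the edge that becomes tight first. -/
def pickCmd : Cmd :=
  .seq (.setNat 16 (.const 0) (.const 0)) <|
  .loop 30 2 <|
    .ite (diffTest 30)
      -- Twice the residual cost divided by the multiplicity, without division: multiplicity 1 when
      -- one label is zero, and 2 otherwise.
      (.seq (.ite (zeroTest 30)
          (.setReal 2 (.const 0) (.add (residual 30) (residual 30)))
          (.setReal 2 (.const 0) (residual 30))) <|
        .ite (.or (.eq (.var 16) (.const 0))
            (.not (.realLe (.load 1 (.const 0)) (.load 2 (.const 0)))))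
          (.seq (.setNat 16 (.const 0) (.add (.var 30) (.const 1)))
            (.setReal 1 (.const 0) (.load 2 (.const 0))))
          .skip)
      .skip

/-- Update the residual costs, which are doubled at the same time. -/
def updateCmd : Cmd :=
  .loop 31 2 <|
    .seq (.setReal 0 (.var 31) (.add (residual 31) (residual 31))) <|
    -- The value of the chosen edge is subtracted as many times as the multiplicity says.
    .ite (diffTest 31)
      (.seq (.setReal 0 (.var 31) (.sub (residual 31) (.load 1 (.const 0)))) <|
        .ite (zeroTest 31) .skip
          (.setReal 0 (.var 31) (.sub (residual 31) (.load 1 (.const 0)))))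
      .skip

/-- Choose one more edge, if there are uncovered cuts. -/
def growStep : Cmd :=
  .seq labelCmd <|
  .ite (.natLe (.const 2) (.var 7))
    (.seq pickCmd <|
      .ite (.not (.eq (.var 16) (.const 0)))
        (.seq updateCmd <|
          .seq (.setNat 5 (.sub (.var 16) (.const 1)) (.const 1))
            (.setNat 17 (.var 32) (.var 16)))
        .skip)
    .skip

/-- The edge that is examined in the current step of the deletion phase, increased by one. -/
def pruneEdge : NatExp := .load 17 (.sub (.load 0 (.const 2)) (.add (.var 33) (.const 1)))

/-- Delete one more edge, if it is redundant. -/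
def pruneStep : Cmd :=
  .ite (.not (.eq pruneEdge (.const 0)))
    (.seq (.setNat 5 (.sub pruneEdge (.const 1)) (.const 0)) <|
      .seq labelCmd <|
      .ite (.natLe (.const 2) (.var 7)) (.setNat 5 (.sub pruneEdge (.const 1)) (.const 1)) .skip)
    .skip

/-- The primal-dual method with reverse deletion. -/
def mainCmd : Cmd := .seq (.loop 32 2 growStep) (.loop 33 2 pruneStep)

end RAM.Cmd

theorem RAM.State.real_setReal_of_ne (s : RAM.State) (a i : ℕ) (v : ℝ) {b : ℕ} (h : b ≠ a) :
    (s.setReal a i v).real b = s.real b := by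
  funext j; simp [h]

/-! ### Correctness of the edge selection and of the cost update -/

namespace SmallCutsInstance

open RAM

variable {I : SmallCutsInstance} {s : State}

/-- The number of labeled sets that an edge covers. -/
def labelMult (I : SmallCutsInstance) (s : State) (e : Fin I.G.m) : ℕ :=
  if s.nat 6 (I.G.fst e) = s.nat 6 (I.G.snd e) then 0
  else (if s.nat 6 (I.G.fst e) = 0 then 0 else 1) + if s.nat 6 (I.G.snd e) = 0 then 0 else 1

/-- Twice the residual cost, divided by the number of labeled sets that the edge covers. -/
noncomputable def edgeValue (I : SmallCutsInstance) (s : State) (e : Fin I.G.m) : ℝ :=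
  if s.nat 6 (I.G.fst e) = 0 ∨ s.nat 6 (I.G.snd e) = 0 then s.real 0 e + s.real 0 e
  else s.real 0 e

theorem labelMult_mul_edgeValue {e : Fin I.G.m} (h : I.labelMult s e ≠ 0) :
    I.labelMult s e * I.edgeValue s e = 2 * s.real 0 e := by
  unfold labelMult edgeValue at *
  split_ifs at * with h1 h2 h3 h4 <;> first | omega | (push_cast; ring)

theorem holds_diffTest {s' : State} (h : I.Loaded s') (h6 : s'.nat 6 = s.nat 6) {c : ℕ}
    {e : Fin I.G.m} (hc : s'.nat c 0 = e) : (Cmd.diffTest c).Holds s' ↔ I.labelMult s e ≠ 0 := by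
  rw [Cmd.diffTest, Test.holds_not, Test.holds_eq]
  simp only [Cmd.labelAt, NatExp.eval, NatExp.eval_var, hc, h.fstG, h.sndG, h6, labelMult]
  split_ifs <;> simp_all

theorem holds_zeroTest {s' : State} (h : I.Loaded s') (h6 : s'.nat 6 = s.nat 6) {c : ℕ}
    {e : Fin I.G.m} (hc : s'.nat c 0 = e) :
    (Cmd.zeroTest c).Holds s' ↔ s.nat 6 (I.G.fst e) = 0 ∨ s.nat 6 (I.G.snd e) = 0 := by
  rw [Cmd.zeroTest, Test.holds_or, Test.holds_eq, Test.holds_eq]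
  simp only [Cmd.labelAt, NatExp.eval, NatExp.eval_var, hc, h.fstG, h.sndG, h6]

theorem run_pickCmd (h : I.Loaded s) :
    (Cmd.pickCmd.run s).real 0 = s.real 0 ∧
    (((Cmd.pickCmd.run s).nat 16 0 = 0 ∧ ∀ e, I.labelMult s e = 0) ∨
      ∃ e : Fin I.G.m, (Cmd.pickCmd.run s).nat 16 0 = e + 1 ∧ I.labelMult s e ≠ 0 ∧
        (Cmd.pickCmd.run s).real 1 0 = I.edgeValue s e ∧
        ∀ f, I.labelMult s f ≠ 0 → I.edgeValue s e ≤ I.edgeValue s f) := by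
  have key : (Cmd.pickCmd.run s).real 0 = s.real 0 ∧
      (((Cmd.pickCmd.run s).nat 16 0 = 0 ∧
        ∀ e : Fin I.G.m, (e : ℕ) < I.G.m → I.labelMult s e = 0) ∨
      ∃ e : Fin I.G.m, (e : ℕ) < I.G.m ∧ (Cmd.pickCmd.run s).nat 16 0 = e + 1 ∧
        I.labelMult s e ≠ 0 ∧ (Cmd.pickCmd.run s).real 1 0 = I.edgeValue s e ∧
        ∀ f : Fin I.G.m, (f : ℕ) < I.G.m → I.labelMult s f ≠ 0 →
          I.edgeValue s e ≤ I.edgeValue s f) := by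
    unfold Cmd.pickCmd
    rw [Cmd.run_seq, Cmd.run_setNat]
    refine Cmd.run_loop_induction (n := I.G.m) _ (fun (i : ℕ) (s' : State) =>
      s'.real 0 = s.real 0 ∧
      ((s'.nat 16 0 = 0 ∧ ∀ e : Fin I.G.m, (e : ℕ) < i → I.labelMult s e = 0) ∨
      ∃ e : Fin I.G.m, (e : ℕ) < i ∧ s'.nat 16 0 = e + 1 ∧ I.labelMult s e ≠ 0 ∧
        s'.real 1 0 = I.edgeValue s e ∧
        ∀ f : Fin I.G.m, (f : ℕ) < i → I.labelMult s f ≠ 0 →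
          I.edgeValue s e ≤ I.edgeValue s f)) ?_ ?_ ?_
    · rw [State.nat_setNat_of_ne _ _ _ _ (by decide), h.mG]
    · exact ⟨rfl, Or.inl ⟨by simp [NatExp.eval], fun e he => absurd he (Nat.not_lt_zero _)⟩⟩
    · rintro i hi s' hs' - hc ⟨hr, hP⟩
      have fr : ∀ a, a ∉ [16, 30] → s'.nat a = s.nat a := by
        intro a ha
        simp only [List.mem_cons, List.not_mem_nil, not_or, or_false] at ha
        rw [hs' a (by simp [Cmd.writes, ha]), State.nat_setNat_of_ne _ _ _ _ ha.1]
      have hL : I.Loaded s' := h.of_eq fun a ha => fr a (by simp; omega)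
      set e : Fin I.G.m := ⟨i, hi⟩ with he
      have hce : s'.nat 30 0 = e := hc
      have hlt : ∀ u : Fin I.G.m, (u : ℕ) < i + 1 → u ≠ e → (u : ℕ) < i := fun u hu hne => by
        have : (u : ℕ) ≠ i := fun hui => hne (Fin.ext hui)
        omega
      rw [Cmd.run]
      split_ifs with ht
      · rw [holds_diffTest hL (fr 6 (by decide)) hce] at ht
        rw [Cmd.run_seq]
        generalize hs2 : Cmd.run _ s' = s2
        have hn2 : s2.nat = s'.nat := by
          rw [← hs2, Cmd.run]
          split_ifs <;> rfl
        have hr2 : s2.real 0 = s.real 0 ∧ s2.real 1 = s'.real 1 ∧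
            s2.real 2 0 = I.edgeValue s e := by
          rw [← hs2, Cmd.run]
          have hz := holds_zeroTest hL (fr 6 (by decide)) hce
          unfold edgeValue
          split_ifs with hz' hz'' hz''
          · refine ⟨?_, ?_, ?_⟩
            · exact (State.real_setReal_of_ne _ _ _ _ (by decide)).trans hr
            · exact State.real_setReal_of_ne _ _ _ _ (by decide)
            · simp [Cmd.run, Cmd.residual, RealExp.eval, NatExp.eval, NatExp.eval_var, hce, hr]
          · exact absurd (hz.1 hz') hz''
          · exact absurd (hz.2 hz'') hz'
          · refine ⟨?_, ?_, ?_⟩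
            · exact (State.real_setReal_of_ne _ _ _ _ (by decide)).trans hr
            · exact State.real_setReal_of_ne _ _ _ _ (by decide)
            · simp [Cmd.run, Cmd.residual, RealExp.eval, NatExp.eval, NatExp.eval_var, hce, hr]
        obtain ⟨q0, q1, q2⟩ := hr2
        rw [Cmd.run]
        split_ifs with ht'
        · rw [Test.holds_or, Test.holds_eq, Test.holds_not] at ht'
          simp only [NatExp.eval, NatExp.eval_var, RealExp.eval, hn2, q1, q2, Test.Holds,
            not_le] at ht'
          refine ⟨?_, Or.inr ⟨e, by simp [he], ?_, ht, ?_, ?_⟩⟩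
          · rw [← q0]
            funext j
            simp [Cmd.run]
          · simp [Cmd.run, NatExp.eval, NatExp.eval_var, hn2, hc, he]
          · simp [Cmd.run, NatExp.eval, RealExp.eval, q2]
          · intro f hf hfm
            by_cases hfe : f = e
            · rw [hfe]
            · have hfi := hlt f hf hfe
              rcases hP with ⟨-, hP⟩ | ⟨g, hg, h1, h2, h3, h4⟩
              · exact absurd (hP f hfi) hfm
              · have := h4 f hfi hfm
                rcases ht' with h5 | h5
                · omega
                · linarith
        · rw [Test.holds_or, Test.holds_eq, Test.holds_not] at ht'
          simp only [NatExp.eval, NatExp.eval_var, RealExp.eval, hn2, q1, q2, Test.Holds,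
            not_or, not_not] at ht'
          rcases hP with ⟨hP, -⟩ | ⟨g, hg, h1, h2, h3, h4⟩
          · exact absurd hP ht'.1
          · refine ⟨q0, Or.inr ⟨g, by omega, ?_, h2, ?_, ?_⟩⟩
            · simpa [Cmd.run, hn2] using h1
            · simpa [Cmd.run, q1] using h3
            · intro f hf hfm
              by_cases hfe : f = e
              · rw [hfe, ← h3]; exact ht'.2
              · exact h4 f (hlt f hf hfe) hfm
      · rw [holds_diffTest hL (fr 6 (by decide)) hce, not_not] at ht
        have hne : ∀ f : Fin I.G.m, I.labelMult s f ≠ 0 → f ≠ e := by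
          rintro f hf rfl
          exact hf ht
        refine ⟨hr, ?_⟩
        rcases hP with ⟨hP, hP'⟩ | ⟨g, hg, h1, h2, h3, h4⟩
        · left
          refine ⟨by simpa [Cmd.run] using hP, fun f hf => ?_⟩
          by_contra hfm
          exact hfm (hP' f (hlt f hf (hne f hfm)))
        · right
          exact ⟨g, by omega, by simpa [Cmd.run] using h1, h2, by simpa [Cmd.run] using h3,
            fun f hf hfm => h4 f (hlt f hf (hne f hfm)) hfm⟩
  refine ⟨key.1, ?_⟩
  rcases key.2 with ⟨h1, h2⟩ | ⟨e, he, h1, h2, h3, h4⟩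
  · exact Or.inl ⟨h1, fun e => h2 e e.2⟩
  · exact Or.inr ⟨e, h1, h2, h3, fun f => h4 f f.2⟩

theorem run_updateCmd (h : I.Loaded s) (e : Fin I.G.m) :
    (Cmd.updateCmd.run s).real 0 e = 2 * s.real 0 e - I.labelMult s e * s.real 1 0 := by
  have key : (Cmd.updateCmd.run s).real 1 = s.real 1 ∧
      ∀ e : Fin I.G.m, (Cmd.updateCmd.run s).real 0 e = if (e : ℕ) < I.G.m then
        2 * s.real 0 e - I.labelMult s e * s.real 1 0 else s.real 0 e := by
    refine Cmd.run_loop_induction (n := I.G.m) _ (fun (i : ℕ) (s' : State) =>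
      s'.real 1 = s.real 1 ∧ ∀ e : Fin I.G.m, s'.real 0 e = if (e : ℕ) < i then
        2 * s.real 0 e - I.labelMult s e * s.real 1 0 else s.real 0 e) h.mG ?_ ?_
    · exact ⟨rfl, fun e => by simp⟩
    · rintro i hi s' hs' - hc ⟨h1, hP⟩
      have fr : ∀ a, a ≠ 31 → s'.nat a = s.nat a := fun a ha =>
        hs' a (by simp [Cmd.writes, ha])
      have hL : I.Loaded s' := h.of_eq fun a ha => fr a (by omega)
      set e : Fin I.G.m := ⟨i, hi⟩ with he
      have hce : s'.nat 31 0 = e := hc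
      have hPe : s'.real 0 e = s.real 0 e := by rw [hP, if_neg (by simp [he])]
      rw [Cmd.run_seq]
      generalize hs2 : Cmd.run _ s' = s2
      have hn2 : s2.nat = s'.nat := by rw [← hs2]; rfl
      have hL2 : I.Loaded s2 := hL.of_eq fun a _ => by rw [hn2]
      have h12 : s2.real 1 = s.real 1 := by
        rw [← hs2, ← h1]
        exact State.real_setReal_of_ne _ _ _ _ (by decide)
      have h02 : ∀ j, s2.real 0 j = if j = e then 2 * s.real 0 e else s'.real 0 j := by
        intro j
        rw [← hs2]
        simp [Cmd.run, Cmd.residual, RealExp.eval, NatExp.eval_var, hce, hPe, two_mul]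
      have hd := holds_diffTest (s := s) hL2 (by rw [hn2, fr 6 (by decide)]) (c := 31) (e := e)
        (by rw [hn2, hce])
      have hz := fun s3 : State => fun hn3 : s3.nat = s2.nat =>
        holds_zeroTest (s := s) (I := I) (s' := s3) (hL2.of_eq fun a _ => by rw [hn3])
          (by rw [hn3, hn2, fr 6 (by decide)]) (c := 31) (e := e) (by rw [hn3, hn2, hce])
      have fin : ∀ s3 : State, s3.real 1 = s.real 1 →
          (∀ j, s3.real 0 j = if j = e then
            2 * s.real 0 e - I.labelMult s e * s.real 1 0 else s'.real 0 j) →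
          (s3.setNat 31 0 (i + 1)).real 1 = s.real 1 ∧
          ∀ f : Fin I.G.m, (s3.setNat 31 0 (i + 1)).real 0 f = if (f : ℕ) < i + 1 then
            2 * s.real 0 f - I.labelMult s f * s.real 1 0 else s.real 0 f := by
        intro s3 q1 q2
        refine ⟨q1, fun f => ?_⟩
        rw [State.real_setNat, q2]
        by_cases hfe : f = e
        · rw [if_pos (by rw [hfe]), if_pos (by rw [hfe]; simp [he]), hfe]
        · have hne : (f : ℕ) ≠ i := fun hfi => hfe (Fin.ext hfi)
          rw [if_neg (by simpa [he] using hne), hP]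
          by_cases hlt : (f : ℕ) < i
          · rw [if_pos hlt, if_pos (by omega)]
          · rw [if_neg hlt, if_neg (by omega)]
      rw [Cmd.run]
      split_ifs with ht
      · rw [hd] at ht
        rw [Cmd.run_seq]
        generalize hs3 : Cmd.run _ s2 = s3
        have hn3 : s3.nat = s2.nat := by rw [← hs3]; rfl
        have h13 : s3.real 1 = s.real 1 := by
          rw [← hs3, ← h12]
          exact State.real_setReal_of_ne _ _ _ _ (by decide)
        have h03 : ∀ j, s3.real 0 j = if j = e then 2 * s.real 0 e - s.real 1 0
            else s'.real 0 j := by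
          intro j
          rw [← hs3]
          simp only [Cmd.run, Cmd.residual, RealExp.eval, NatExp.eval_var, NatExp.eval,
            State.real_setReal, hn2, hce, h02, h12, true_and, if_true]
          split_ifs <;> rfl
        have hz3 := hz s3 hn3
        rw [Cmd.run]
        split_ifs with ht'
        · rw [hz3] at ht'
          have hm : I.labelMult s e = 1 := by
            unfold labelMult at ht ⊢
            split_ifs at ht ⊢ <;> omega
          refine fin _ h13 fun j => ?_
          rw [Cmd.run, h03, hm, Nat.cast_one, one_mul]
        · rw [hz3] at ht'
          have hm : I.labelMult s e = 2 := by
            unfold labelMult at ht ⊢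
            split_ifs at ht ⊢ <;> omega
          refine fin _ ((State.real_setReal_of_ne _ _ _ _ (by decide)).trans h13) fun j => ?_
          simp only [Cmd.run, Cmd.residual, RealExp.eval, NatExp.eval_var, NatExp.eval,
            State.real_setReal, hn3, hn2, hce, h03, h13, true_and, if_true, hm]
          split_ifs
          · push_cast; ring
          · rfl
      · rw [hd, not_not] at ht
        refine fin _ h12 fun j => ?_
        rw [Cmd.run, h02, ht, Nat.cast_zero, zero_mul, sub_zero]
  rw [key.2 e, if_pos e.2]

end SmallCutsInstance

/-! ### Correctness of the two phases of the program -/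

namespace SmallCutsInstance

open RAM

variable {I : SmallCutsInstance} {s : State} {i : ℕ}

theorem labelMult_run_labelCmd (h : I.Loaded s) (e : Fin I.G.m) :
    I.labelMult (Cmd.labelCmd.run s) e = I.mult (I.output s) e :=
  ((run_labelCmd h).card_separates (I.G.fst e) (I.G.snd e)).symm

theorem labelMult_mul_le {e : Fin I.G.m} (h : 0 ≤ s.real 0 e) {b : ℝ}
    (hb : I.labelMult s e ≠ 0 → b ≤ I.edgeValue s e) :
    I.labelMult s e * b ≤ 2 * s.real 0 e := by
  by_cases h0 : I.labelMult s e = 0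
  · rw [h0, Nat.cast_zero, zero_mul]
    linarith
  · rw [← labelMult_mul_edgeValue h0]
    exact mul_le_mul_of_nonneg_left (hb h0) (Nat.cast_nonneg _)

theorem growStep_writes {a : ℕ} (ha : a < 5) : a ∉ Cmd.growStep.writes := by
  have h1 := labelCmd_writes (a := a) (Or.inl (by omega))
  simp only [Cmd.growStep, Cmd.pickCmd, Cmd.updateCmd, Cmd.writes, List.mem_append, List.mem_cons,
    List.not_mem_nil, h1, false_or, or_false, not_or]
  omega

theorem run_growStep (h : I.Loaded s) (hc : s.nat 32 0 = i)
    (hinv : I.GrowInv i (s.nat 17) fun e => s.real 0 e)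
    (hout : I.output s = I.added (s.nat 17) i) :
    I.GrowInv (i + 1) ((Cmd.growStep.run s).nat 17) (fun e => (Cmd.growStep.run s).real 0 e) ∧
      I.output (Cmd.growStep.run s) = I.added ((Cmd.growStep.run s).nat 17) (i + 1) := by
  have hcard := (run_labelCmd h).card_eq
  have hmult := labelMult_run_labelCmd h
  have hreal := Cmd.run_real Cmd.labelCmd s rfl
  have hnat : ∀ a, (a < 6 ∨ (15 < a ∧ a < 20) ∨ 29 < a) →
      (Cmd.labelCmd.run s).nat a = s.nat a := fun a ha => Cmd.run_nat _ _ (labelCmd_writes ha)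
  rw [Cmd.growStep, Cmd.run_seq]
  generalize Cmd.labelCmd.run s = s1 at *
  have h1 : I.Loaded s1 := h.of_eq fun a ha => hnat a (by omega)
  rw [← output_congr (hnat 5 (by omega))] at hout hcard
  simp only [← output_congr (I := I) (hnat 5 (by omega)), hout] at hmult
  rw [← hnat 17 (by omega)] at hinv hout
  rw [← hreal] at hinv
  rw [← hnat 32 (by omega)] at hc
  rw [← hnat 17 (by omega)] at hmult
  rw [hout] at hcard
  clear hreal hnat h
  -- Covers both ways of adding nothing: the edges already form a solution, or no edge has positive
  -- multiplicity, which `exists_mult_ne_zero` excludes on feasible instances.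
  have idle : ∀ s2 : State, s2.nat 17 = s1.nat 17 → s2.nat 5 = s1.nat 5 →
      s2.real 0 = s1.real 0 →
      ((∃ J, I.IsSolution J) → I.IsSolution (I.added (s1.nat 17) i)) →
      I.GrowInv (i + 1) (s2.nat 17) (fun e => s2.real 0 e) ∧
        I.output s2 = I.added (s2.nat 17) (i + 1) := by
    intro s2 e1 e2 e3 hs
    rw [e1, e3, output_congr e2, hout]
    refine ⟨hinv.idle hs, (added_mono _ (Nat.le_succ i)).antisymm fun e he => ?_⟩
    rw [mem_added] at *
    obtain ⟨j, hj, hj'⟩ := he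
    refine ⟨j, ?_, hj'⟩
    by_contra hji
    rw [hinv.zero j (by omega)] at hj'
    omega
  rw [Cmd.run]
  split_ifs with ht
  · have h2 : 2 ≤ s1.nat 7 0 := ht
    rw [← hcard] at h2
    obtain ⟨p1, p2⟩ := run_pickCmd h1
    have hnat : ∀ a, a ≠ 16 → a ≠ 30 → (Cmd.pickCmd.run s1).nat a = s1.nat a := fun a ha hb =>
      Cmd.run_nat _ _ (by simp [Cmd.pickCmd, Cmd.writes, ha, hb])
    rw [Cmd.run_seq]
    generalize Cmd.pickCmd.run s1 = s2 at *
    have hL2 : I.Loaded s2 := h1.of_eq fun a ha => hnat a (by omega) (by omega)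
    rw [Cmd.run]
    split_ifs with ht'
    · rw [Test.holds_not, Test.holds_eq, NatExp.eval_var] at ht'
      obtain ⟨e, e1, e2, e3, e4⟩ := p2.resolve_left fun hp => ht' hp.1
      have hu := run_updateCmd hL2
      have hnat' : ∀ a, a ≠ 31 → (Cmd.updateCmd.run s2).nat a = s2.nat a := fun a ha =>
        Cmd.run_nat _ _ (by simp [Cmd.updateCmd, Cmd.writes, ha])
      rw [Cmd.run_seq]
      generalize Cmd.updateCmd.run s2 = s3 at *
      have hlm : ∀ f, I.labelMult s2 f = I.mult (I.added (s1.nat 17) i) f := fun f => by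
        rw [← hmult, labelMult, labelMult, hnat 6 (by decide) (by decide)]
      have e16 : s3.nat 16 0 = e + 1 := by rw [hnat' 16 (by decide), e1]
      have e32 : s3.nat 32 0 = i := by
        rw [hnat' 32 (by decide), hnat 32 (by decide) (by decide), hc]
      have e17 : s3.nat 17 = s1.nat 17 := by
        rw [hnat' 17 (by decide), hnat 17 (by decide) (by decide)]
      have e5 : s3.nat 5 = s1.nat 5 := by
        rw [hnat' 5 (by decide), hnat 5 (by decide) (by decide)]
      set s4 := ((Cmd.setNat 5 (.sub (.var 16) (.const 1)) (.const 1)).seq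
        (Cmd.setNat 17 (.var 32) (.var 16))).run s3 with hs4
      have f17 : ∀ j, s4.nat 17 j = if j = i then (e : ℕ) + 1 else s1.nat 17 j := by
        intro j
        simp [hs4, Cmd.run, NatExp.eval, NatExp.eval_var, e16, e32, e17]
      have f5 : ∀ j, s4.nat 5 j = if j = e then 1 else s1.nat 5 j := by
        intro j
        simp [hs4, Cmd.run, NatExp.eval, NatExp.eval_var, e16, e5]
      have f0 : s4.real = s3.real := rfl
      have hmul : I.mult (I.added (s1.nat 17) i) e * s2.real 1 0 = 2 * s1.real 0 e := by
        rw [e3, ← hmult, labelMult_mul_edgeValue e2]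
      refine ⟨hinv.grow h2 (e := e) (b := s2.real 1 0) (hmult e ▸ e2) hmul (fun f => ?_) f17
        fun f => ?_, ?_⟩
      · rw [← hmult, e3]
        exact labelMult_mul_le (hinv.nonneg f) (e4 f)
      · rw [f0, hu, p1, hlm]
      · ext f
        have := congrArg (f ∈ ·) hout
        simp only [mem_output, mem_added, eq_iff_iff] at this
        rw [mem_output, f5, mem_added]
        simp only [f17]
        constructor
        · intro hf
          split_ifs at hf with hfe
          · exact ⟨i, by omega, by rw [if_pos rfl, hfe]⟩
          · obtain ⟨j, hj, hj'⟩ := this.1 hf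
            exact ⟨j, by omega, by rw [if_neg (by omega), hj']⟩
        · rintro ⟨j, hj, hj'⟩
          split_ifs at hj' with hji
          · rw [if_pos (by omega)]
            exact one_ne_zero
          · split_ifs
            · exact one_ne_zero
            · exact this.2 ⟨j, by omega, hj'⟩
    · rw [Test.holds_not, Test.holds_eq, NatExp.eval_var, not_not] at ht'
      refine idle s2 (hnat 17 (by decide) (by decide)) (hnat 5 (by decide) (by decide)) p1 ?_
      rintro ⟨J, hJ⟩
      obtain ⟨e, he⟩ := exists_mult_ne_zero h2 hJ
      rcases p2 with p2 | ⟨f, hf, -⟩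
      · exact absurd ((hmult e).symm.trans (p2.2 e)) he
      · exact absurd (hf.symm.trans ht') (Nat.succ_ne_zero _)
  · have h2 : ¬ 2 ≤ s1.nat 7 0 := ht
    refine idle s1 rfl rfl rfl fun _ => isSolution_iff_card.2 ?_
    omega

theorem PruneInv.init {o : ℕ → ℕ} {r : Fin I.G.m → ℝ} (h : I.GrowInv I.G.m o r)
    (hf : ∃ J, I.IsSolution J) : I.PruneInv o I.G.m (I.added o I.G.m) where
  sol := h.isSolution hf
  sup := subset_rfl
  sub := subset_rfl
  wit e _ j hj hje := by
    rw [h.zero j hj] at hje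
    omega

theorem pruneStep_writes {a : ℕ} (ha : a < 5 ∨ a = 17) : a ∉ Cmd.pruneStep.writes := by
  have h1 := labelCmd_writes (a := a) (by omega)
  simp only [Cmd.pruneStep, Cmd.writes, List.mem_append, List.mem_cons, List.not_mem_nil, h1,
    false_or, or_false, not_or]
  omega

/-- The edge is unmarked tentatively and the minimal small sets are recomputed; it is restored if
there are at least two of them. Round `i` looks at position `I.G.m - (i + 1)`, so the order is
reversed. -/
theorem run_pruneStep (h : I.Loaded s) (hc : s.nat 33 0 = i) (hi : i < I.G.m)
    {r : Fin I.G.m → ℝ} (hG : I.GrowInv I.G.m (s.nat 17) r)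
    (hP : I.PruneInv (s.nat 17) (I.G.m - i) (I.output s)) :
    I.PruneInv (s.nat 17) (I.G.m - (i + 1)) (I.output (Cmd.pruneStep.run s)) := by
  have hedge : ∀ s' : State, s'.nat 0 = s.nat 0 → s'.nat 17 = s.nat 17 → s'.nat 33 = s.nat 33 →
      Cmd.pruneEdge.eval s' = s.nat 17 (I.G.m - (i + 1)) := by
    intro s' e1 e2 e3
    simp only [Cmd.pruneEdge, NatExp.eval, NatExp.eval_var, e1, e2, e3, h.mG, hc]
  obtain ⟨p, hp⟩ : ∃ p, p = I.G.m - (i + 1) := ⟨_, rfl⟩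
  rw [← hp] at hedge ⊢
  rw [show I.G.m - i = p + 1 by omega] at hP
  rw [Cmd.pruneStep, Cmd.run]
  split_ifs with ht
  · rw [Test.holds_not, Test.holds_eq, hedge s rfl rfl rfl] at ht
    change s.nat 17 p ≠ 0 at ht
    obtain ⟨e, he⟩ : ∃ e : Fin I.G.m, s.nat 17 p = e + 1 :=
      ⟨⟨s.nat 17 p - 1, by have := hG.le p; omega⟩, by simp only; omega⟩
    rw [Cmd.run_seq, Cmd.run_setNat, Cmd.run_seq]
    simp only [NatExp.eval, hedge s rfl rfl rfl, he, Nat.add_sub_cancel]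
    have hout : I.output (s.setNat 5 e 0) = (I.output s).erase e := by
      ext f
      rw [mem_output, Finset.mem_erase, mem_output, State.nat_setNat]
      simp only [true_and]
      by_cases hfe : f = e
      · simp [hfe]
      · rw [if_neg fun h' => hfe (Fin.ext h')]
        simp [hfe]
    have hL : I.Loaded (s.setNat 5 e 0) := h.of_eq fun a ha => s.nat_setNat_of_ne _ _ _ (by omega)
    have hcard := (run_labelCmd hL).card_eq
    rw [hout] at hcard
    have hnat : ∀ a, a ≠ 5 → (a < 6 ∨ (15 < a ∧ a < 20) ∨ 29 < a) →
        (Cmd.labelCmd.run (s.setNat 5 e 0)).nat a = s.nat a := fun a h5 ha =>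
      (Cmd.run_nat _ _ (labelCmd_writes ha)).trans (s.nat_setNat_of_ne _ _ _ h5)
    have hnat5 : (Cmd.labelCmd.run (s.setNat 5 e 0)).nat 5 = (s.setNat 5 e 0).nat 5 :=
      Cmd.run_nat _ _ (labelCmd_writes (by omega))
    generalize Cmd.labelCmd.run (s.setNat 5 e 0) = s1 at *
    rw [Cmd.run]
    split_ifs with ht'
    · have h2 : 2 ≤ s1.nat 7 0 := ht'
      rw [Cmd.run_setNat]
      simp only [NatExp.eval, hedge s1 (hnat 0 (by omega) (by omega)) (hnat 17 (by omega) (by omega))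
        (hnat 33 (by omega) (by omega)), he, Nat.add_sub_cancel]
      have heq : I.output (s1.setNat 5 e 1) = I.output s := by
        ext f
        rw [mem_output, mem_output, State.nat_setNat, hnat5, State.nat_setNat]
        simp only [true_and]
        by_cases hfe : f = e
        · have : e ∈ I.output s := hP.sup (mem_added.2 ⟨p, by omega, he⟩)
          rw [mem_output] at this
          simp [hfe, this]
        · rw [if_neg fun h' => hfe (Fin.ext h'), if_neg fun h' => hfe (Fin.ext h')]
      rw [heq]
      refine hP.keep hG.inj he fun hs => ?_
      have := isSolution_iff_card.1 hs
      omega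
    · have h2 : ¬ 2 ≤ s1.nat 7 0 := ht'
      rw [Cmd.run, output_congr hnat5, hout]
      refine hP.delete hG.inj he (isSolution_iff_card.2 ?_)
      omega
  · rw [Test.holds_not, Test.holds_eq, hedge s rfl rfl rfl, not_not] at ht
    exact hP.skip ht

theorem run_mainCmd (I : SmallCutsInstance) : ∃ (o : ℕ → ℕ) (r : Fin I.G.m → ℝ),
    I.GrowInv I.G.m o r ∧
    ((∃ J, I.IsSolution J) → I.PruneInv o 0 (I.output (Cmd.mainCmd.run I.input))) := by
  have h0 : I.Loaded I.input := fun _ _ => rfl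
  have hgrow := Cmd.run_loop_induction (c := 32) (b := 2) (n := I.G.m) (p := Cmd.growStep) I.input
    (fun i s => I.GrowInv i (s.nat 17) (fun e => s.real 0 e) ∧
      I.output s = I.added (s.nat 17) i) h0.mG ?_ ?_
  · have hL : I.Loaded ((Cmd.loop 32 2 Cmd.growStep).run I.input) := h0.of_eq fun a ha =>
      Cmd.run_nat _ _ (by
        rw [Cmd.writes, List.mem_cons, not_or]
        exact ⟨by omega, growStep_writes ha⟩)
    rw [Cmd.mainCmd, Cmd.run_seq]
    generalize (Cmd.loop 32 2 Cmd.growStep).run I.input = s at *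
    refine ⟨_, _, hgrow.1, fun hf => ?_⟩
    have hprune := Cmd.run_loop_induction (c := 33) (b := 2) (n := I.G.m) (p := Cmd.pruneStep) s
      (fun i s' => I.PruneInv (s.nat 17) (I.G.m - i) (I.output s')) hL.mG ?_ ?_
    · rwa [Nat.sub_self] at hprune
    · rw [output_congr (s.nat_setNat_of_ne _ _ _ (by decide)), hgrow.2]
      exact PruneInv.init hgrow.1 hf
    · intro i hi s' hs' _ hc hP
      have hnat : ∀ a, (a < 5 ∨ a = 17) → s'.nat a = s.nat a := fun a ha => hs' a (by
        rw [Cmd.writes, List.mem_cons, not_or]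
        exact ⟨by omega, pruneStep_writes ha⟩)
      rw [output_congr (State.nat_setNat_of_ne _ _ _ _ (by decide)), ← hnat 17 (Or.inr rfl)]
      rw [← hnat 17 (Or.inr rfl)] at hP
      exact run_pruneStep (hL.of_eq fun a ha => hnat a (Or.inl ha)) hc hi
        (hnat 17 (Or.inr rfl) ▸ hgrow.1) hP
  · have h17 : (I.input.setNat 32 0 0).nat 17 = fun _ => 0 := by
      rw [State.nat_setNat_of_ne _ _ _ _ (by decide)]
      rfl
    have hr : (fun e : Fin I.G.m => (I.input.setNat 32 0 0).real 0 e) = I.c := by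
      funext e
      simp [input]
    rw [h17, hr]
    refine ⟨GrowInv.init, ?_⟩
    ext e
    simp [mem_added, input]
  · intro i hi s' hs' _ hc hP
    have hL : I.Loaded s' := h0.of_eq fun a ha => hs' a (by
      rw [Cmd.writes, List.mem_cons, not_or]
      exact ⟨by omega, growStep_writes ha⟩)
    have := run_growStep hL hc hP.1 hP.2
    rw [output_congr (State.nat_setNat_of_ne _ _ _ _ (by decide)),
      State.nat_setNat_of_ne _ _ _ _ (by decide)]
    exact this

end SmallCutsInstance

/-- Small Cuts Cover has a strongly polynomial algorithm with the claimed ratio. The program is the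
primal-dual method with reverse deletion; its ratio is even at most five, by `cost_le_five_mul`. -/
theorem mainTheorem3 :
    ∃ (p : RAM.Prog) (q : Polynomial ℕ), ∀ I : SmallCutsInstance,
      ∃ (t : ℕ) (s : RAM.State), RAM.Exec p I.input t s ∧ t ≤ q.eval I.size ∧
        ((∃ J, I.IsSolution J) →
          I.IsSolution (I.output s) ∧
          ∀ l : ℕ, I.H.IsEdgeConnected l →
            ∀ J, I.IsSolution J →
              I.cost (I.output s) ≤ (6 - 1 / ((betaParam I.k l : ℝ) + 1)) * I.cost J) := by
  refine ⟨RAM.Cmd.mainCmd.compile, RAM.Cmd.mainCmd.time, fun I => ?_⟩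
  obtain ⟨t, ht, h⟩ := RAM.Cmd.mainCmd.exec_compile (by decide) (by decide) I.size I.input (by
    intro j hj
    unfold SmallCutsInstance.size
    interval_cases j <;> simp only [SmallCutsInstance.input] <;> omega)
  obtain ⟨o, r, hG, hP⟩ := I.run_mainCmd
  refine ⟨t, _, h, ht, fun hf => ⟨(hP hf).sol, fun l _ J hJ => ?_⟩⟩
  refine (SmallCutsInstance.cost_le_five_mul hG (hP hf) hJ).trans
    (mul_le_mul_of_nonneg_right ?_ (Finset.sum_nonneg fun e _ => I.c_nonneg e))
  -- Only `β ≥ 0` is needed: the claimed factor is then at least 5.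
  have hβ : 1 / ((betaParam I.k l : ℝ) + 1) ≤ 1 := by
    rw [div_le_one (by positivity)]
    simp
  linarith
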